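/- Let $\mu$ be a finite measure on $\mathbb N=\{0,1,2,\dots\}$ with $\mu(0)>0$ and $\mu(1)=0$. Consider the continuous-time Bienaymé–Galton–Watson process in which individuals behave independently, each individual lives for an exponential time with parameter $\mu(\mathbb N)$ and at its death is replaced by a random number of children with law $\mu(\mathbb N)^{-1}\mu$, independent of its lifetime. Let $Z_r$ be the number of individuals alive at time $r$, let $\mathbb P_x$ be the law of the process started from $x$ individuals at time $0$, and let $\psi_r(s)=\mathbb E_1(s^{Z_r})=\sum_{n\ge 0}\mathbb P_1(Z_r=n)s^n$; primes denote derivatives in $s$. Let $t>0$ be the current time. If $2\le Z_t<\infty$, choose uniformly, given the genealogy, an ordered pair of two distinct individuals alive at time $t$, and let the coalescence time $T$ be the infimum of all $u\in(0,t]$ such that the two individuals have the same ancestor at time $t-u$ (with $\inf\emptyset=\infty$; an individual already alive at time $t-u$ counts as its own ancestor at that time); otherwise $T=\infty$. Write $\mathbb P^{(t)}$ for the resulting probability, under which the process starts from an arbitrary number $x$ of individuals. Let $0<t_2\le t$ and let $y\ge 1$ be an integer with $\mathbb P^{(t)}(Z_{t-t_2}=y)>0$. (i) For all $0<t_1\le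 t_2$ and $s\in[0,1)$, $\psi_{t_1}'(s)>0$, the variable $Z_t(Z_t-1)s^{Z_t-2}\mathbf 1_{\{T\le t_1\}}$ is integrable given $Z_{t-t_2}=y$, and $$\mathbb E^{(t)}\bigl(Z_t(Z_t-1)s^{Z_t-2},\,T\le t_1\mid Z_{t-t_2}=y\bigr)=y\,\psi_{t_2}'(s)\,\psi_{t_2}(s)^{y-1}\,\frac{\psi_{t_1}''(s)}{\psi_{t_1}'(s)}.$$ (ii) For every integer $p\ge 2$, the measure $\mathbb P^{(t)}(Z_t=p,\,T\in\cdot\mid Z_{t-t_2}=y)$ on $(0,t_2]$ has with respect to Lebesgue measure the density $$t_1\longmapsto y\sum_{n\ge 2}n\,\mu(n)\,\mathbb E\Bigl(\frac{Z^{(1)}_{t_2}(1)\,Z^{(2)}_{t_1}(n-1)}{p(p-1)},\ Z^{(0)}_{t_2}(y-1)+Z^{(1)}_{t_2}(1)+Z^{(2)}_{t_1}(n-1)=p\Bigr),$$ where $Z^{(0)},Z^{(1)},Z^{(2)}$ are independent copies of $Z$ and $Z^{(i)}_r(k)$ denotes the value of $Z^{(i)}$ at time $r$ when started from $k$ individuals.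 -/

import Mathlib

open MeasureTheory ProbabilityTheory Set
open scoped ENNReal

namespace BGW

/-- The family tree of a single founder. A (potential) individual is a word `v`: the founder is
`[]`, and for each child `j` of the founder, `j :: v` is the individual which has the position `v`
in the family tree of that child. `τ v = (ℓ, k)` is the lifetime `ℓ` of `v` and its number `k` of
children, who are born when `v` dies. -/
abbrev Tree : Type := List ℕ → ℝ × ℕ

/-- The family tree of the child `j` of the founder. -/
def Tree.child (τ : Tree) (j : ℕ) : Tree := fun v => τ (j :: v)

/-- The word `v` is an individual that really occurs: each letter is smaller than the number of
children of the individual before it. -/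
def Tree.Occurs : Tree → List ℕ → Prop
  | _, [] => True
  | τ, j :: v => j < (τ []).2 ∧ Tree.Occurs (τ.child j) v

/-- The birth time of `v`: the sum of the lifetimes of its strict ancestors. -/
def Tree.birth : Tree → List ℕ → ℝ
  | _, [] => 0
  | τ, j :: v => (τ []).1 + Tree.birth (τ.child j) v

/-- The death time of `v`. -/
def Tree.death (τ : Tree) (v : List ℕ) : ℝ := τ.birth v + (τ v).1

/-- A population with `x` founders, all born at time `0`. -/
abbrev Forest (x : ℕ) : Type := Fin x → Tree

/-- A (potential) individual: the founder it descends from, and its word in that family tree. -/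
abbrev Individual (x : ℕ) : Type := Fin x × List ℕ

/-- The individuals alive at time `r`. -/
def Forest.alive {x : ℕ} (F : Forest x) (r : ℝ) : Set (Individual x) :=
  {a | (F a.1).Occurs a.2 ∧ (F a.1).birth a.2 ≤ r ∧ r < (F a.1).death a.2}

/-- The population size `Z_r` at time `r` (`⊤` if infinitely many individuals are alive, that is,
after an explosion). -/
noncomputable def Forest.Z {x : ℕ} (F : Forest x) (r : ℝ) : ℕ∞ := (F.alive r).encard

/-- `a` is an ancestor of `b`, or `b` itself. -/
def IsAncestor {x : ℕ} (a b : Individual x) : Prop := a.1 = b.1 ∧ a.2 <+: b.2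

/-- The ancestors of `a` (or `a` itself) that are alive at time `r`. If `a` is alive at time `t`,
`0 ≤ r ≤ t` and lifetimes are positive, there is exactly one. -/
def Forest.ancestorsAt {x : ℕ} (F : Forest x) (r : ℝ) (a : Individual x) : Set (Individual x) :=
  {c | c ∈ F.alive r ∧ IsAncestor c a}

/-- The coalescence time of two individuals `a`, `b` living at time `t`: the infimum of the
`u ∈ (0, t]` such that `a` and `b` have the same ancestor at time `t - u`; it is `⊤` if there is
no such `u`. -/
noncomputable def Forest.coalescenceTime {x : ℕ} (F : Forest x) (t : ℝ) (a b : Individual x) :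
    ℝ≥0∞ :=
  sInf {v | ∃ u : ℝ, 0 < u ∧ u ≤ t ∧
    (F.ancestorsAt (t - u) a ∩ F.ancestorsAt (t - u) b).Nonempty ∧ v = ENNReal.ofReal u}

open Classical in
/-- The coalescence time `T` of a sampled pair `σ`, with the value `⊤` if fewer than two
individuals are alive at time `t` (or infinitely many, when no uniform pair exists). -/
noncomputable def Forest.T {x : ℕ} (F : Forest x) (t : ℝ) (σ : Individual x × Individual x) :
    ℝ≥0∞ :=
  if 2 ≤ F.Z t ∧ F.Z t ≠ ⊤ then F.coalescenceTime t σ.1 σ.2 else ⊤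

section Law

variable (μ : Measure ℕ)

/-- The joint law of the lifetime and the number of children of an individual: independent,
exponential with rate `μ(ℕ)`, and `μ(ℕ)⁻¹ μ`. -/
noncomputable def individualLaw : Measure (ℝ × ℕ) :=
  (expMeasure (μ.real univ)).prod ((μ univ)⁻¹ • μ)

instance [IsFiniteMeasure μ] [NeZero μ] : IsProbabilityMeasure (individualLaw μ) := by
  have : IsProbabilityMeasure (expMeasure (μ.real univ)) :=
    isProbabilityMeasure_expMeasure (by
      simp [Measure.real, ENNReal.toReal_pos_iff, pos_iff_ne_zero, NeZero.ne μ])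
  unfold individualLaw
  infer_instance

/-- The law of the family tree of a single founder: all individuals behave independently. -/
noncomputable def treeLaw : Measure Tree :=
  Measure.infinitePi (fun _ : List ℕ => individualLaw μ)

instance [IsFiniteMeasure μ] [NeZero μ] : IsProbabilityMeasure (treeLaw μ) := by
  unfold treeLaw
  infer_instance

/-- The law `ℙ_x` of the population with `x` founders: `x` independent family trees. -/
noncomputable def forestLaw (x : ℕ) : Measure (Forest x) :=
  Measure.pi (fun _ : Fin x => treeLaw μ)

instance [IsFiniteMeasure μ] [NeZero μ] (x : ℕ) : IsProbabilityMeasure (forestLaw μ x) := by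
  unfold forestLaw
  infer_instance

/-- The generating function `ψ_t(s) = 𝔼_1(s ^ Z_t) = ∑ₙ ℙ_1(Z_t = n) sⁿ`. -/
noncomputable def ψ (t s : ℝ) : ℝ :=
  ∑' n : ℕ, (forestLaw μ 1).real {F | F.Z t = (n : ℕ∞)} * s ^ n

/-- The expectation `𝔼( Z¹_{t₂} Z²_{t₁} / (p (p - 1)), Z⁰_{t₂} + Z¹_{t₂} + Z²_{t₁} = p )`, where
`Z⁰`, `Z¹`, `Z²` are independent copies of the branching process, started from `y - 1`, `1` and
`n - 1` individuals. -/
noncomputable def splitMean (y p n : ℕ) (t₂ t₁ : ℝ) : ℝ≥0∞ :=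
  ∫⁻ F in {F : Forest (y - 1) × Forest 1 × Forest (n - 1) |
      F.1.Z t₂ + F.2.1.Z t₂ + F.2.2.Z t₁ = (p : ℕ∞)},
    ((F.2.1.Z t₂ : ℝ≥0∞) * (F.2.2.Z t₁ : ℝ≥0∞)) / ((p : ℝ≥0∞) * ((p : ℝ≥0∞) - 1))
    ∂((forestLaw μ (y - 1)).prod ((forestLaw μ 1).prod (forestLaw μ (n - 1))))

/-- The density `t₁ ↦ y ∑_{n ≥ 2} n μ(n) 𝔼(…)`. -/
noncomputable def density (y p : ℕ) (t₂ t₁ : ℝ) : ℝ≥0∞ :=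
  (y : ℝ≥0∞) * ∑' n : {n : ℕ // 2 ≤ n}, ((n : ℕ) : ℝ≥0∞) * μ {(n : ℕ)} * splitMean μ y p n t₂ t₁

end Law

/-- Given the genealogy `X`, the random pair `σ` is uniform among the ordered pairs of distinct
individuals alive at time `t`, whenever at least two (and finitely many) are alive:
the conditional probability of `σ = (a, b)` given `X` is `1 / (Z_t (Z_t - 1))` for each pair
`a ≠ b` of individuals alive at time `t`. -/
structure IsUniformPair {Ω : Type*} [MeasurableSpace Ω] (P : Measure Ω) {x : ℕ}
    (X : Ω → Forest x) (t : ℝ) (σ : Ω → Individual x × Individual x) : Prop where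
  measurable : ∀ a b : Individual x, MeasurableSet {ω | σ ω = (a, b)}
  law : ∀ A : Set (Forest x), MeasurableSet A → ∀ a b : Individual x,
    P {ω | X ω ∈ A ∧ 2 ≤ (X ω).Z t ∧ (X ω).Z t ≠ ⊤ ∧ σ ω = (a, b)} =
      ∫⁻ ω in {ω | X ω ∈ A ∧ 2 ≤ (X ω).Z t ∧ (X ω).Z t ≠ ⊤ ∧
          a ≠ b ∧ a ∈ (X ω).alive t ∧ b ∈ (X ω).alive t},
        (((X ω).Z t : ℝ≥0∞) * (((X ω).Z t : ℝ≥0∞) - 1))⁻¹ ∂P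

end BGW

/-! Given the genealogy the sampled pair is uniform, so on `Z_t = p` a probability involving `σ`
becomes, after multiplication by `p (p - 1)`, an expected number of ordered pairs. Lifetimes are
positive and death times have no atoms, so almost surely `T ≤ u` means that the population at time
`t` is finite and the sampled individuals have a common ancestor at time `t - u`. The whole theorem
is therefore about the mean number of such pairs, weighted by `s ^ (Z_t - 2)`.

For (i) the branching property is applied twice. Two individuals with a common ancestor at time `t -
t₁` belong to the same one of the `y` families present at time `t - t₂`, which gives `y h(s)
ψ_{t₂}(s)^(y-1)`. Inside one family, with `q = t₂ - t₁`, the pair lies in the subfamily of a single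
individual alive at age `q`, and all pairs of that subfamily count; hence `h(s) = ψ_q'(ψ_{t₁}(s))
ψ_{t₁}''(s)`. The chain rule `ψ_{q+t₁}' = ψ_q'(ψ_{t₁}) ψ_{t₁}'` (`gen'_add`) turns this into
`ψ_{t₂}' ψ_{t₁}'' / ψ_{t₁}'` (`setLIntegral_pairs`, `gen'_gen_mul_gen''`).

For (ii) put `L_t = ψ_t'' / ψ_t'`, the logarithmic derivative of `ψ_t'`. The chain rule makes it a
cocycle, `L_{r+q} = L_r(ψ_q) ψ_q' + L_q` (`logDerivRatio_add`). For `n ≠ 1` the probability of `n`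
individuals at a small time `a` is `μ(n) a + o(a)` (`tendsto_sizeProb_div`), so `L_a(u) / a` tends
to `f''(u)`, where `f(u) = ∑ μ(n) uⁿ`. Thus `L` is continuous in time with right derivative
`f''(ψ_r) ψ_r'` and is the integral of it (`lintegral_rateGen''`). Multiplied by `y ψ_{t₂}'
ψ_{t₂}^(y-1)`, this integrand is the generating function in `p` of `p (p - 1)` times the claimed
density (`tsum_mul_density`). Comparing coefficients of power series on `(0, 1)` gives the law of
`T` on the intervals `(0, u]`, and these determine it on Borel sets.

The branching property is proved on the product space of marked words by decomposing a tree at its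
root: if the root is alive at time `r`, the exponential law has no memory; if it is dead, its
children form a forest to which the property applies with words shorter by one letter
(`TreeBranching.succ`). Explosion is allowed: an infinite population has weight `0` in the
generating functions, and since it almost surely stays infinite (`ae_Z_add_eq_top`), summing over
the finite values of `Z_r` loses nothing. -/

namespace BGW

/-! ### Words, ancestors and residual trees -/

/-- The words of the individuals alive at time `r` in a single family tree. -/
def Tree.alive (τ : Tree) (r : ℝ) : Set (List ℕ) :=
  {v | τ.Occurs v ∧ τ.birth v ≤ r ∧ r < τ.death v}

theorem Forest.mem_alive {x : ℕ} {F : Forest x} {r : ℝ} {a : Individual x} :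
    a ∈ F.alive r ↔ a.2 ∈ (F a.1).alive r := Iff.rfl

theorem Tree.death_nil (τ : Tree) : τ.death [] = (τ []).1 := by
  simp [Tree.death, Tree.birth]

theorem Tree.death_cons (τ : Tree) (j : ℕ) (v : List ℕ) :
    τ.death (j :: v) = (τ []).1 + (τ.child j).death v := by
  simp [Tree.death, Tree.birth, Tree.child, add_assoc]

theorem Tree.nil_mem_alive {τ : Tree} {r : ℝ} : [] ∈ τ.alive r ↔ 0 ≤ r ∧ r < (τ []).1 := by
  simp [Tree.alive, Tree.Occurs, Tree.birth, Tree.death_nil]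

theorem Tree.cons_mem_alive {τ : Tree} {r : ℝ} {j : ℕ} {v : List ℕ} :
    j :: v ∈ τ.alive r ↔ j < (τ []).2 ∧ v ∈ (τ.child j).alive (r - (τ []).1) := by
  simp only [Tree.alive, Tree.Occurs, Tree.birth, Tree.death_cons, mem_ofPred_eq, and_assoc,
    le_sub_iff_add_le', sub_lt_iff_lt_add']

/-- All lifetimes are positive. -/
def Tree.Pos (τ : Tree) : Prop := ∀ v, 0 < (τ v).1

/-- All lifetimes are positive. -/
def Forest.Pos {x : ℕ} (F : Forest x) : Prop := ∀ i, (F i).Pos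

theorem Tree.Pos.child {τ : Tree} (h : τ.Pos) (j : ℕ) : (τ.child j).Pos := fun v => h (j :: v)

theorem Tree.Pos.birth_nonneg {τ : Tree} (h : τ.Pos) (v : List ℕ) : 0 ≤ τ.birth v := by
  induction v generalizing τ with
  | nil => simp [Tree.birth]
  | cons j v ih => exact add_nonneg (h []).le (ih (h.child j))

theorem Tree.Pos.death_pos {τ : Tree} (h : τ.Pos) (v : List ℕ) : 0 < τ.death v :=
  add_pos_of_nonneg_of_pos (h.birth_nonneg v) (h v)

theorem Tree.Pos.nonneg_of_mem_alive {τ : Tree} (h : τ.Pos) {v : List ℕ} {r : ℝ}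
    (hv : v ∈ τ.alive r) : 0 ≤ r := (h.birth_nonneg v).trans hv.2.1

theorem Tree.Occurs.of_prefix {τ : Tree} {c a : List ℕ} (ha : τ.Occurs a) (hc : c <+: a) :
    τ.Occurs c := by
  induction c generalizing τ a with
  | nil => simp [Tree.Occurs]
  | cons j c ih =>
    obtain ⟨e, rfl⟩ := hc
    exact ⟨ha.1, ih ha.2 ⟨e, rfl⟩⟩

theorem Tree.Pos.death_le_birth {τ : Tree} (h : τ.Pos) {c a : List ℕ} (hc : c <+: a)
    (hne : c ≠ a) : τ.death c ≤ τ.birth a := by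
  induction c generalizing τ a with
  | nil =>
    cases a with
    | nil => exact absurd rfl hne
    | cons j a =>
      rw [Tree.death_nil]
      simpa [Tree.birth] using (h.child j).birth_nonneg a
  | cons j c ih =>
    obtain ⟨e, rfl⟩ := hc
    rw [Tree.death_cons]
    simpa [Tree.birth] using ih (h.child j) ⟨e, rfl⟩ (by simpa using hne)

/-- Walk down the word, subtracting lifetimes, until the remaining time is smaller than the current
lifetime. The individual `a` itself may be born after time `r`. -/
theorem Tree.exists_prefix_mem_alive {τ : Tree} {a : List ℕ} {r : ℝ} (ha : τ.Occurs a)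
    (hr : 0 ≤ r) (hd : r < τ.death a) : ∃ c, c <+: a ∧ c ∈ τ.alive r := by
  induction a generalizing τ r with
  | nil => exact ⟨[], List.prefix_rfl, Tree.nil_mem_alive.2 ⟨hr, by rwa [Tree.death_nil] at hd⟩⟩
  | cons j a ih =>
    by_cases hl : r < (τ []).1
    · exact ⟨[], List.nil_prefix, Tree.nil_mem_alive.2 ⟨hr, hl⟩⟩
    · rw [Tree.death_cons] at hd
      obtain ⟨c, hc, hc'⟩ := ih (τ := τ.child j) (r := r - (τ []).1) ha.2 (by linarith)
        (by linarith)
      exact ⟨j :: c, by simpa using hc, Tree.cons_mem_alive.2 ⟨ha.1, hc'⟩⟩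

/-- Prefixes of one word are comparable, and a strict ancestor is dead by the time its descendant is
born. -/
theorem Tree.Pos.prefix_unique {τ : Tree} (h : τ.Pos) {r : ℝ} {c d a : List ℕ}
    (hc : c ∈ τ.alive r) (hd : d ∈ τ.alive r) (hca : c <+: a) (hda : d <+: a) : c = d := by
  by_contra hne
  rcases List.prefix_or_prefix_of_prefix hca hda with hp | hp
  · have := h.death_le_birth hp hne
    linarith [hc.2.2, hd.2.1]
  · have := h.death_le_birth hp (Ne.symm hne)
    linarith [hd.2.2, hc.2.1]

/-- If `c` is alive at time `r`, the family tree of `c` seen from time `r` on: its lifetime is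
replaced by the residual one. -/
def Tree.residual : ℝ → List ℕ → Tree → Tree
  | r, [], τ => Function.update τ [] ((τ []).1 - r, (τ []).2)
  | r, j :: v, τ => Tree.residual (r - (τ []).1) v (τ.child j)

/-- Only the root mark of the subtree of `c` is altered, and shortening that lifetime by the age
reached at time `r` is the same as moving the clock from `r + q` to `q`. -/
theorem Tree.mem_alive_residual {τ : Tree} {c v : List ℕ} {r q : ℝ} (hr : 0 ≤ r) (hq : 0 ≤ q)
    (hc : c ∈ τ.alive r) (h : τ.Pos) :
    v ∈ (Tree.residual r c τ).alive q ↔ c ++ v ∈ τ.alive (r + q) := by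
  induction c generalizing τ r with
  | nil =>
    rw [List.nil_append, Tree.residual]
    cases v with
    | nil =>
      rw [Tree.nil_mem_alive, Tree.nil_mem_alive]
      simp only [Function.update_self]
      constructor <;> rintro ⟨h1, h2⟩ <;> constructor <;> linarith
    | cons j v =>
      rw [Tree.cons_mem_alive, Tree.cons_mem_alive]
      have : Tree.child (Function.update τ [] ((τ []).1 - r, (τ []).2)) j = τ.child j := by
        funext w; simp [Tree.child]
      rw [this, Function.update_self, show q - ((τ []).1 - r) = r + q - (τ []).1 by ring]
  | cons j c ih =>
    rw [Tree.cons_mem_alive] at hc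
    rw [Tree.residual, List.cons_append, Tree.cons_mem_alive,
      ih ((h.child j).nonneg_of_mem_alive hc.2) hc.2 (h.child j),
      show r + q - (τ []).1 = r - (τ []).1 + q by ring]
    simp [hc.1]

/-- The population descending from the individual `c` alive at time `r`, seen from time `r` on. -/
def Forest.residual {x : ℕ} (F : Forest x) (r : ℝ) (c : Individual x) : Forest 1 :=
  fun _ => Tree.residual r c.2 (F c.1)

/-- The descendant `d` of the individual `c`. -/
def Individual.append {x : ℕ} (c : Individual x) (d : Individual 1) : Individual x :=
  (c.1, c.2 ++ d.2)

theorem Individual.append_injective {x : ℕ} (c : Individual x) :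
    Function.Injective (Individual.append c) := by
  rintro ⟨i, v⟩ ⟨j, w⟩ h
  simp only [Individual.append, Prod.mk.injEq, List.append_cancel_left_eq, true_and] at h
  exact Prod.ext (Subsingleton.elim _ _) h

theorem isAncestor_append {x : ℕ} (c : Individual x) (d : Individual 1) :
    IsAncestor c (c.append d) := ⟨rfl, List.prefix_append _ _⟩

theorem IsAncestor.exists_append {x : ℕ} {c a : Individual x} (h : IsAncestor c a) :
    ∃ d, c.append d = a := by
  obtain ⟨h1, e, he⟩ := h
  exact ⟨(0, e), Prod.ext h1 he⟩

theorem isAncestor_append_append {x : ℕ} (c : Individual x) (d e : Individual 1) :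
    IsAncestor (c.append d) (c.append e) ↔ IsAncestor d e := by
  simp [IsAncestor, Individual.append, Subsingleton.elim d.1 e.1]

theorem IsAncestor.trans {x : ℕ} {a b c : Individual x} (h : IsAncestor a b)
    (h' : IsAncestor b c) : IsAncestor a c := ⟨h.1.trans h'.1, h.2.trans h'.2⟩

theorem Forest.Pos.mem_alive_residual {x : ℕ} {F : Forest x} (h : F.Pos) {r q : ℝ} (hr : 0 ≤ r)
    (hq : 0 ≤ q) {c : Individual x} (hc : c ∈ F.alive r) {d : Individual 1} :
    d ∈ (F.residual r c).alive q ↔ c.append d ∈ F.alive (r + q) :=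
  Tree.mem_alive_residual hr hq hc (h c.1)

theorem Forest.Pos.ancestor_unique {x : ℕ} {F : Forest x} (h : F.Pos) {r : ℝ}
    {c d a : Individual x} (hc : c ∈ F.alive r) (hd : d ∈ F.alive r) (hca : IsAncestor c a)
    (hda : IsAncestor d a) : c = d := by
  obtain ⟨i, c⟩ := c
  obtain ⟨j, d⟩ := d
  obtain ⟨k, a⟩ := a
  obtain rfl : i = k := hca.1
  obtain rfl : j = i := hda.1
  exact Prod.ext rfl ((h j).prefix_unique hc hd hca.2 hda.2)

theorem Forest.exists_ancestor {x : ℕ} {F : Forest x} {r q : ℝ} (hr : 0 ≤ r) (hq : 0 ≤ q)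
    {a : Individual x} (ha : a ∈ F.alive (r + q)) : ∃ c ∈ F.alive r, IsAncestor c a := by
  obtain ⟨c, hc, hc'⟩ := Tree.exists_prefix_mem_alive (r := r) ha.1 hr
    (by linarith [ha.2.2])
  exact ⟨(a.1, c), hc', rfl, hc⟩

theorem Forest.Pos.alive_add {x : ℕ} {F : Forest x} (h : F.Pos) {r q : ℝ} (hr : 0 ≤ r)
    (hq : 0 ≤ q) :
    F.alive (r + q) = ⋃ c ∈ F.alive r, Individual.append c '' (F.residual r c).alive q := by
  ext a
  simp only [mem_iUnion, mem_image, exists_prop]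
  constructor
  · intro ha
    obtain ⟨c, hc, hca⟩ := Forest.exists_ancestor hr hq ha
    obtain ⟨d, rfl⟩ := hca.exists_append
    exact ⟨c, hc, d, (h.mem_alive_residual hr hq hc).2 ha, rfl⟩
  · rintro ⟨c, hc, d, hd, rfl⟩
    exact (h.mem_alive_residual hr hq hc).1 hd

theorem Forest.Pos.Z_add {x : ℕ} {F : Forest x} (h : F.Pos) {r q : ℝ} (hr : 0 ≤ r)
    (hq : 0 ≤ q) {S : Finset (Individual x)} (hS : F.alive r = S) :
    F.Z (r + q) = ∑ c ∈ S, (F.residual r c).Z q := by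
  rw [Forest.Z, h.alive_add hr hq, hS, (S.finite_toSet).encard_biUnion,
    finsum_mem_coe_finset]
  · exact Finset.sum_congr rfl fun c _ => (Individual.append_injective c).encard_image _
  · intro c hc d hd hcd
    refine disjoint_left.2 ?_
    rintro _ ⟨e, -, rfl⟩ ⟨f, -, hf⟩
    refine hcd (h.ancestor_unique (hS ▸ hc) (hS ▸ hd) (isAncestor_append c e) ?_)
    rw [← hf]
    exact isAncestor_append d f

/-- The ordered pairs of distinct individuals alive at time `t` which have the same ancestor at
time `q`. -/
def Forest.pairs {x : ℕ} (F : Forest x) (t q : ℝ) : Set (Individual x × Individual x) :=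
  {p | p.1 ≠ p.2 ∧ p.1 ∈ F.alive t ∧ p.2 ∈ F.alive t ∧
    ∃ c ∈ F.alive q, IsAncestor c p.1 ∧ IsAncestor c p.2}

/-- A common ancestor at the later time `r + q` has its own ancestor at time `r`, so the pair never
straddles two families. This makes the pair count additive over the individuals alive at time `r`.
-/
theorem Forest.Pos.pairs_add {x : ℕ} {F : Forest x} (h : F.Pos) {r q t : ℝ} (hr : 0 ≤ r)
    (hq : 0 ≤ q) (ht : q ≤ t) :
    F.pairs (r + t) (r + q) = ⋃ c ∈ F.alive r,
      Prod.map (Individual.append c) (Individual.append c) '' (F.residual r c).pairs t q := by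
  have ht0 := hq.trans ht
  ext ⟨a, b⟩
  simp only [mem_iUnion, mem_image, exists_prop]
  constructor
  · rintro ⟨hab, ha, hb, d, hd, hda, hdb⟩
    obtain ⟨c, hc, hcd⟩ := Forest.exists_ancestor hr hq hd
    obtain ⟨a, rfl⟩ := (hcd.trans hda).exists_append
    obtain ⟨b, rfl⟩ := (hcd.trans hdb).exists_append
    obtain ⟨d, rfl⟩ := hcd.exists_append
    rw [isAncestor_append_append] at hda hdb
    refine ⟨c, hc, (a, b), ⟨fun e => hab (by rw [show a = b from e]), ?_, ?_, d, ?_, hda, hdb⟩, rfl⟩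
    · exact (h.mem_alive_residual hr ht0 hc).2 ha
    · exact (h.mem_alive_residual hr ht0 hc).2 hb
    · exact (h.mem_alive_residual hr hq hc).2 hd
  · rintro ⟨c, hc, ⟨a, b⟩, ⟨hab, ha, hb, d, hd, hda, hdb⟩, h'⟩
    obtain ⟨rfl, rfl⟩ := Prod.mk.inj h'
    exact ⟨fun e => hab (Individual.append_injective c e), (h.mem_alive_residual hr ht0 hc).1 ha,
      (h.mem_alive_residual hr ht0 hc).1 hb, c.append d, (h.mem_alive_residual hr hq hc).1 hd,
      (isAncestor_append_append c d a).2 hda, (isAncestor_append_append c d b).2 hdb⟩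

theorem Forest.Pos.encard_pairs_add {x : ℕ} {F : Forest x} (h : F.Pos) {r q t : ℝ} (hr : 0 ≤ r)
    (hq : 0 ≤ q) (ht : q ≤ t) {S : Finset (Individual x)} (hS : F.alive r = S) :
    (F.pairs (r + t) (r + q)).encard = ∑ c ∈ S, ((F.residual r c).pairs t q).encard := by
  rw [h.pairs_add hr hq ht, hS, (S.finite_toSet).encard_biUnion, finsum_mem_coe_finset]
  · exact Finset.sum_congr rfl fun c _ => ((Individual.append_injective c).prodMap
      (Individual.append_injective c)).encard_image _
  · intro c hc d hd hcd
    refine disjoint_left.2 ?_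
    rintro _ ⟨e, -, rfl⟩ ⟨f, -, hf⟩
    refine hcd (h.ancestor_unique (hS ▸ hc) (hS ▸ hd) (isAncestor_append c e.1) ?_)
    have := congrArg Prod.fst hf
    simp only [Prod.map_fst] at this
    rw [← this]
    exact isAncestor_append d f.1

/-- All pairs of individuals descend from the founder. -/
theorem Forest.encard_pairs_zero {G : Forest 1} {t : ℝ} (h : (0, []) ∈ G.alive 0) {n : ℕ}
    (hn : G.Z t = n) : (G.pairs t 0).encard = ((n * (n - 1) : ℕ) : ℕ∞) := by
  have hfin : (G.alive t).Finite := by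
    rw [← encard_lt_top_iff, show (G.alive t).encard = n from hn]
    exact ENat.natCast_lt_top n
  have hcard : hfin.toFinset.card = n := by
    rw [← ENat.natCast_inj, ← hn, Forest.Z, hfin.encard_eq_coe_toFinset_card]
  have : G.pairs t 0 = hfin.toFinset.offDiag := by
    ext ⟨a, b⟩
    simp only [Forest.pairs, mem_ofPred_eq, Finset.coe_offDiag, Finite.coe_toFinset, mem_offDiag]
    constructor
    · rintro ⟨h1, h2, h3, -⟩
      exact ⟨h2, h3, h1⟩
    · rintro ⟨h2, h3, h1⟩
      exact ⟨h1, h2, h3, (0, []), h, ⟨Subsingleton.elim _ _, List.nil_prefix⟩,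
        ⟨Subsingleton.elim _ _, List.nil_prefix⟩⟩
  rw [this, encard_coe_eq_coe_finsetCard, Finset.offDiag_card, hcard, Nat.mul_sub_one]

/-! ### Coalescence times -/

/-- The longest common prefix of two words. -/
def commonPrefix : List ℕ → List ℕ → List ℕ
  | i :: a, j :: b => if i = j then i :: commonPrefix a b else []
  | _, _ => []

theorem prefix_commonPrefix {a b c : List ℕ} :
    c <+: commonPrefix a b ↔ c <+: a ∧ c <+: b := by
  induction a generalizing b c with
  | nil => cases b <;> cases c <;> simp [commonPrefix]
  | cons i a ih =>
    cases b with
    | nil => cases c <;> simp [commonPrefix]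
    | cons j b =>
      cases c with
      | nil => simp
      | cons k c =>
        rw [commonPrefix]
        split_ifs with hij
        · subst hij
          simp only [List.cons_prefix_cons, ih]
          tauto
        · simp only [List.prefix_nil, reduceCtorEq, List.cons_prefix_cons, false_iff]
          rintro ⟨⟨rfl, -⟩, rfl, -⟩
          exact hij rfl

/-- The death time of the last common ancestor of two individuals with the same founder. -/
def Forest.splitTime {x : ℕ} (F : Forest x) (a b : Individual x) : ℝ :=
  (F a.1).death (commonPrefix a.2 b.2)

theorem Forest.Pos.splitTime_pos {x : ℕ} {F : Forest x} (h : F.Pos) (a b : Individual x) :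
    0 < F.splitTime a b := (h a.1).death_pos _

theorem Forest.Pos.splitTime_le {x : ℕ} {F : Forest x} (h : F.Pos) {a b : Individual x} {t : ℝ}
    (hab : a ≠ b) (h1 : a.1 = b.1) (ha : a ∈ F.alive t) (hb : b ∈ F.alive t) :
    F.splitTime a b ≤ t := by
  obtain ⟨i, a⟩ := a
  obtain ⟨j, b⟩ := b
  obtain rfl : i = j := h1
  have hp := prefix_commonPrefix.1 (List.prefix_refl (commonPrefix a b))
  by_cases hca : commonPrefix a b = a
  · have hcb : commonPrefix a b ≠ b := fun hcb => hab (by rw [← hca, hcb])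
    exact ((h i).death_le_birth hp.2 hcb).trans hb.2.1
  · exact ((h i).death_le_birth hp.1 hca).trans ha.2.1

/-- The common ancestors are the prefixes of the longest common prefix, so one of them is alive at
time `v` as long as the last of them has not died. The inequality is strict because an individual is
no longer alive at its death time. -/
theorem Forest.Pos.common_ancestor_iff {x : ℕ} {F : Forest x} (h : F.Pos) {a b : Individual x}
    {t v : ℝ} (ha : a ∈ F.alive t) (hv : 0 ≤ v) :
    (∃ c ∈ F.alive v, IsAncestor c a ∧ IsAncestor c b) ↔ a.1 = b.1 ∧ v < F.splitTime a b := by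
  constructor
  · rintro ⟨⟨i, c⟩, hc, ⟨hi, hca⟩, hj, hcb⟩
    refine ⟨hi.symm.trans hj, hc.2.2.trans_le ?_⟩
    have hp := prefix_commonPrefix.2 ⟨hca, hcb⟩
    simp only at hi
    subst hi
    by_cases he : c = commonPrefix a.2 b.2
    · rw [Forest.splitTime, ← he]
    · exact ((h a.1).death_le_birth hp he).trans (le_add_of_nonneg_right (h a.1 _).le)
  · rintro ⟨h1, h2⟩
    have hp := prefix_commonPrefix.1 (List.prefix_refl (commonPrefix a.2 b.2))
    obtain ⟨c, hc, hc'⟩ := Tree.exists_prefix_mem_alive (Tree.Occurs.of_prefix ha.1 hp.1) hv h2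
    exact ⟨(a.1, c), hc', ⟨rfl, hc.trans hp.1⟩, h1, hc.trans hp.2⟩

theorem Forest.Pos.mem_pairs_iff {x : ℕ} {F : Forest x} (h : F.Pos) {a b : Individual x}
    {t q : ℝ} (hq : 0 ≤ q) : (a, b) ∈ F.pairs t q ↔
      a ≠ b ∧ a ∈ F.alive t ∧ b ∈ F.alive t ∧ a.1 = b.1 ∧ q < F.splitTime a b := by
  simp only [Forest.pairs, mem_ofPred_eq]
  constructor
  · rintro ⟨h1, h2, h3, h4⟩
    exact ⟨h1, h2, h3, (h.common_ancestor_iff h2 hq).1 h4⟩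
  · rintro ⟨h1, h2, h3, h4⟩
    exact ⟨h1, h2, h3, (h.common_ancestor_iff h2 hq).2 h4⟩

/-- For a common founder the admissible `u` form the interval `(t - splitTime, t]`; the infimum is
its left end, which is not attained. -/
theorem Forest.Pos.coalescenceTime_eq {x : ℕ} {F : Forest x} (h : F.Pos) {a b : Individual x}
    {t : ℝ} (hab : a ≠ b) (ha : a ∈ F.alive t) (hb : b ∈ F.alive t) :
    F.coalescenceTime t a b =
      if a.1 = b.1 then ENNReal.ofReal (t - F.splitTime a b) else ⊤ := by
  have key : ∀ u : ℝ, u ≤ t →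
      ((F.ancestorsAt (t - u) a ∩ F.ancestorsAt (t - u) b).Nonempty ↔
        a.1 = b.1 ∧ t - u < F.splitTime a b) := by
    intro u hu
    rw [← h.common_ancestor_iff ha (sub_nonneg.2 hu)]
    constructor
    · rintro ⟨c, hc, hc'⟩
      exact ⟨c, hc.1, hc.2, hc'.2⟩
    · rintro ⟨c, hc, h1, h2⟩
      exact ⟨c, ⟨hc, h1⟩, hc, h2⟩
  unfold Forest.coalescenceTime
  split_ifs with h1
  · have hle := h.splitTime_le hab h1 ha hb
    have hpos := h.splitTime_pos a b
    apply le_antisymm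
    · refine le_of_forall_gt_imp_ge_of_dense fun z hz => ?_
      obtain ⟨w, hw, hwz⟩ := ENNReal.lt_iff_exists_real_btwn.1 hz
      obtain ⟨hw1, hw2⟩ := hwz
      rw [ENNReal.ofReal_lt_ofReal_iff_of_nonneg (by linarith)] at hw1
      -- Any `u` strictly above `t - splitTime` is admissible, but it must not exceed `t`. Capping
      -- `w` at `t` keeps it strictly above because `splitTime` is positive.
      refine le_trans (sInf_le ⟨min w t, lt_min (by linarith) (by linarith), min_le_right _ _,
        (key _ (min_le_right _ _)).2 ⟨h1, ?_⟩, rfl⟩)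
        ((ENNReal.ofReal_le_ofReal (min_le_left _ _)).trans hw2.le)
      rcases min_cases w t with hm | hm <;> rw [hm.1] <;> linarith
    · refine le_sInf ?_
      rintro _ ⟨u, hu0, hut, hne, rfl⟩
      exact ENNReal.ofReal_le_ofReal (by linarith [((key u hut).1 hne).2])
  · rw [sInf_eq_top]
    rintro _ ⟨u, hu0, hut, hne, rfl⟩
    exact absurd ((key u hut).1 hne).1 h1

/-! ### Measurability -/

/-! ### Random subsets of a countable set. -/

section RandomSet

variable {Ω ι : Type*} [MeasurableSpace Ω] [Countable ι] {A : Ω → Set ι}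

theorem measurableSet_setOf_inter_eq (hA : ∀ i, MeasurableSet {ω | i ∈ A ω}) (W S : Set ι) :
    MeasurableSet {ω | A ω ∩ W = S} := by
  classical
  have : {ω | A ω ∩ W = S} = ⋂ i, {ω | (i ∈ A ω ∧ i ∈ W) ↔ i ∈ S} := by
    ext ω
    simp [Set.ext_iff]
  rw [this]
  refine MeasurableSet.iInter fun i => ?_
  by_cases hW : i ∈ W <;> by_cases hS : i ∈ S <;> simp only [hW, hS, and_true, and_false, iff_true,
    iff_false, ofPred_true, ofPred_false, MeasurableSet.univ, MeasurableSet.empty]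
  · exact hA i
  · exact (hA i).compl

theorem measurableSet_setOf_eq_set (hA : ∀ i, MeasurableSet {ω | i ∈ A ω}) (S : Set ι) :
    MeasurableSet {ω | A ω = S} := by
  simpa using measurableSet_setOf_inter_eq hA univ S

/-- There are countably many finite subsets, so each event `encard = n` is a countable union of
events fixing the set; the value `⊤` is the complement of all of these. -/
theorem measurable_encard (hA : ∀ i, MeasurableSet {ω | i ∈ A ω}) :
    Measurable fun ω => (A ω).encard := by
  have hn : ∀ n : ℕ, MeasurableSet {ω | (A ω).encard = n} := by
    intro n
    have : {ω | (A ω).encard = n} = ⋃ S : {S : Finset ι // S.card = n}, {ω | A ω = S.1} := by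
      ext ω
      simp only [mem_ofPred_eq, mem_iUnion, Subtype.exists, exists_prop]
      constructor
      · intro h
        have hfin : (A ω).Finite := by
          rw [← encard_lt_top_iff, h]; exact ENat.natCast_lt_top n
        refine ⟨hfin.toFinset, ?_, by simp⟩
        rw [← ENat.natCast_inj, ← h, hfin.encard_eq_coe_toFinset_card]
      · rintro ⟨S, rfl, hS⟩
        rw [hS, encard_coe_eq_coe_finsetCard]
    rw [this]
    exact MeasurableSet.iUnion fun S => measurableSet_setOf_eq_set hA _
  refine measurable_to_countable' fun n => ?_
  induction n using ENat.recTopCoe with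
  | top =>
    have : (fun ω => (A ω).encard) ⁻¹' {⊤} = (⋃ n : ℕ, {ω | (A ω).encard = n})ᶜ := by
      ext ω
      simp only [mem_preimage, mem_singleton_iff, mem_compl_iff, mem_iUnion, mem_ofPred_eq]
      constructor
      · rintro h ⟨n, hn⟩
        rw [h] at hn
        exact ENat.top_ne_natCast n hn
      · intro h
        by_contra h'
        obtain ⟨n, hn⟩ := ENat.ne_top_iff_exists.1 h'
        exact h ⟨n, hn.symm⟩
    rw [this]
    exact (MeasurableSet.iUnion hn).compl
  | coe n => exact hn n

end RandomSet

theorem Tree.measurable_child (j : ℕ) : Measurable fun τ : Tree => τ.child j :=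
  measurable_pi_lambda _ fun v => measurable_pi_apply (j :: v)

theorem Tree.measurable_birth (v : List ℕ) : Measurable fun τ : Tree => τ.birth v := by
  induction v with
  | nil => exact measurable_const
  | cons j v ih =>
    exact (measurable_pi_apply (X := fun _ : List ℕ => ℝ × ℕ) []).fst.add
      (ih.comp (Tree.measurable_child j))

theorem Tree.measurable_death (v : List ℕ) : Measurable fun τ : Tree => τ.death v :=
  (Tree.measurable_birth v).add (measurable_pi_apply (X := fun _ : List ℕ => ℝ × ℕ) v).fst

theorem Tree.measurableSet_occurs (v : List ℕ) : MeasurableSet {τ : Tree | τ.Occurs v} := by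
  induction v with
  | nil => simp [Tree.Occurs]
  | cons j v ih =>
    refine MeasurableSet.inter ?_ (ih.preimage (Tree.measurable_child j))
    exact measurableSet_lt measurable_const
      (measurable_pi_apply (X := fun _ : List ℕ => ℝ × ℕ) []).snd

/-- Joint measurability in time and tree is needed: after the death of the root the remaining time
`r - ℓ` is random, and the density will be integrated over `t₁`. -/
theorem Tree.measurableSet_mem_alive (v : List ℕ) :
    MeasurableSet {p : ℝ × Tree | v ∈ p.2.alive p.1} :=
  ((Tree.measurableSet_occurs v).preimage measurable_snd).inter
    ((measurableSet_le ((Tree.measurable_birth v).comp measurable_snd) measurable_fst).inter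
      (measurableSet_lt measurable_fst ((Tree.measurable_death v).comp measurable_snd)))

theorem Tree.measurable_residual (c : List ℕ) :
    Measurable fun p : ℝ × Tree => Tree.residual p.1 c p.2 := by
  induction c with
  | nil =>
    refine measurable_pi_lambda _ fun v => ?_
    simp only [Tree.residual]
    by_cases hv : v = []
    · subst hv
      simp only [Function.update_self]
      fun_prop
    · simp only [Function.update_of_ne hv]
      fun_prop
  | cons j c ih =>
    simp only [Tree.residual]
    have h1 : Measurable fun p : ℝ × Tree => p.1 - (p.2 []).1 := by fun_prop
    exact ih.comp (h1.prodMk ((Tree.measurable_child j).comp measurable_snd))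

theorem Forest.measurableSet_mem_alive {x : ℕ} (a : Individual x) :
    MeasurableSet {p : ℝ × Forest x | a ∈ p.2.alive p.1} := by
  have h : Measurable fun p : ℝ × Forest x => (p.1, p.2 a.1) := by fun_prop
  exact (Tree.measurableSet_mem_alive a.2).preimage h

theorem Forest.measurable_residual {x : ℕ} (c : Individual x) :
    Measurable fun p : ℝ × Forest x => p.2.residual p.1 c := by
  have h : Measurable fun p : ℝ × Forest x => (p.1, p.2 c.1) := by fun_prop
  exact measurable_pi_lambda _ fun _ => (Tree.measurable_residual c.2).comp h

theorem Forest.measurable_residual_right {x : ℕ} (r : ℝ) (c : Individual x) :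
    Measurable fun F : Forest x => F.residual r c :=
  (Forest.measurable_residual c).comp measurable_prodMk_left

theorem Forest.measurableSet_mem_alive_right {x : ℕ} (r : ℝ) (a : Individual x) :
    MeasurableSet {F : Forest x | a ∈ F.alive r} :=
  (Forest.measurableSet_mem_alive a).preimage measurable_prodMk_left

theorem Forest.measurable_Z {x : ℕ} (r : ℝ) : Measurable fun F : Forest x => F.Z r :=
  measurable_encard (Forest.measurableSet_mem_alive_right r)

theorem Forest.measurableSet_Z_eq {x : ℕ} (r : ℝ) (n : ℕ∞) :
    MeasurableSet {F : Forest x | F.Z r = n} :=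
  Forest.measurable_Z r (measurableSet_singleton n)

theorem Forest.measurableSet_common_ancestor {x : ℕ} (q : ℝ) (p : Individual x × Individual x) :
    MeasurableSet {F : Forest x | ∃ c ∈ F.alive q, IsAncestor c p.1 ∧ IsAncestor c p.2} := by
  have : {F : Forest x | ∃ c ∈ F.alive q, IsAncestor c p.1 ∧ IsAncestor c p.2} =
      ⋃ c ∈ {c : Individual x | IsAncestor c p.1 ∧ IsAncestor c p.2}, {F | c ∈ F.alive q} := by
    ext F
    simp only [mem_ofPred_eq, mem_iUnion, exists_prop]
    exact exists_congr fun c => and_comm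
  rw [this]
  exact MeasurableSet.biUnion (to_countable _) fun c _ => Forest.measurableSet_mem_alive_right q c

theorem Forest.measurableSet_mem_pairs {x : ℕ} (t q : ℝ) (p : Individual x × Individual x) :
    MeasurableSet {F : Forest x | p ∈ F.pairs t q} := by
  refine MeasurableSet.inter (.const _) (.inter (Forest.measurableSet_mem_alive_right t p.1)
    (.inter (Forest.measurableSet_mem_alive_right t p.2) ?_))
  exact Forest.measurableSet_common_ancestor q p

theorem Forest.measurable_encard_pairs {x : ℕ} (t q : ℝ) :
    Measurable fun F : Forest x => (F.pairs t q).encard :=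
  measurable_encard (Forest.measurableSet_mem_pairs t q)

theorem Forest.measurable_splitTime {x : ℕ} (a b : Individual x) :
    Measurable fun F : Forest x => F.splitTime a b :=
  (Tree.measurable_death _).comp (measurable_pi_apply a.1)

/-! ### The law of a family tree -/

section Law

variable (μ : Measure ℕ)

theorem expMeasure_eq (c : ℝ) : expMeasure c = volume.withDensity (exponentialPDF c) := rfl

instance (c : ℝ) : NullSingletonClass (expMeasure c) := by
  rw [expMeasure_eq]; infer_instance

theorem measurable_exponentialPDF (c : ℝ) : Measurable (exponentialPDF c) :=
  (measurable_exponentialPDFReal c).ennreal_ofReal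

/-- The exponential law has no memory. -/
theorem lintegral_expMeasure_shift {c a : ℝ} (ha : 0 ≤ a) {f : ℝ → ℝ≥0∞} (hf : Measurable f) :
    ∫⁻ l in Ioi a, f (l - a) ∂expMeasure c =
      ENNReal.ofReal (Real.exp (-(c * a))) * ∫⁻ l, f l ∂expMeasure c := by
  have hd := measurable_exponentialPDF c
  rw [expMeasure_eq, restrict_withDensity measurableSet_Ioi,
    lintegral_withDensity_eq_lintegral_mul _ hd hf,
    lintegral_withDensity_eq_lintegral_mul _ hd (by fun_prop), ← lintegral_indicator
      measurableSet_Ioi,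
    ← lintegral_add_right_eq_self _ a, ← lintegral_const_mul _ (hd.mul hf)]
  refine lintegral_congr_ae ?_
  -- The point `0` is removed because the exponential density does not vanish there, while the
  -- shifted half-line `Ioi a` excludes its endpoint.
  filter_upwards [compl_mem_ae_iff.2 (measure_singleton (μ := volume) (0 : ℝ))] with u hu
  rcases lt_trichotomy u 0 with h | h | h
  · rw [indicator_of_notMem (by simp [h.le])]
    simp [exponentialPDF_of_neg h]
  · exact absurd h hu
  · rw [indicator_of_mem (by simpa using h)]
    simp only [Pi.mul_apply, add_sub_cancel_right]
    rw [exponentialPDF_of_nonneg h.le, exponentialPDF_of_nonneg (by linarith), ← mul_assoc,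
      ← ENNReal.ofReal_mul (Real.exp_pos _).le]
    congr 2
    rw [mul_add, neg_add, Real.exp_add]
    ring

theorem expMeasure_Ioi {c a : ℝ} (hc : 0 < c) (ha : 0 ≤ a) :
    expMeasure c (Ioi a) = ENNReal.ofReal (Real.exp (-(c * a))) := by
  have := isProbabilityMeasure_expMeasure hc
  simpa using lintegral_expMeasure_shift (c := c) ha (f := fun _ => 1) measurable_const

/-- The family tree with root `p` and family trees `φ` of the children. -/
def Tree.graft (p : ℝ × ℕ) (φ : ℕ → Tree) : Tree
  | [] => p
  | j :: v => φ j v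

theorem Tree.measurable_graft :
    Measurable fun q : (ℝ × ℕ) × (ℕ → Tree) => Tree.graft q.1 q.2 := by
  refine measurable_pi_lambda _ fun v => ?_
  cases v with
  | nil => exact measurable_fst
  | cons j v =>
    exact (measurable_pi_apply v).comp ((measurable_pi_apply j).comp measurable_snd)

variable [IsFiniteMeasure μ] [NeZero μ]

theorem real_univ_pos : 0 < μ.real univ := by
  simp [Measure.real, ENNReal.toReal_pos_iff, pos_iff_ne_zero, NeZero.ne μ]

instance : IsProbabilityMeasure (expMeasure (μ.real univ)) :=
  isProbabilityMeasure_expMeasure (real_univ_pos μ)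

/-- An independent sequence of trees is, by currying, one independent family of marks indexed by `ℕ
× List ℕ`. -/
theorem infinitePi_treeLaw_box (s : Finset (ℕ × List ℕ)) (t : ℕ × List ℕ → Set (ℝ × ℕ))
    (ht : ∀ i, MeasurableSet (t i)) :
    Measure.infinitePi (fun _ : ℕ => treeLaw μ) {φ | ∀ i ∈ s, φ i.1 i.2 ∈ t i} =
      ∏ i ∈ s, individualLaw μ (t i) := by
  have h := Measure.infinitePi_map_curry_symm (fun (_ : ℕ) (_ : List ℕ) => individualLaw μ)
  have h2 := Measure.infinitePi_pi (μ := fun _ : ℕ × List ℕ => individualLaw μ) (s := s)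
    (t := t) (fun i _ => ht i)
  rw [← h, Measure.map_apply (by fun_prop)
    (.pi s.countable_toSet fun i _ => ht i)] at h2
  rw [← h2]
  rfl

/-- The map `(j, v) ↦ j :: v` is a bijection onto the nonempty words, so a root mark and an
independent sequence of trees carry the same independent marks as one tree. All potential children
are grafted, whatever the number of real ones, so the root stays independent of them. Agreement on
finite boxes suffices. -/
theorem map_graft : (((individualLaw μ).prod (Measure.infinitePi fun _ : ℕ => treeLaw μ)).map
    fun q => Tree.graft q.1 q.2) = treeLaw μ := by
  classical
  refine Measure.eq_infinitePi _ fun s t ht => ?_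
  rw [Measure.map_apply Tree.measurable_graft (.pi s.countable_toSet fun i _ => ht i)]
  have hinj : Function.Injective fun i : ℕ × List ℕ => i.1 :: i.2 := by
    rintro ⟨i, v⟩ ⟨j, w⟩ h
    simpa using h
  set s' := s.preimage (fun i : ℕ × List ℕ => i.1 :: i.2) hinj.injOn with hs'
  have hpre : (fun q : (ℝ × ℕ) × (ℕ → Tree) => Tree.graft q.1 q.2) ⁻¹' Set.pi s t =
      (if [] ∈ s then t [] else univ) ×ˢ {φ | ∀ i ∈ s', φ i.1 i.2 ∈ t (i.1 :: i.2)} := by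
    ext ⟨p, φ⟩
    simp only [mem_preimage, Set.mem_pi, mem_prod, mem_ofPred_eq, hs', Finset.mem_preimage,
      Finset.mem_coe]
    constructor
    · intro h
      refine ⟨?_, fun i hi => h _ hi⟩
      split_ifs with h0
      · exact h _ h0
      · trivial
    · rintro ⟨h1, h2⟩ v hv
      cases v with
      | nil => rw [if_pos hv] at h1; exact h1
      | cons j v => exact h2 (j, v) hv
  rw [hpre, Measure.prod_prod, infinitePi_treeLaw_box _ _ _ fun i => ht _]
  have hsplit : ∏ i ∈ s', individualLaw μ (t (i.1 :: i.2)) =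
      ∏ v ∈ s.erase [], individualLaw μ (t v) := by
    refine Finset.prod_bij (fun i _ => i.1 :: i.2) ?_ (fun i _ j _ h => hinj h) ?_ fun _ _ => rfl
    · intro i hi
      simpa [hs'] using hi
    · intro v hv
      cases v with
      | nil => simp at hv
      | cons j v => exact ⟨(j, v), by simpa [hs'] using hv, rfl⟩
  rw [hsplit]
  split_ifs with h0
  · exact Finset.mul_prod_erase s (fun v => individualLaw μ (t v)) h0
  · rw [measure_univ, one_mul, Finset.erase_eq_of_notMem h0]

theorem map_infinitePi_forest (k : ℕ) :
    (Measure.infinitePi fun _ : ℕ => treeLaw μ).map (fun φ (j : Fin k) => φ j) =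
      forestLaw μ k := by
  rw [forestLaw, ← Measure.infinitePi_eq_pi]
  exact Measure.map_infinitePi_infinitePi_of_inj (P := fun _ : ℕ => treeLaw μ) Fin.val_injective

/-- The decomposition of a family tree at its root. -/
theorem lintegral_treeLaw {f : Tree → ℝ≥0∞} (hf : Measurable f)
    (G : ∀ k, ℝ → Forest k → ℝ≥0∞) (hG : ∀ k l, Measurable (G k l))
    (h : ∀ᵐ τ ∂treeLaw μ, f τ = G (τ []).2 (τ []).1 fun j => τ.child j) :
    ∫⁻ τ, f τ ∂treeLaw μ = ∫⁻ p, ∫⁻ F, G p.2 p.1 F ∂forestLaw μ p.2 ∂individualLaw μ := by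
  rw [← map_graft] at h ⊢
  rw [lintegral_map hf Tree.measurable_graft,
    lintegral_prod (fun q : (ℝ × ℕ) × (ℕ → Tree) => f (Tree.graft q.1 q.2))
      (hf.comp Tree.measurable_graft).aemeasurable]
  have h' := Measure.ae_ae_of_ae_prod (ae_of_ae_map Tree.measurable_graft.aemeasurable h)
  refine lintegral_congr_ae ?_
  filter_upwards [h'] with p hp
  rw [← map_infinitePi_forest, lintegral_map (hG _ _) (by fun_prop)]
  exact lintegral_congr_ae hp

theorem lintegral_individualLaw {f : ℝ × ℕ → ℝ≥0∞} (hf : Measurable f) :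
    ∫⁻ p, f p ∂individualLaw μ =
      ∑' k, (μ univ)⁻¹ * μ {k} * ∫⁻ l, f (l, k) ∂expMeasure (μ.real univ) := by
  rw [individualLaw, lintegral_prod_symm' _ hf, lintegral_countable']
  exact tsum_congr fun k => by rw [mul_comm, Measure.smul_apply, smul_eq_mul]

theorem individualLaw_fst (s : Set ℝ) :
    individualLaw μ {p | p.1 ∈ s} = expMeasure (μ.real univ) s := by
  have : {p : ℝ × ℕ | p.1 ∈ s} = s ×ˢ univ := by ext; simp
  rw [individualLaw, this, Measure.prod_prod, Measure.smul_apply, smul_eq_mul,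
    ENNReal.inv_mul_cancel (by simpa using NeZero.ne μ) (measure_ne_top μ _), mul_one]

theorem ae_pos_individualLaw : ∀ᵐ p ∂individualLaw μ, 0 < p.1 := by
  rw [ae_iff]
  have : {p : ℝ × ℕ | ¬ 0 < p.1} = {p | p.1 ∈ (Ioi (0 : ℝ))ᶜ} := by ext; simp
  rw [this, individualLaw_fst, prob_compl_eq_zero_iff measurableSet_Ioi,
    expMeasure_Ioi (real_univ_pos μ) le_rfl]
  simp

theorem ae_pos_treeLaw : ∀ᵐ τ ∂treeLaw μ, τ.Pos := by
  refine ae_all_iff.2 fun v => ?_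
  exact (measurePreserving_eval_infinitePi (fun _ : List ℕ => individualLaw μ)
      v).quasiMeasurePreserving.ae
    (ae_pos_individualLaw μ)

theorem ae_pos_forestLaw (x : ℕ) : ∀ᵐ F ∂forestLaw μ x, F.Pos := by
  refine ae_all_iff.2 fun i => ?_
  exact (Measure.quasiMeasurePreserving_eval (fun _ : Fin x => treeLaw μ) i).ae (ae_pos_treeLaw μ)

/-- With the child trees fixed, the death time of `v` is the root lifetime plus a constant, and the
exponential law has no atoms. This disposes of the boundary cases `T = u` and `T = 0`. -/
theorem ae_death_ne (v : List ℕ) (q : ℝ) : ∀ᵐ τ ∂treeLaw μ, τ.death v ≠ q := by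
  have hm : MeasurableSet {τ : Tree | τ.death v = q} :=
    Tree.measurable_death v (measurableSet_singleton q)
  rw [ae_iff]
  simp only [ne_eq, not_not]
  rw [← map_graft, Measure.map_apply Tree.measurable_graft hm,
    Measure.prod_apply_symm (hm.preimage Tree.measurable_graft), lintegral_eq_zero_iff'
      (measurable_measure_prodMk_right (hm.preimage Tree.measurable_graft)).aemeasurable]
  refine Filter.Eventually.of_forall fun φ => ?_
  have key : ∀ d : ℝ, individualLaw μ {p | p.1 + d = q} = 0 := by
    intro d
    have : {p : ℝ × ℕ | p.1 + d = q} = {p | p.1 ∈ ({q - d} : Set ℝ)} := by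
      ext p; simp [eq_sub_iff_add_eq]
    rw [this, individualLaw_fst, measure_singleton]
  cases v with
  | nil => simpa [Tree.death_nil, Tree.graft] using key 0
  | cons j v =>
    simp only [Tree.death_cons]
    exact key ((φ j).death v)

end Law

/-! ### The branching property -/

section Law

theorem lintegral_pi_prod {ι : Type*} [Fintype ι] {E : ι → Type*} [∀ i, MeasurableSpace (E i)]
    (ν : ∀ i, Measure (E i)) [∀ i, IsProbabilityMeasure (ν i)] (f : ∀ i, E i → ℝ≥0∞)
    (hf : ∀ i, Measurable (f i)) :
    ∫⁻ F, ∏ i, f i (F i) ∂Measure.pi ν = ∏ i, ∫⁻ e, f i e ∂ν i := by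
  rw [lintegral_prod_eq_prod_lintegral_of_indepFun Finset.univ (fun i (F : ∀ i, E i) => f i (F i))
    (iIndepFun_pi fun i => (hf i).aemeasurable) (fun i => (hf i).comp (measurable_pi_apply i))]
  exact Finset.prod_congr rfl fun i _ =>
    (measurePreserving_eval ν i).lintegral_comp (hf i)

variable (μ : Measure ℕ) [IsFiniteMeasure μ] [NeZero μ]

theorem lintegral_forestLaw_one {f : Tree → ℝ≥0∞} (hf : Measurable f) :
    ∫⁻ F, f (F 0) ∂forestLaw μ 1 = ∫⁻ τ, f τ ∂treeLaw μ :=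
  (measurePreserving_eval (fun _ : Fin 1 => treeLaw μ) 0).lintegral_comp hf

theorem lintegral_individualLaw_shift {r : ℝ} (hr : 0 ≤ r) {f : ℝ × ℕ → ℝ≥0∞}
    (hf : Measurable f) :
    ∫⁻ p, (Ioi r).indicator (fun l => f (l - r, p.2)) p.1 ∂individualLaw μ =
      expMeasure (μ.real univ) (Ioi r) * ∫⁻ p, f p ∂individualLaw μ := by
  have hm : Measurable fun p : ℝ × ℕ => (Ioi r).indicator (fun l => f (l - r, p.2)) p.1 := by
    have : (fun p : ℝ × ℕ => (Ioi r).indicator (fun l => f (l - r, p.2)) p.1) =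
        {p : ℝ × ℕ | r < p.1}.indicator fun p => f (p.1 - r, p.2) := by
      ext p; simp [indicator]
    rw [this]
    exact (hf.comp (by fun_prop)).indicator (measurableSet_lt measurable_const measurable_fst)
  rw [lintegral_individualLaw μ hm, lintegral_individualLaw μ hf, ← ENNReal.tsum_mul_left]
  refine tsum_congr fun k => ?_
  change _ * ∫⁻ l, (Ioi r).indicator (fun l' => f (l' - r, k)) l ∂_ = _
  rw [lintegral_indicator measurableSet_Ioi,
    lintegral_expMeasure_shift hr (f := fun l => f (l, k)) (by fun_prop),
    expMeasure_Ioi (real_univ_pos μ) hr]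
  ring

/-- The branching property for a single founder: given the individuals of `W` alive at time `r`,
their family trees from time `r` on are independent and distributed as the whole family tree. -/
def TreeBranching (L : ℕ) : Prop :=
  ∀ (r : ℝ) (W : Set (List ℕ)) (S : Finset (List ℕ)), (∀ v ∈ S, v.length < L) →
    ∀ g : List ℕ → Tree → ℝ≥0∞, (∀ v, Measurable (g v)) →
    ∫⁻ τ, {τ : Tree | τ.alive r ∩ W = S}.indicator
        (fun τ => ∏ v ∈ S, g v (Tree.residual r v τ)) τ ∂treeLaw μ =
      treeLaw μ {τ | τ.alive r ∩ W = S} * ∏ v ∈ S, ∫⁻ τ, g v τ ∂treeLaw μ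

theorem Tree.measurableSet_alive_inter_eq (r : ℝ) (W S : Set (List ℕ)) :
    MeasurableSet {τ : Tree | τ.alive r ∩ W = S} :=
  measurableSet_setOf_inter_eq
    (fun v => (Tree.measurableSet_mem_alive v).preimage measurable_prodMk_left) W S

theorem Forest.measurableSet_alive_inter_eq {x : ℕ} (W S : Set (Individual x)) :
    MeasurableSet {p : ℝ × Forest x | p.2.alive p.1 ∩ W = S} :=
  measurableSet_setOf_inter_eq Forest.measurableSet_mem_alive W S

theorem Tree.measurable_indicator_prod (r : ℝ) (W : Set (List ℕ)) (S : Finset (List ℕ))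
    {g : List ℕ → Tree → ℝ≥0∞} (hg : ∀ v, Measurable (g v)) :
    Measurable ({τ : Tree | τ.alive r ∩ W = S}.indicator
        (fun τ => ∏ v ∈ S, g v (Tree.residual r v τ))) :=
  (Finset.measurable_prod _ fun v _ => (hg v).comp
    ((Tree.measurable_residual v).comp measurable_prodMk_left)).indicator
      (Tree.measurableSet_alive_inter_eq r W S)

variable {μ}

/-- Both the event and the product factor over the founders, through the fibres of `W` and `S`, and
the founders' trees are independent. -/
theorem TreeBranching.forest {L : ℕ} (h : TreeBranching μ L) {x : ℕ} (r : ℝ)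
    (W : Set (Individual x)) (S : Finset (Individual x)) (hS : ∀ c ∈ S, c.2.length < L)
    (g : Individual x → Tree → ℝ≥0∞) (hg : ∀ c, Measurable (g c)) :
    ∫⁻ F, {F : Forest x | F.alive r ∩ W = S}.indicator
        (fun F => ∏ c ∈ S, g c (Tree.residual r c.2 (F c.1))) F ∂forestLaw μ x =
      forestLaw μ x {F | F.alive r ∩ W = S} * ∏ c ∈ S, ∫⁻ τ, g c τ ∂treeLaw μ := by
  classical
  set S' : Fin x → Finset (List ℕ) := fun i =>
    S.preimage (Prod.mk i) (Prod.mk_right_injective i).injOn with hS'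
  set W' : Fin x → Set (List ℕ) := fun i => {v | (i, v) ∈ W} with hW'
  have hprod : ∀ f : Individual x → ℝ≥0∞, ∏ c ∈ S, f c = ∏ i, ∏ v ∈ S' i, f (i, v) := by
    intro f
    rw [Finset.prod_sigma']
    refine (Finset.prod_bij (fun p _ => (p.1, p.2)) ?_ ?_ ?_ ?_).symm
    · simp [hS']
    · rintro ⟨i, v⟩ _ ⟨j, w⟩ _ h
      simpa using h
    · rintro ⟨i, v⟩ hc
      exact ⟨⟨i, v⟩, by simpa [hS'] using hc, rfl⟩
    · simp
  have hset : ∀ F : Forest x, F.alive r ∩ W = S ↔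
      ∀ i, (F i).alive r ∩ W' i = S' i := by
    intro F
    simp only [Set.ext_iff, mem_inter_iff, Forest.mem_alive, Prod.forall, hW', hS',
      Finset.coe_preimage, mem_preimage, mem_ofPred_eq]
  have hind : ∀ g : Individual x → Tree → ℝ≥0∞, ∀ F : Forest x,
      {F : Forest x | F.alive r ∩ W = S}.indicator
        (fun F => ∏ c ∈ S, g c (Tree.residual r c.2 (F c.1))) F =
      ∏ i, {τ : Tree | τ.alive r ∩ W' i = S' i}.indicator
        (fun τ => ∏ v ∈ S' i, g (i, v) (Tree.residual r v τ)) (F i) := by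
    intro g F
    by_cases hF : F.alive r ∩ W = S
    · rw [indicator_of_mem (show F ∈ {F : Forest x | F.alive r ∩ W = S} from hF), hprod]
      refine Finset.prod_congr rfl fun i _ => ?_
      rw [indicator_of_mem (show F i ∈ {τ : Tree | τ.alive r ∩ W' i = S' i} from (hset F).1 hF i)]
    · rw [indicator_of_notMem (show F ∉ {F : Forest x | F.alive r ∩ W = S} from hF)]
      obtain ⟨i, hi⟩ := not_forall.1 fun h => hF ((hset F).2 h)
      refine (Finset.prod_eq_zero (Finset.mem_univ i) ?_).symm
      rw [indicator_of_notMem (show F i ∉ {τ : Tree | τ.alive r ∩ W' i = S' i} from hi)]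
  have key : ∀ g : Individual x → Tree → ℝ≥0∞, (∀ c, Measurable (g c)) →
      ∫⁻ F, {F : Forest x | F.alive r ∩ W = S}.indicator
        (fun F => ∏ c ∈ S, g c (Tree.residual r c.2 (F c.1))) F ∂forestLaw μ x =
      (∏ i, treeLaw μ {τ | τ.alive r ∩ W' i = S' i}) * ∏ c ∈ S, ∫⁻ τ, g c τ ∂treeLaw μ := by
    intro g hg
    rw [lintegral_congr (hind g), forestLaw, lintegral_pi_prod (fun _ : Fin x => treeLaw μ) _
      fun i => Tree.measurable_indicator_prod r (W' i) (S' i) fun v => hg (i, v), hprod,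
      ← Finset.prod_mul_distrib]
    refine Finset.prod_congr rfl fun i _ => ?_
    refine h r (W' i) (S' i) (fun v hv => ?_) (fun v => g (i, v)) fun v => hg (i, v)
    exact hS (i, v) (by simpa [hS'] using hv)
  rw [key g hg]
  -- Taking all functionals equal to `1` identifies the remaining factor with the probability of the
  -- event.
  have h1 := key (fun _ _ => 1) fun _ => measurable_const
  simp only [Finset.prod_const_one, lintegral_const, measure_univ, mul_one] at h1
  have hm : MeasurableSet {F : Forest x | F.alive r ∩ W = S} :=
    (Forest.measurableSet_alive_inter_eq W S).preimage measurable_prodMk_left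
  rw [lintegral_indicator_const hm, one_mul] at h1
  rw [h1]

variable (μ) in
-- Lack of memory: given survival up to `r`, the residual lifetime of the root is again exponential,
-- and neither its number of children nor their trees are touched.
theorem lintegral_residual_nil {r : ℝ} (hr : 0 ≤ r) {f : Tree → ℝ≥0∞} (hf : Measurable f) :
    ∫⁻ τ, {τ : Tree | r < (τ []).1}.indicator (fun τ => f (Tree.residual r [] τ)) τ ∂treeLaw μ =
      expMeasure (μ.real univ) (Ioi r) * ∫⁻ τ, f τ ∂treeLaw μ := by
  have hgr := Tree.measurable_graft
  have hm : MeasurableSet {τ : Tree | r < (τ []).1} :=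
    measurableSet_lt measurable_const (measurable_pi_apply (X := fun _ : List ℕ => ℝ × ℕ) []).fst
  have hf' : Measurable ({τ : Tree | r < (τ []).1}.indicator
      fun τ => f (Tree.residual r [] τ)) :=
    (hf.comp ((Tree.measurable_residual []).comp measurable_prodMk_left)).indicator hm
  have hres : ∀ p φ, Tree.residual r [] (Tree.graft p φ) = Tree.graft (p.1 - r, p.2) φ := by
    intro p φ
    funext v
    cases v <;> simp [Tree.residual, Tree.graft]
  rw [← map_graft, lintegral_map hf' hgr, lintegral_map hf hgr,
    lintegral_prod (fun q : (ℝ × ℕ) × (ℕ → Tree) => f (Tree.graft q.1 q.2))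
      (hf.comp hgr).aemeasurable,
    lintegral_prod (fun q : (ℝ × ℕ) × (ℕ → Tree) => {τ : Tree | r < (τ []).1}.indicator
      (fun τ => f (Tree.residual r [] τ)) (Tree.graft q.1 q.2)) (hf'.comp hgr).aemeasurable,
    ← lintegral_individualLaw_shift μ hr (f := fun p => ∫⁻ φ, f (Tree.graft p φ)
      ∂Measure.infinitePi fun _ : ℕ => treeLaw μ)
      (Measurable.lintegral_prod_right' (f := fun q : (ℝ × ℕ) × (ℕ → Tree) =>
        f (Tree.graft q.1 q.2)) (hf.comp hgr))]
  refine lintegral_congr fun p => ?_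
  by_cases hp : r < p.1
  · rw [indicator_of_mem (mem_Ioi.2 hp)]
    refine lintegral_congr fun φ => ?_
    rw [indicator_of_mem (show Tree.graft p φ ∈ {τ : Tree | r < (τ []).1} from hp), hres]
  · rw [indicator_of_notMem (fun h => hp (mem_Ioi.1 h))]
    rw [← lintegral_zero (μ := Measure.infinitePi fun _ : ℕ => treeLaw μ)]
    refine lintegral_congr fun φ => ?_
    rw [indicator_of_notMem (show Tree.graft p φ ∉ {τ : Tree | r < (τ []).1} from hp)]

theorem Tree.Pos.alive_eq_singleton {τ : Tree} (h : τ.Pos) {r : ℝ} (hr : 0 ≤ r)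
    (hl : r < (τ []).1) : τ.alive r = {[]} := by
  ext v
  cases v with
  | nil => simp [Tree.nil_mem_alive, hr, hl]
  | cons j v =>
    simp only [mem_singleton_iff, reduceCtorEq, iff_false, Tree.cons_mem_alive, not_and]
    intro _ hv
    linarith [(h.child j).nonneg_of_mem_alive hv]

/-- The population of the children of the founder. -/
def Tree.children (τ : Tree) (k : ℕ) : Forest k := fun j => τ.child j

/-- The first conjunct does not follow from the second: individuals of a forest with `k` founders
cannot express words whose first letter is at least `k`, so such elements of `S` would go unnoticed.
-/
theorem Tree.children_alive_inter_eq {τ : Tree} {r : ℝ} (hl : (τ []).1 ≤ r) {W : Set (List ℕ)}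
    {S : Finset (List ℕ)} (hS : [] ∉ S) : τ.alive r ∩ W = S ↔
      (∀ j v, j :: v ∈ S → j < (τ []).2) ∧
      (τ.children (τ []).2).alive (r - (τ []).1) ∩ {c | (c.1 : ℕ) :: c.2 ∈ W} =
        {c : Individual (τ []).2 | (c.1 : ℕ) :: c.2 ∈ S} := by
  constructor
  · intro h
    have h1 : ∀ j v, j :: v ∈ S → j < (τ []).2 := by
      intro j v hv
      have : j :: v ∈ τ.alive r ∩ W := h ▸ hv
      exact (Tree.cons_mem_alive.1 this.1).1
    refine ⟨h1, ?_⟩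
    ext ⟨j, v⟩
    have := Set.ext_iff.1 h ((j : ℕ) :: v)
    rw [mem_inter_iff, Tree.cons_mem_alive] at this
    simpa [Forest.mem_alive, Tree.children] using this
  · rintro ⟨h1, h2⟩
    ext v
    cases v with
    | nil =>
      simp only [mem_inter_iff, Tree.nil_mem_alive, Finset.mem_coe, hS, iff_false]
      rintro ⟨⟨_, h⟩, _⟩
      linarith
    | cons j v =>
      rw [mem_inter_iff, Tree.cons_mem_alive]
      by_cases hj : j < (τ []).2
      · have := Set.ext_iff.1 h2 (⟨j, hj⟩, v)
        simpa [Forest.mem_alive, Tree.children, hj] using this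
      · simp only [hj, false_and, Finset.mem_coe, false_iff]
        exact fun h => hj (h1 j v h)

/-- If the root belongs to `S` it is the only individual alive, and lack of memory applies.
Otherwise it is dead by time `r`; conditionally on its mark `(ℓ, k)`, the `k` child trees are
observed at time `r - ℓ`, and the words of `S` lose their first letter, which puts them within reach
of the induction hypothesis. -/
theorem TreeBranching.succ {L : ℕ} (h : TreeBranching μ L) : TreeBranching μ (L + 1) := by
  classical
  intro r W S hSL g hg
  have hmE := Tree.measurableSet_alive_inter_eq r W S
  -- The tree facts used below hold only almost surely. Once the event is not null, they force
  -- deterministic conclusions about `r`, `W` and `S`.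
  by_cases hnull : treeLaw μ {τ : Tree | τ.alive r ∩ W = S} = 0
  · rw [hnull, zero_mul, lintegral_indicator hmE, Measure.restrict_eq_zero.2 hnull,
      lintegral_zero_measure]
  rcases S.eq_empty_or_nonempty with rfl | hne
  · simp only [Finset.prod_empty, mul_one]
    rw [lintegral_indicator_const hmE, one_mul]
  have hr : 0 ≤ r := by
    by_contra hr
    refine hnull ((measure_eq_zero_iff_ae_notMem).2 ?_)
    filter_upwards [ae_pos_treeLaw μ] with τ hτ hE
    obtain ⟨v, hv⟩ := hne
    have hv' : v ∈ τ.alive r ∩ W := (mem_ofPred.1 hE) ▸ hv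
    exact hr (hτ.nonneg_of_mem_alive hv'.1)
  by_cases h0 : [] ∈ S
  · have hW : [] ∈ W ∧ S = {[]} := by
      by_contra hcon
      refine hnull ((measure_eq_zero_iff_ae_notMem).2 ?_)
      filter_upwards [ae_pos_treeLaw μ] with τ hτ hE
      have h0' : [] ∈ τ.alive r ∩ W := (mem_ofPred.1 hE) ▸ h0
      refine hcon ⟨h0'.2, ?_⟩
      have hal := hτ.alive_eq_singleton hr (Tree.nil_mem_alive.1 h0'.1).2
      rw [hal, singleton_inter_of_mem h0'.2] at hE
      exact_mod_cast hE.symm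
    obtain ⟨hW, rfl⟩ := hW
    have hset : ∀ f : Tree → ℝ≥0∞, ∀ᵐ τ ∂treeLaw μ,
        {τ : Tree | τ.alive r ∩ W = ({[]} : Finset (List ℕ))}.indicator f τ =
        {τ : Tree | r < (τ []).1}.indicator f τ := by
      intro f
      filter_upwards [ae_pos_treeLaw μ] with τ hτ
      have : τ.alive r ∩ W = ({[]} : Finset (List ℕ)) ↔ r < (τ []).1 := by
        constructor
        · intro hE
          have h0' : [] ∈ τ.alive r ∩ W := hE ▸ h0
          exact (Tree.nil_mem_alive.1 h0'.1).2
        · intro hl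
          rw [hτ.alive_eq_singleton hr hl, singleton_inter_of_mem hW]
          simp
      simp only [indicator, mem_ofPred_eq, this]
    have hP : treeLaw μ {τ : Tree | τ.alive r ∩ W = ({[]} : Finset (List ℕ))} =
        expMeasure (μ.real univ) (Ioi r) := by
      have := lintegral_residual_nil μ hr (f := fun _ => 1) measurable_const
      rw [← lintegral_indicator_one hmE, lintegral_congr_ae (hset _)]
      simpa using! this
    rw [lintegral_congr_ae (hset _), hP]
    simp only [Finset.prod_singleton]
    exact lintegral_residual_nil μ hr (hg [])
  · set S' : ∀ k, Finset (Individual k) := fun k =>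
      S.preimage (fun c : Individual k => (c.1 : ℕ) :: c.2) (by
        rintro ⟨i, v⟩ _ ⟨j, w⟩ _ hc
        simpa [Fin.ext_iff] using hc) with hS'
    have hS'c : ∀ k, (S' k : Set (Individual k)) = {c | (c.1 : ℕ) :: c.2 ∈ S} := by
      intro k; ext c; exact Finset.mem_preimage
    set W' : ∀ k, Set (Individual k) := fun k => {c | (c.1 : ℕ) :: c.2 ∈ W} with hW'
    -- `Q` collects the conditions on the root mark alone: death by time `r`, and enough children
    -- for every first letter occurring in `S`. What remains is an event of the child forest.
    set Q : ℕ → ℝ → Prop := fun k l => l ≤ r ∧ ∀ j v, j :: v ∈ S → j < k with hQ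
    have hiff : ∀ τ : Tree, τ.Pos → (τ.alive r ∩ W = S ↔ Q (τ []).2 (τ []).1 ∧
        (τ.children (τ []).2).alive (r - (τ []).1) ∩ W' (τ []).2 = S' (τ []).2) := by
      intro τ hτ
      by_cases hl : (τ []).1 ≤ r
      · rw [Tree.children_alive_inter_eq hl h0]
        rw [hS'c]
        exact ⟨fun h => ⟨⟨hl, h.1⟩, h.2⟩, fun h => ⟨h.1.2, h.2⟩⟩
      · simp only [hQ, hl, false_and, iff_false]
        intro hE
        obtain ⟨v, hv⟩ := hne
        have hv' : v ∈ τ.alive r ∩ W := hE ▸ hv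
        rw [hτ.alive_eq_singleton hr (not_le.1 hl)] at hv'
        exact h0 ((mem_singleton_iff.1 hv'.1) ▸ hv)
    have hprod : ∀ k, (∀ j v, j :: v ∈ S → j < k) → ∀ f : List ℕ → ℝ≥0∞,
        ∏ v ∈ S, f v = ∏ c ∈ S' k, f ((c.1 : ℕ) :: c.2) := by
      intro k hk f
      refine (Finset.prod_bij (fun c _ => (c.1 : ℕ) :: c.2) ?_ ?_ ?_ fun _ _ => rfl).symm
      · exact fun c hc => (Finset.mem_preimage (f := fun c : Individual k => (c.1 : ℕ) :: c.2)).1 hc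
      · rintro ⟨i, v⟩ _ ⟨j, w⟩ _ hc
        simpa [Fin.ext_iff] using hc
      · intro v hv
        cases v with
        | nil => exact absurd hv h0
        | cons j v => exact ⟨(⟨j, hk j v hv⟩, v), Finset.mem_preimage.2 hv, rfl⟩
    have key : ∀ g : List ℕ → Tree → ℝ≥0∞, (∀ v, Measurable (g v)) →
        ∫⁻ τ, {τ : Tree | τ.alive r ∩ W = S}.indicator
          (fun τ => ∏ v ∈ S, g v (Tree.residual r v τ)) τ ∂treeLaw μ =
        (∫⁻ p, {p : ℝ × ℕ | Q p.2 p.1}.indicator (fun p => forestLaw μ p.2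
          {F | F.alive (r - p.1) ∩ W' p.2 = S' p.2}) p ∂individualLaw μ) *
          ∏ v ∈ S, ∫⁻ τ, g v τ ∂treeLaw μ := by
      intro g hg
      rw [lintegral_treeLaw μ (Tree.measurable_indicator_prod r W S hg)
        (fun k l F => {F : Forest k | Q k l ∧ F.alive (r - l) ∩ W' k = S' k}.indicator
          (fun F => ∏ c ∈ S' k, g ((c.1 : ℕ) :: c.2) (Tree.residual (r - l) c.2 (F c.1))) F)]
      · rw [← lintegral_mul_const]
        · refine lintegral_congr fun p => ?_
          by_cases hp : Q p.2 p.1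
          · rw [indicator_of_mem (show p ∈ {p : ℝ × ℕ | Q p.2 p.1} from hp), hprod p.2 hp.2]
            simp only [hp, true_and]
            refine h.forest (r - p.1) (W' p.2) (S' p.2) (fun c hc => ?_)
              (fun c => g ((c.1 : ℕ) :: c.2)) fun c => hg _
            have := hSL _ (Finset.mem_preimage.1 hc)
            simpa using this
          · rw [indicator_of_notMem (show p ∉ {p : ℝ × ℕ | Q p.2 p.1} from hp)]
            simp [hp]
        · refine Measurable.indicator ?_ ?_
          · refine measurable_from_prod_countable_left fun k => ?_
            have := measurable_measure_prodMk_left (ν := forestLaw μ k)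
              (Forest.measurableSet_alive_inter_eq (W' k) (S' k : Set (Individual k)))
            exact this.comp (measurable_const.sub measurable_id)
          · exact (measurableSet_le measurable_fst measurable_const).inter
              ((MeasurableSet.of_discrete (s := {k : ℕ | ∀ j v, j :: v ∈ S → j < k})).preimage
                measurable_snd)
      · intro k l
        refine Measurable.indicator (Finset.measurable_prod _ fun c _ => (hg _).comp
          ((Tree.measurable_residual c.2).comp (measurable_const.prodMk
            (measurable_pi_apply c.1)))) ?_
        exact (MeasurableSet.const _).inter
          ((Forest.measurableSet_alive_inter_eq (W' k) (S' k : Set (Individual k))).preimage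
            measurable_prodMk_left)
      · filter_upwards [ae_pos_treeLaw μ] with τ hτ
        by_cases hE : τ.alive r ∩ W = S
        · have hE' := (hiff τ hτ).1 hE
          rw [indicator_of_mem (show τ ∈ {τ : Tree | τ.alive r ∩ W = S} from hE), hprod _ hE'.1.2]
          exact (indicator_of_mem (show τ.children (τ []).2 ∈ {F : Forest (τ []).2 |
            Q (τ []).2 (τ []).1 ∧ F.alive (r - (τ []).1) ∩ W' (τ []).2 = S' (τ []).2} from hE')
            fun F => ∏ c ∈ S' (τ []).2, g ((c.1 : ℕ) :: c.2)
              (Tree.residual (r - (τ []).1) c.2 (F c.1))).symm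
        · have hE' := mt (hiff τ hτ).2 hE
          rw [indicator_of_notMem (show τ ∉ {τ : Tree | τ.alive r ∩ W = S} from hE)]
          exact (indicator_of_notMem (show τ.children (τ []).2 ∉ {F : Forest (τ []).2 |
            Q (τ []).2 (τ []).1 ∧ F.alive (r - (τ []).1) ∩ W' (τ []).2 = S' (τ []).2} from hE')
              _).symm
    rw [key g hg]
    have h1 := key (fun _ _ => 1) fun _ => measurable_const
    simp only [Finset.prod_const_one, lintegral_const, measure_univ, mul_one] at h1
    rw [lintegral_indicator_const hmE, one_mul] at h1
    rw [h1]

variable (μ)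

theorem treeBranching (L : ℕ) : TreeBranching μ L := by
  induction L with
  | zero =>
    intro r W S hS g hg
    obtain rfl : S = ∅ := Finset.eq_empty_of_forall_notMem fun v hv => absurd (hS v hv) (by simp)
    simp only [Finset.prod_empty, mul_one]
    rw [lintegral_indicator_const (Tree.measurableSet_alive_inter_eq r W _), one_mul]
  | succ L ih => exact ih.succ

/-- The branching property: given the individuals of `W` alive at time `r`, their populations of
descendants from time `r` on are independent and distributed as the process started from one
individual. -/
theorem lintegral_branching {x : ℕ} (r : ℝ) (W : Set (Individual x)) (S : Finset (Individual x))
    (g : Individual x → Forest 1 → ℝ≥0∞) (hg : ∀ c, Measurable (g c)) :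
    ∫⁻ F, {F : Forest x | F.alive r ∩ W = S}.indicator
        (fun F => ∏ c ∈ S, g c (F.residual r c)) F ∂forestLaw μ x =
      forestLaw μ x {F | F.alive r ∩ W = S} * ∏ c ∈ S, ∫⁻ G, g c G ∂forestLaw μ 1 := by
  have hc : Measurable fun (τ : Tree) (_ : Fin 1) => τ := by fun_prop
  -- Since `S` is finite its words have bounded length, so the induction on the length bound covers
  -- it.
  have hL : ∀ c ∈ S, c.2.length < S.sup (fun c => c.2.length) + 1 := fun c hc =>
    Nat.lt_succ_of_le (Finset.le_sup (f := fun c : Individual x => c.2.length) hc)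
  have := (treeBranching μ _).forest r W S hL (fun c τ => g c fun _ => τ)
    fun c => (hg c).comp hc
  refine this.trans ?_
  congr 1
  refine Finset.prod_congr rfl fun c _ => ?_
  rw [← lintegral_forestLaw_one μ (f := fun τ => g c fun _ => τ) ((hg c).comp hc)]
  refine lintegral_congr fun F => ?_
  exact congrArg (g c) (funext fun i => by rw [Subsingleton.elim i 0])

end Law

/-! ### Generating functions -/

/-- `s ^ (m - k)`, which is `0` for `m = ⊤`. -/
noncomputable def shiftPow (s : ℝ≥0∞) (k : ℕ) (m : ℕ∞) : ℝ≥0∞ :=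
  if m = ⊤ then 0 else s ^ (m.toNat - k)

@[simp] theorem shiftPow_top (s : ℝ≥0∞) (k : ℕ) : shiftPow s k ⊤ = 0 := by simp [shiftPow]

@[simp] theorem shiftPow_coe (s : ℝ≥0∞) (k n : ℕ) : shiftPow s k n = s ^ (n - k) := by
  simp [shiftPow]

/-- The condition `k ≤ a` keeps the truncated subtraction from acting across the two summands. -/
theorem shiftPow_add (s : ℝ≥0∞) {k : ℕ} {a : ℕ∞} (h : (k : ℕ∞) ≤ a) (b : ℕ∞) :
    shiftPow s k (a + b) = shiftPow s k a * shiftPow s 0 b := by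
  induction a using ENat.recTopCoe with
  | top => simp
  | coe a =>
    induction b using ENat.recTopCoe with
    | top => simp
    | coe b =>
      rw [← Nat.cast_add, shiftPow_coe, shiftPow_coe, shiftPow_coe, ← pow_add]
      congr 1
      have : k ≤ a := by exact_mod_cast h
      omega

theorem shiftPow_zero_sum {ι : Type*} (s : ℝ≥0∞) (S : Finset ι) (m : ι → ℕ∞) :
    shiftPow s 0 (∑ c ∈ S, m c) = ∏ c ∈ S, shiftPow s 0 (m c) := by
  classical
  induction S using Finset.induction_on with
  | empty => simpa using shiftPow_coe s 0 0
  | insert c S hc ih => rw [Finset.sum_insert hc, Finset.prod_insert hc, shiftPow_add s (by simp),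
    ih]

/-- A pointwise Leibniz rule: the summand carrying the factor `N c` absorbs the loss of `k` powers
of `s`, and the other factors keep theirs. With `k = 1, 2` it yields the first derivative and the
weighted pair count. -/
theorem mul_shiftPow_sum {ι : Type*} [DecidableEq ι] (s : ℝ≥0∞) (S : Finset ι) (m : ι → ℕ∞)
    (N : ι → ℝ≥0∞) (k : ℕ) (h : ∀ c ∈ S, N c ≠ 0 → (k : ℕ∞) ≤ m c) :
    (∑ c ∈ S, N c) * shiftPow s k (∑ c ∈ S, m c) =
      ∑ c ∈ S, N c * shiftPow s k (m c) * ∏ d ∈ S.erase c, shiftPow s 0 (m d) := by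
  rw [Finset.sum_mul]
  refine Finset.sum_congr rfl fun c hc => ?_
  by_cases h0 : N c = 0
  · simp [h0]
  · rw [← Finset.add_sum_erase S m hc, shiftPow_add s (h c hc h0), shiftPow_zero_sum, mul_assoc]

theorem shiftPow_antitone {s : ℝ≥0∞} (hs : s ≤ 1) {a b : ℕ∞} (h : a ≤ b) :
    shiftPow s 0 b ≤ shiftPow s 0 a := by
  induction b using ENat.recTopCoe with
  | top => simp
  | coe b =>
    obtain ⟨a, rfl⟩ := ENat.ne_top_iff_exists.1 (ne_top_of_le_ne_top (ENat.natCast_ne_top b) h)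
    rw [shiftPow_coe, shiftPow_coe]
    exact pow_le_pow_right_of_le_one' hs (by simpa using h)

theorem shiftPow_le_one {s : ℝ≥0∞} (hs : s ≤ 1) (k : ℕ) (m : ℕ∞) : shiftPow s k m ≤ 1 := by
  unfold shiftPow
  split_ifs
  · exact zero_le_one
  · exact pow_le_one' hs _

theorem measurable_shiftPow (s : ℝ≥0∞) (k : ℕ) : Measurable (shiftPow s k) :=
  measurable_of_countable _

theorem measurable_toENNReal : Measurable (fun m : ℕ∞ => (m : ℝ≥0∞)) := measurable_of_countable _

section Law

variable (μ : Measure ℕ) [IsFiniteMeasure μ] [NeZero μ]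

theorem Forest.measurableSet_alive_eq {x : ℕ} (r : ℝ) (S : Set (Individual x)) :
    MeasurableSet {F : Forest x | F.alive r = S} :=
  measurableSet_setOf_eq_set (Forest.measurableSet_mem_alive_right r) S

theorem Forest.setOf_Z_eq {x : ℕ} (r : ℝ) (y : ℕ) : {F : Forest x | F.Z r = y} =
    ⋃ S : {S : Finset (Individual x) // S.card = y}, {F | F.alive r = (S.1 : Set (Individual x))}
      := by
  ext F
  simp only [mem_ofPred_eq, mem_iUnion, Subtype.exists, exists_prop]
  constructor
  · intro h
    have hfin : (F.alive r).Finite := by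
      rw [← encard_lt_top_iff, show (F.alive r).encard = y from h]
      exact ENat.natCast_lt_top y
    refine ⟨hfin.toFinset, ?_, by simp⟩
    rw [← ENat.natCast_inj, ← h, Forest.Z, hfin.encard_eq_coe_toFinset_card]
  · rintro ⟨S, rfl, hS⟩
    rw [Forest.Z, hS, encard_coe_eq_coe_finsetCard]

theorem setLIntegral_Z_eq {x : ℕ} (r : ℝ) (y : ℕ) (f : Forest x → ℝ≥0∞) (ν : Measure (Forest x)) :
    ∫⁻ F in {F | F.Z r = y}, f F ∂ν =
      ∑' S : {S : Finset (Individual x) // S.card = y}, ∫⁻ F in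
        {F | F.alive r = (S.1 : Set (Individual x))}, f F ∂ν := by
  rw [Forest.setOf_Z_eq, lintegral_iUnion fun S => Forest.measurableSet_alive_eq r _]
  intro S T hST
  refine disjoint_left.2 fun F hS hT => hST (Subtype.ext ?_)
  exact Finset.coe_injective ((show F.alive r = (S.1 : Set (Individual x)) from hS).symm.trans hT)

theorem measure_Z_eq {x : ℕ} (r : ℝ) (y : ℕ) (ν : Measure (Forest x)) :
    ν {F | F.Z r = y} =
      ∑' S : {S : Finset (Individual x) // S.card = y}, ν
        {F | F.alive r = (S.1 : Set (Individual x))} := by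
  simpa using setLIntegral_Z_eq r y (fun _ => 1) ν

theorem setLIntegral_alive_eq {x : ℕ} (r : ℝ) (S : Finset (Individual x))
    (g : Individual x → Forest 1 → ℝ≥0∞) (hg : ∀ c, Measurable (g c)) :
    ∫⁻ F in {F : Forest x | F.alive r = S}, ∏ c ∈ S, g c (F.residual r c) ∂forestLaw μ x =
      forestLaw μ x {F | F.alive r = S} * ∏ c ∈ S, ∫⁻ G, g c G ∂forestLaw μ 1 := by
  have := lintegral_branching μ r univ S g hg
  simp only [inter_univ] at this
  rwa [lintegral_indicator (Forest.measurableSet_alive_eq r _)] at this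

variable {μ} in
theorem setLIntegral_alive_congr {x : ℕ} {r : ℝ} {S : Finset (Individual x)}
    {f g : Forest x → ℝ≥0∞} (h : ∀ F : Forest x, F.Pos → F.alive r = S → f F = g F) :
    ∫⁻ F in {F : Forest x | F.alive r = S}, f F ∂forestLaw μ x =
      ∫⁻ F in {F : Forest x | F.alive r = S}, g F ∂forestLaw μ x := by
  refine lintegral_congr_ae ?_
  filter_upwards [ae_restrict_mem (Forest.measurableSet_alive_eq r (S : Set (Individual x))),
    ae_restrict_of_ae (ae_pos_forestLaw μ x)] with F hF hpos
  exact h F hpos hF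

/-- Branching for a functional of the population after time `r` which is a product over the
individuals alive at time `r`. -/
theorem setLIntegral_prod_branching {x : ℕ} (r : ℝ) (y : ℕ) {Θ : Forest x → ℝ≥0∞}
    {g : Forest 1 → ℝ≥0∞} (hg : Measurable g)
    (hΘ : ∀ F : Forest x, F.Pos → ∀ S : Finset (Individual x), F.alive r = S →
      Θ F = ∏ c ∈ S, g (F.residual r c)) :
    ∫⁻ F in {F | F.Z r = y}, Θ F ∂forestLaw μ x =
      forestLaw μ x {F | F.Z r = y} * (∫⁻ G, g G ∂forestLaw μ 1) ^ y := by
  rw [setLIntegral_Z_eq, measure_Z_eq, ← ENNReal.tsum_mul_right]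
  refine tsum_congr fun S => ?_
  rw [setLIntegral_alive_congr fun F hF hS => hΘ F hF S.1 hS,
    setLIntegral_alive_eq μ r S.1 (fun _ => g) fun _ => hg, Finset.prod_const, S.2]

/-- Branching for a functional of the population after time `r` which is a sum of products over the
individuals alive at time `r`. -/
theorem setLIntegral_sum_branching {x : ℕ} (r : ℝ) (y : ℕ) {Θ : Forest x → ℝ≥0∞}
    {g h : Forest 1 → ℝ≥0∞} (hg : Measurable g) (hh : Measurable h)
    (hΘ : ∀ F : Forest x, F.Pos → ∀ S : Finset (Individual x), F.alive r = S →
      Θ F = ∑ c ∈ S, h (F.residual r c) * ∏ d ∈ S.erase c, g (F.residual r d)) :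
    ∫⁻ F in {F | F.Z r = y}, Θ F ∂forestLaw μ x =
      forestLaw μ x {F | F.Z r = y} *
        (y * (∫⁻ G, h G ∂forestLaw μ 1) * (∫⁻ G, g G ∂forestLaw μ 1) ^ (y - 1)) := by
  classical
  rw [setLIntegral_Z_eq, measure_Z_eq, ← ENNReal.tsum_mul_right]
  refine tsum_congr fun S => ?_
  -- Each summand is written as a single product over `S` with a distinguished factor at `c`, the
  -- form to which the branching identity applies.
  have hsplit : ∀ c ∈ S.1, ∀ a b : Individual x → ℝ≥0∞,
      a c * ∏ d ∈ S.1.erase c, b d = ∏ d ∈ S.1, if d = c then a d else b d := by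
    intro c hc a b
    rw [← Finset.mul_prod_erase S.1 _ hc, if_pos rfl]
    congr 1
    exact Finset.prod_congr rfl fun d hd => (if_neg (Finset.ne_of_mem_erase hd)).symm
  have hm : ∀ c d : Individual x, Measurable (if d = c then h else g) := by
    intro c d; split_ifs <;> assumption
  rw [setLIntegral_alive_congr (g := fun F => ∑ c ∈ S.1, ∏ d ∈ S.1,
    (if d = c then h else g) (F.residual r d)), lintegral_finsetSum]
  · have : ∀ c ∈ S.1, ∫⁻ F in {F : Forest x | F.alive r = (S.1 : Set (Individual x))},
        ∏ d ∈ S.1, (if d = c then h else g) (F.residual r d) ∂forestLaw μ x =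
        forestLaw μ x {F | F.alive r = (S.1 : Set (Individual x))} *
          ((∫⁻ G, h G ∂forestLaw μ 1) * (∫⁻ G, g G ∂forestLaw μ 1) ^ (y - 1)) := by
      intro c hc
      rw [setLIntegral_alive_eq μ r S.1 _ (hm c)]
      have h1 := hsplit c hc (fun _ => ∫⁻ G, h G ∂forestLaw μ 1) fun _ => ∫⁻ G, g G ∂forestLaw μ 1
      rw [Finset.prod_const, Finset.card_erase_of_mem hc, S.2] at h1
      rw [h1]
      congr 1
      exact Finset.prod_congr rfl fun d _ => by split_ifs <;> rfl
    rw [Finset.sum_congr rfl this, Finset.sum_const, S.2, nsmul_eq_mul]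
    ring
  · intro c _
    exact Finset.measurable_prod _ fun d _ =>
      (hm c d).comp (Forest.measurable_residual_right r d)
  · intro F hF hS
    rw [hΘ F hF S.1 hS]
    refine Finset.sum_congr rfl fun c hc => ?_
    rw [hsplit c hc (fun d => h (F.residual r d)) fun d => g (F.residual r d)]
    exact Finset.prod_congr rfl fun d _ => by split_ifs <;> rfl

/-- The generating function of `Z_t`, with values in `[0, ∞]`. -/
noncomputable def gen (t : ℝ) (s : ℝ≥0∞) : ℝ≥0∞ :=
  ∫⁻ F, shiftPow s 0 (F.Z t) ∂forestLaw μ 1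

/-- The derivative of the generating function of `Z_t`. -/
noncomputable def gen' (t : ℝ) (s : ℝ≥0∞) : ℝ≥0∞ :=
  ∫⁻ F, (F.Z t : ℝ≥0∞) * shiftPow s 1 (F.Z t) ∂forestLaw μ 1

/-- The second derivative of the generating function of `Z_t`. -/
noncomputable def gen'' (t : ℝ) (s : ℝ≥0∞) : ℝ≥0∞ :=
  ∫⁻ F, (F.Z t : ℝ≥0∞) * ((F.Z t : ℝ≥0∞) - 1) * shiftPow s 2 (F.Z t) ∂forestLaw μ 1

theorem Forest.measurable_shiftPow_Z {x : ℕ} (s : ℝ≥0∞) (k : ℕ) (t : ℝ) :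
    Measurable fun F : Forest x => shiftPow s k (F.Z t) :=
  (measurable_shiftPow s k).comp (Forest.measurable_Z t)

theorem Forest.measurable_Z_toENNReal {x : ℕ} (t : ℝ) :
    Measurable fun F : Forest x => (F.Z t : ℝ≥0∞) :=
  measurable_toENNReal.comp (Forest.measurable_Z t)

theorem Forest.measurable_pairs_toENNReal {x : ℕ} (t q : ℝ) :
    Measurable fun F : Forest x => ((F.pairs t q).encard : ℝ≥0∞) :=
  measurable_toENNReal.comp (Forest.measurable_encard_pairs t q)

theorem setLIntegral_shiftPow {x : ℕ} {r q : ℝ} (hr : 0 ≤ r) (hq : 0 ≤ q) (y : ℕ) (s : ℝ≥0∞) :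
    ∫⁻ F in {F | F.Z r = y}, shiftPow s 0 (F.Z (r + q)) ∂forestLaw μ x =
      forestLaw μ x {F | F.Z r = y} * gen μ q s ^ y :=
  setLIntegral_prod_branching μ r y (Forest.measurable_shiftPow_Z s 0 q) fun F hF S hS => by
    rw [hF.Z_add hr hq hS, shiftPow_zero_sum]

theorem setLIntegral_Z_mul_shiftPow {x : ℕ} {r q : ℝ} (hr : 0 ≤ r) (hq : 0 ≤ q) (y : ℕ)
    (s : ℝ≥0∞) :
    ∫⁻ F in {F | F.Z r = y}, (F.Z (r + q) : ℝ≥0∞) * shiftPow s 1 (F.Z (r + q)) ∂forestLaw μ x =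
      forestLaw μ x {F | F.Z r = y} * (y * gen' μ q s * gen μ q s ^ (y - 1)) := by
  classical
  refine setLIntegral_sum_branching μ r y
    (g := fun G => shiftPow s 0 (G.Z q)) (h := fun G => (G.Z q : ℝ≥0∞) * shiftPow s 1 (G.Z q))
    (Forest.measurable_shiftPow_Z s 0 q)
    ((Forest.measurable_Z_toENNReal q).mul (Forest.measurable_shiftPow_Z s 1 q)) fun F hF S hS => ?_
  have hcast : ((∑ c ∈ S, (F.residual r c).Z q : ℕ∞) : ℝ≥0∞) =
      ∑ c ∈ S, ((F.residual r c).Z q : ℝ≥0∞) := map_sum ENat.toENNRealRingHom _ _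
  rw [hF.Z_add hr hq hS, hcast, mul_shiftPow_sum]
  intro c _ hc
  rw [Nat.cast_one, Order.one_le_iff_ne_zero]
  exact fun h => hc (by rw [h, ENat.toENNReal_zero])

theorem two_le_Z_of_pairs {x : ℕ} {F : Forest x} {t q : ℝ} (h : (F.pairs t q).encard ≠ 0) :
    2 ≤ F.Z t := by
  obtain ⟨⟨a, b⟩, hab, ha, hb, -⟩ := encard_ne_zero.1 h
  rw [Forest.Z, ← encard_pair hab]
  exact encard_le_encard (pair_subset ha hb)

theorem setLIntegral_pairs_mul_shiftPow {x : ℕ} {r q t : ℝ} (hr : 0 ≤ r) (hq : 0 ≤ q) (ht : q ≤ t)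
    (y : ℕ) (s : ℝ≥0∞) :
    ∫⁻ F in {F | F.Z r = y}, ((F.pairs (r + t) (r + q)).encard : ℝ≥0∞) *
        shiftPow s 2 (F.Z (r + t)) ∂forestLaw μ x =
      forestLaw μ x {F | F.Z r = y} *
        (y * (∫⁻ G, ((G.pairs t q).encard : ℝ≥0∞) * shiftPow s 2 (G.Z t) ∂forestLaw μ 1) *
          gen μ t s ^ (y - 1)) := by
  classical
  refine setLIntegral_sum_branching μ r y
    (g := fun G => shiftPow s 0 (G.Z t))
    (h := fun G => ((G.pairs t q).encard : ℝ≥0∞) * shiftPow s 2 (G.Z t))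
    (Forest.measurable_shiftPow_Z s 0 t)
    ((Forest.measurable_pairs_toENNReal t q).mul (Forest.measurable_shiftPow_Z s 2 t))
    fun F hF S hS => ?_
  have hcast : ((∑ c ∈ S, ((F.residual r c).pairs t q).encard : ℕ∞) : ℝ≥0∞) =
      ∑ c ∈ S, (((F.residual r c).pairs t q).encard : ℝ≥0∞) := map_sum ENat.toENNRealRingHom _ _
  rw [hF.Z_add hr (hq.trans ht) hS, hF.encard_pairs_add hr hq ht hS, hcast, mul_shiftPow_sum]
  intro c _ hc
  refine two_le_Z_of_pairs (q := q) fun h => hc ?_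
  rw [h, ENat.toENNReal_zero]

theorem natCast_mul_sub_one (n : ℕ) :
    (((n * (n - 1) : ℕ) : ℕ∞) : ℝ≥0∞) = (n : ℝ≥0∞) * ((n : ℝ≥0∞) - 1) := by
  rw [ENat.toENNReal_coe, Nat.cast_mul]
  simp

/-- All pairs of descendants of a single founder have a common ancestor at time `0`. -/
theorem lintegral_pairs_zero (t : ℝ) (s : ℝ≥0∞) :
    ∫⁻ G, ((G.pairs t 0).encard : ℝ≥0∞) * shiftPow s 2 (G.Z t) ∂forestLaw μ 1 = gen'' μ t s := by
  refine lintegral_congr_ae ?_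
  filter_upwards [ae_pos_forestLaw μ 1] with G hG
  rcases eq_or_ne (G.Z t) ⊤ with h | h
  · simp [h]
  · obtain ⟨n, hn⟩ := ENat.ne_top_iff_exists.1 h
    rw [Forest.encard_pairs_zero (Tree.nil_mem_alive.2 ⟨le_rfl, hG 0 []⟩) hn.symm,
      natCast_mul_sub_one, ← hn, ENat.toENNReal_coe]

end Law

/-! ### Series expansions, explosion, and the chain rule in time. -/

section Law

variable (μ : Measure ℕ)

theorem lintegral_eq_tsum_Z {x : ℕ} (r : ℝ) (ν : Measure (Forest x)) {Θ : Forest x → ℝ≥0∞}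
    (h : ∀ᵐ F ∂ν, F.Z r = ⊤ → Θ F = 0) :
    ∫⁻ F, Θ F ∂ν = ∑' n : ℕ, ∫⁻ F in {F | F.Z r = n}, Θ F ∂ν := by
  have hm := fun n : ℕ => Forest.measurableSet_Z_eq (x := x) r n
  rw [← lintegral_iUnion hm, ← lintegral_add_compl _ (MeasurableSet.iUnion hm)]
  · refine (congrArg _ (?_ : _ = (0 : ℝ≥0∞))).trans (add_zero _)
    refine (setLIntegral_congr_fun_ae (g := fun _ => 0) (MeasurableSet.iUnion hm).compl ?_).trans
      lintegral_zero
    filter_upwards [h] with F hF hc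
    refine hF ?_
    by_contra hne
    obtain ⟨n, hn⟩ := ENat.ne_top_iff_exists.1 hne
    exact hc (mem_iUnion.2 ⟨n, hn.symm⟩)
  · intro m n hmn
    refine disjoint_left.2 fun F h1 h2 => hmn ?_
    exact_mod_cast (show F.Z r = m from h1).symm.trans h2

theorem setLIntegral_Z_const {x : ℕ} (r : ℝ) (n : ℕ) (ν : Measure (Forest x)) {Θ : Forest x → ℝ≥0∞}
    {c : ℝ≥0∞} (h : ∀ F : Forest x, F.Z r = n → Θ F = c) :
    ∫⁻ F in {F | F.Z r = n}, Θ F ∂ν = ν {F | F.Z r = n} * c := by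
  rw [setLIntegral_congr_fun (g := fun _ => c) (Forest.measurableSet_Z_eq r n) fun F hF => h F hF,
    setLIntegral_const, mul_comm]

theorem gen_eq_tsum (t : ℝ) (s : ℝ≥0∞) :
    gen μ t s = ∑' n : ℕ, forestLaw μ 1 {F | F.Z t = n} * s ^ n := by
  rw [gen, lintegral_eq_tsum_Z t _ (Filter.Eventually.of_forall fun F hF => by simp [hF])]
  exact tsum_congr fun n => setLIntegral_Z_const t n _ fun F hF => by simp [hF]

theorem gen'_eq_tsum (t : ℝ) (s : ℝ≥0∞) :
    gen' μ t s = ∑' n : ℕ, forestLaw μ 1 {F | F.Z t = n} * (n * s ^ (n - 1)) := by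
  rw [gen', lintegral_eq_tsum_Z t _ (Filter.Eventually.of_forall fun F hF => by simp [hF])]
  exact tsum_congr fun n => setLIntegral_Z_const t n _ fun F hF => by simp [hF]

theorem gen''_eq_tsum (t : ℝ) (s : ℝ≥0∞) :
    gen'' μ t s = ∑' n : ℕ, forestLaw μ 1 {F | F.Z t = n} *
      ((n : ℝ≥0∞) * ((n : ℝ≥0∞) - 1) * s ^ (n - 2)) := by
  rw [gen'', lintegral_eq_tsum_Z t _ (Filter.Eventually.of_forall fun F hF => by simp [hF])]
  exact tsum_congr fun n => setLIntegral_Z_const t n _ fun F hF => by simp [hF]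

theorem measurableSet_lifetime {x : ℕ} (i : Fin x) (t : ℝ) :
    MeasurableSet {F : Forest x | t < (F i []).1} := by
  have h : Measurable fun F : Forest x => (F i []).1 := by fun_prop
  exact measurableSet_lt measurable_const h

variable [IsFiniteMeasure μ] [NeZero μ]

theorem treeLaw_lifetime {t : ℝ} (ht : 0 ≤ t) :
    treeLaw μ {τ | t < (τ []).1} = ENNReal.ofReal (Real.exp (-(μ.real univ * t))) := by
  rw [← expMeasure_Ioi (real_univ_pos μ) ht, ← individualLaw_fst]
  exact (measurePreserving_eval_infinitePi (fun _ : List ℕ => individualLaw μ)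
    []).measure_preimage (measurableSet_lt measurable_const measurable_fst).nullMeasurableSet

theorem forestLaw_lifetimes {t : ℝ} (ht : 0 ≤ t) (x : ℕ) :
    forestLaw μ x {F | ∀ i, t < (F i []).1} =
      ENNReal.ofReal (Real.exp (-(μ.real univ * t))) ^ x := by
  have : {F : Forest x | ∀ i, t < (F i []).1} = Set.univ.pi fun _ => {τ : Tree | t < (τ []).1} := by
    ext F; simp
  rw [this, forestLaw, Measure.pi_pi, Finset.prod_const, treeLaw_lifetime μ ht]
  simp

theorem Forest.Pos.Z_of_lifetimes {x : ℕ} {F : Forest x} (h : F.Pos) {t : ℝ} (ht : 0 ≤ t)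
    (hF : ∀ i, t < (F i []).1) : F.Z t = x := by
  have : F.alive t = (Finset.univ : Finset (Fin x)).image fun i => (i, ([] : List ℕ)) := by
    ext ⟨i, v⟩
    rw [Forest.mem_alive, (h i).alive_eq_singleton ht (hF i)]
    simp [eq_comm]
  rw [Forest.Z, this, encard_coe_eq_coe_finsetCard, Finset.card_image_of_injective]
  · simp
  · exact fun i j hij => congrArg Prod.fst hij

/-- If no founder has died by time `t`, the population is exactly the set of founders. -/
theorem le_forestLaw_Z_eq {t : ℝ} (ht : 0 ≤ t) (x : ℕ) :
    ENNReal.ofReal (Real.exp (-(μ.real univ * t))) ^ x ≤ forestLaw μ x {F | F.Z t = x} := by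
  rw [← forestLaw_lifetimes μ ht]
  refine measure_mono_ae ?_
  filter_upwards [ae_pos_forestLaw μ x] with F hF hl
  exact hF.Z_of_lifetimes ht hl

theorem forestLaw_Z_one_pos {t : ℝ} (ht : 0 ≤ t) : 0 < forestLaw μ 1 {F | F.Z t = (1 : ℕ)} := by
  refine lt_of_lt_of_le ?_ (le_forestLaw_Z_eq μ ht 1)
  simpa using Real.exp_pos _

/-- The integrand `s ^ Z + (1 - s) 1_{Z = 1}` is at most `1`, with equality when `Z = 1`. As `Z_t =
1` has positive probability, this quantifies how far the generating function stays below `1`. -/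
theorem gen_add_le {s : ℝ≥0∞} (hs : s ≤ 1) (t : ℝ) :
    gen μ t s + forestLaw μ 1 {F | F.Z t = (1 : ℕ)} * (1 - s) ≤ 1 := by
  rw [gen, mul_comm, ← setLIntegral_const, ← lintegral_indicator (Forest.measurableSet_Z_eq t _), ←
      lintegral_add_right]
  · calc _ ≤ ∫⁻ F, 1 ∂forestLaw μ 1 := by
          refine lintegral_mono fun F => ?_
          by_cases hF : F.Z t = (1 : ℕ)
          · rw [indicator_of_mem (show F ∈ {F : Forest 1 | F.Z t = (1 : ℕ)} from hF), hF]
            rw [shiftPow_coe]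
            simp [add_tsub_cancel_of_le hs]
          · rw [indicator_of_notMem (show F ∉ {F : Forest 1 | F.Z t = (1 : ℕ)} from hF), add_zero]
            exact shiftPow_le_one hs _ _
      _ = 1 := by simp
  · exact measurable_const.indicator (Forest.measurableSet_Z_eq t _)

theorem gen_le_one {s : ℝ≥0∞} (hs : s ≤ 1) (t : ℝ) : gen μ t s ≤ 1 :=
  le_self_add.trans (gen_add_le μ hs t)

theorem gen_lt_one {s : ℝ≥0∞} (hs : s < 1) {t : ℝ} (ht : 0 ≤ t) : gen μ t s < 1 := by
  refine lt_of_lt_of_le (ENNReal.lt_add_right (ne_top_of_le_ne_top ENNReal.one_ne_top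
    (gen_le_one μ hs.le t)) ?_) (gen_add_le μ hs.le t)
  exact mul_ne_zero (forestLaw_Z_one_pos μ ht).ne' (tsub_pos_of_lt hs).ne'

theorem Forest.Pos.sum_Z_le {x : ℕ} {F : Forest x} (h : F.Pos) {r q : ℝ} (hr : 0 ≤ r)
    (hq : 0 ≤ q) {S : Finset (Individual x)} (hS : (S : Set (Individual x)) ⊆ F.alive r) :
    ∑ c ∈ S, (F.residual r c).Z q ≤ F.Z (r + q) := by
  have : ∑ c ∈ S, (F.residual r c).Z q =
      (⋃ c ∈ (S : Set (Individual x)), Individual.append c '' (F.residual r c).alive q).encard := by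
    rw [(S.finite_toSet).encard_biUnion, finsum_mem_coe_finset]
    · exact Finset.sum_congr rfl fun c _ => ((Individual.append_injective c).encard_image _).symm
    · intro c hc d hd hcd
      refine disjoint_left.2 ?_
      rintro _ ⟨e, -, rfl⟩ ⟨f, -, hf⟩
      refine hcd (h.ancestor_unique (hS hc) (hS hd) (isAncestor_append c e) ?_)
      rw [← hf]
      exact isAncestor_append d f
  rw [this, Forest.Z, h.alive_add hr hq]
  exact encard_le_encard (biUnion_subset_biUnion_left hS)

/-- Once infinitely many individuals are alive, there are so at all later times. -/
theorem ae_Z_add_eq_top {x : ℕ} {r q : ℝ} (hr : 0 ≤ r) (hq : 0 ≤ q) :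
    ∀ᵐ F ∂forestLaw μ x, F.Z r = ⊤ → F.Z (r + q) = ⊤ := by
  classical
  -- Any `s` in `(0, 1)` would do: below `1` so that `gen μ q s < 1`, and nonzero so that `shiftPow
  -- s 0 m = 0` only for `m = ⊤`.
  set s : ℝ≥0∞ := 2⁻¹ with hs
  have hs1 : s < 1 := by rw [hs]; exact ENNReal.inv_lt_one.2 ENNReal.one_lt_two
  have hβ := gen_lt_one μ hs1 hq
  -- Finite windows exhausting all individuals: the branching identity handles only finitely many
  -- individuals at once, while the population at time `r` is infinite here.
  obtain ⟨W, hWmono, hWcov⟩ : ∃ W : ℕ → Finset (Individual x), Monotone W ∧ ∀ a, ∃ n, a ∈ W n := by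
    have : Encodable (Individual x) := Encodable.ofCountable _
    refine ⟨fun n => (Finset.range n).biUnion fun k =>
        (Encodable.decode (α := Individual x) k).toFinset,
      fun m n hmn => Finset.biUnion_subset_biUnion_of_subset_left _ (Finset.range_mono hmn),
      fun a => ⟨Encodable.encode a + 1, ?_⟩⟩
    simp only [Finset.mem_biUnion, Finset.mem_range]
    exact ⟨Encodable.encode a, Nat.lt_succ_self _, by simp⟩
  -- An infinite population has `m` members in some window. Their descendants are independent and
  -- bound `Z_{r+q}` from below, so the mean of `s ^ Z_{r+q}` is at most the `m`-th power of a
  -- number smaller than `1`, for every `m`.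
  have hbound : ∀ m : ℕ, ∫⁻ F in {F : Forest x | F.Z r = ⊤}, shiftPow s 0 (F.Z (r + q))
      ∂forestLaw μ x ≤ gen μ q s ^ m := by
    intro m
    set A : ℕ → Set (Forest x) := fun n =>
      ⋃ S : {S : Finset (Individual x) // m ≤ S.card}, {F | F.alive r ∩ W n = S.1} with hA
    have hAmem : ∀ n F, F ∈ A n ↔ (m : ℕ∞) ≤ (F.alive r ∩ W n).encard := by
      intro n F
      simp only [hA, mem_iUnion, Subtype.exists, exists_prop, mem_ofPred_eq]
      constructor
      · rintro ⟨S, hS, hF⟩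
        rw [hF, encard_coe_eq_coe_finsetCard]
        exact_mod_cast hS
      · intro h
        have hfin : (F.alive r ∩ W n).Finite := (W n).finite_toSet.subset inter_subset_right
        refine ⟨hfin.toFinset, ?_, by simp⟩
        rw [hfin.encard_eq_coe_toFinset_card] at h
        exact_mod_cast h
    have hsub : {F : Forest x | F.Z r = ⊤} ⊆ ⋃ n, A n := by
      intro F hF
      have hinf : (F.alive r).Infinite := encard_eq_top_iff.1 hF
      obtain ⟨T, hT, hTm⟩ := hinf.exists_subset_card_eq m
      choose N hN using hWcov
      refine mem_iUnion.2 ⟨T.sup N, (hAmem _ _).2 ?_⟩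
      rw [← hTm, ← encard_coe_eq_coe_finsetCard]
      refine encard_le_encard fun a ha => ⟨hT ha, ?_⟩
      exact hWmono (Finset.le_sup (f := N) ha) (hN a)
    have hdir : Directed (· ⊆ ·) A := by
      refine Monotone.directed_le (fun n n' hn F hF => ?_)
      rw [hAmem] at hF ⊢
      exact hF.trans (encard_le_encard (inter_subset_inter_right _ (hWmono hn)))
    refine (lintegral_mono_set hsub).trans ?_
    rw [setLIntegral_iUnion_of_directed _ hdir]
    refine iSup_le fun n => ?_
    have hmeas : ∀ S : {S : Finset (Individual x) // m ≤ S.card},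
        MeasurableSet {F : Forest x | F.alive r ∩ W n = (S.1 : Set (Individual x))} := fun S =>
      (Forest.measurableSet_alive_inter_eq (W n : Set (Individual x)) _).preimage
        measurable_prodMk_left
    have hdisj : Pairwise (Function.onFun Disjoint
        fun S : {S : Finset (Individual x) // m ≤ S.card} =>
          {F : Forest x | F.alive r ∩ W n = (S.1 : Set (Individual x))}) := by
      intro S T hST
      refine disjoint_left.2 fun F hS hT => hST (Subtype.ext (Finset.coe_injective ?_))
      exact (show F.alive r ∩ W n = (S.1 : Set (Individual x)) from hS).symm.trans hT
    rw [hA, lintegral_iUnion hmeas hdisj]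
    calc _ ≤ ∑' S : {S : Finset (Individual x) // m ≤ S.card},
          forestLaw μ x {F : Forest x | F.alive r ∩ W n = (S.1 : Set (Individual x))} *
            gen μ q s ^ m := by
          refine ENNReal.tsum_le_tsum fun S => ?_
          have hbr := lintegral_branching μ r (W n : Set (Individual x)) S.1
            (fun _ G => shiftPow s 0 (G.Z q)) fun _ => Forest.measurable_shiftPow_Z s 0 q
          rw [lintegral_indicator (hmeas S), Finset.prod_const] at hbr
          calc _ ≤ _ := ?_
            _ = _ := hbr
            _ ≤ _ := mul_le_mul_right (pow_le_pow_right_of_le_one' hβ.le S.2) _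
          refine lintegral_mono_ae ?_
          filter_upwards [ae_restrict_mem (hmeas S), ae_restrict_of_ae (ae_pos_forestLaw μ x)]
            with F hF hpos
          rw [← shiftPow_zero_sum]
          refine shiftPow_antitone hs1.le (hpos.sum_Z_le hr hq ?_)
          rw [← show F.alive r ∩ W n = (S.1 : Set (Individual x)) from hF]
          exact inter_subset_left
      _ = forestLaw μ x (⋃ S : {S : Finset (Individual x) // m ≤ S.card},
          {F : Forest x | F.alive r ∩ W n = (S.1 : Set (Individual x))}) * gen μ q s ^ m := by
          rw [ENNReal.tsum_mul_right, measure_iUnion hdisj hmeas]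
      _ ≤ 1 * gen μ q s ^ m := by gcongr; exact prob_le_one
      _ = _ := one_mul _
  have hzero : ∫⁻ F in {F : Forest x | F.Z r = ⊤}, shiftPow s 0 (F.Z (r + q)) ∂forestLaw μ x = 0 :=
    le_antisymm (ge_of_tendsto' (ENNReal.tendsto_pow_atTop_nhds_zero_of_lt_one hβ) hbound)
      zero_le
  rw [lintegral_eq_zero_iff (Forest.measurable_shiftPow_Z s 0 _)] at hzero
  have := (ae_restrict_iff' (Forest.measurableSet_Z_eq r ⊤)).1 hzero
  filter_upwards [this] with F hF hr
  by_contra hne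
  obtain ⟨n, hn⟩ := ENat.ne_top_iff_exists.1 hne
  have h0 := hF hr
  rw [← hn, shiftPow_coe] at h0
  simp [hs] at h0

/-- The chain rule for a composition of generating functions, obtained by summing the branching
identity over the population size at time `r`; the explosive part contributes `0` because it stays
explosive. -/
theorem gen'_add {r q : ℝ} (hr : 0 ≤ r) (hq : 0 ≤ q) (s : ℝ≥0∞) :
    gen' μ (r + q) s = gen' μ r (gen μ q s) * gen' μ q s := by
  rw [gen', lintegral_eq_tsum_Z r, gen'_eq_tsum, ← ENNReal.tsum_mul_right]
  · refine tsum_congr fun y => ?_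
    rw [setLIntegral_Z_mul_shiftPow μ hr hq y s]
    ring
  · filter_upwards [ae_Z_add_eq_top μ hr hq] with F hF h
    simp [hF h]

/-- Conditionally on `y` individuals at time `q`, one of the `y` families contains the pair and
contributes `gen''`, the others contribute `gen`. Summing `y gen ^ (y - 1)` over the law of `Z_q`
gives `gen'` at `gen`. -/
theorem lintegral_pairs {q t : ℝ} (hq : 0 ≤ q) (ht : 0 ≤ t) (s : ℝ≥0∞) :
    ∫⁻ G, ((G.pairs (q + t) q).encard : ℝ≥0∞) * shiftPow s 2 (G.Z (q + t)) ∂forestLaw μ 1 =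
      gen' μ q (gen μ t s) * gen'' μ t s := by
  rw [lintegral_eq_tsum_Z q, gen'_eq_tsum, ← ENNReal.tsum_mul_right]
  · refine tsum_congr fun y => ?_
    have := setLIntegral_pairs_mul_shiftPow μ (x := 1) hq le_rfl ht y s
    rw [add_zero, lintegral_pairs_zero] at this
    rw [this]
    ring
  · filter_upwards [ae_Z_add_eq_top μ hq ht] with F hF h
    simp [hF h]

/-- The weighted number of pairs of individuals alive at time `r + (q + t)` with a common ancestor
at time `r + q`, given the population size at time `r`. -/
theorem setLIntegral_pairs {x : ℕ} {r q t : ℝ} (hr : 0 ≤ r) (hq : 0 ≤ q) (ht : 0 ≤ t) (y : ℕ)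
    (s : ℝ≥0∞) :
    ∫⁻ F in {F | F.Z r = y}, ((F.pairs (r + (q + t)) (r + q)).encard : ℝ≥0∞) *
        shiftPow s 2 (F.Z (r + (q + t))) ∂forestLaw μ x =
      forestLaw μ x {F | F.Z r = y} *
        (y * (gen' μ q (gen μ t s) * gen'' μ t s) * gen μ (q + t) s ^ (y - 1)) := by
  rw [setLIntegral_pairs_mul_shiftPow μ hr hq (le_add_of_nonneg_right ht), lintegral_pairs μ hq ht]

end Law

/-! ### Power series with bounded coefficients. -/

section PowerSeries

theorem summable_natCast_mul_pow {r : ℝ} (h0 : 0 ≤ r) (h1 : r < 1) :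
    Summable fun n : ℕ => (n : ℝ) * r ^ (n - 1) := by
  refine (summable_nat_add_iff 1).1 ?_
  have := summable_descFactorial_mul_geometric_of_norm_lt_one (R := ℝ) 1
    (r := r) (by rwa [Real.norm_of_nonneg h0])
  simpa using this

theorem natCast_mul_sub_one_nonneg (n : ℕ) : (0 : ℝ) ≤ (n : ℝ) * ((n : ℝ) - 1) := by
  rcases n with _ | n
  · simp
  · push_cast
    rw [add_sub_cancel_right]
    positivity

theorem summable_natCast_mul_sub_one_mul_pow {r : ℝ} (h0 : 0 ≤ r) (h1 : r < 1) :
    Summable fun n : ℕ => (n : ℝ) * ((n : ℝ) - 1) * r ^ (n - 2) := by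
  refine (summable_nat_add_iff 2).1 ?_
  have := summable_descFactorial_mul_geometric_of_norm_lt_one (R := ℝ) 2
    (r := r) (by rwa [Real.norm_of_nonneg h0])
  refine this.congr fun n => ?_
  rw [Nat.add_sub_cancel, Nat.descFactorial_succ, Nat.descFactorial_one,
    show n + 2 - 1 = n + 1 by omega]
  push_cast
  ring

theorem summable_mul_of_abs_le_one {a u : ℕ → ℝ} (ha : ∀ n, |a n| ≤ 1) (hu0 : ∀ n, 0 ≤ u n)
    (hu : Summable u) : Summable fun n => a n * u n :=
  Summable.of_norm_bounded hu fun n => by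
    rw [Real.norm_eq_abs, abs_mul, abs_of_nonneg (hu0 n)]
    exact mul_le_of_le_one_left (hu0 n) (ha n)

variable {a : ℕ → ℝ}

/-- On a ball of radius `r` with `|s| < r < 1` the differentiated series is dominated by the
convergent series `∑ n r ^ (n - 1)`. -/
theorem hasDerivAt_powerSeries (ha : ∀ n, |a n| ≤ 1) {s : ℝ} (hs : |s| < 1) :
    HasDerivAt (fun s => ∑' n, a n * s ^ n) (∑' n, a n * (n * s ^ (n - 1))) s := by
  obtain ⟨r, hr, hr1⟩ := exists_between hs
  have hr0 := (abs_nonneg s).trans hr.le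
  have hpos : 0 < r := (abs_nonneg s).trans_lt hr
  refine hasDerivAt_tsum_of_isPreconnected (summable_natCast_mul_pow hr0 hr1)
      (Metric.isOpen_ball (x := (0 : ℝ)) (ε := r))
    (convex_ball (0 : ℝ) r).isPreconnected (fun n y _ => (hasDerivAt_pow n y).const_mul (a n))
    (fun n y hy => ?_) (Metric.mem_ball_self hpos) ?_ (by simpa using hr)
  · rw [norm_mul, norm_mul, norm_pow, Real.norm_natCast, Real.norm_eq_abs, Real.norm_eq_abs]
    have hy' : |y| < r := by simpa using hy
    calc |a n| * (n * |y| ^ (n - 1)) ≤ 1 * (n * r ^ (n - 1)) := by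
          gcongr
          exact ha n
      _ = _ := one_mul _
  · refine summable_of_ne_finset_zero (s := {0}) fun n hn => ?_
    simp [zero_pow (by simpa using hn : n ≠ 0)]

theorem hasDerivAt_powerSeries_deriv (ha : ∀ n, |a n| ≤ 1) {s : ℝ} (hs : |s| < 1) :
    HasDerivAt (fun s => ∑' n, a n * (n * s ^ (n - 1)))
      (∑' n, a n * (n * ((n : ℝ) - 1) * s ^ (n - 2))) s := by
  obtain ⟨r, hr, hr1⟩ := exists_between hs
  have hr0 := (abs_nonneg s).trans hr.le
  have hpos : 0 < r := (abs_nonneg s).trans_lt hr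
  refine hasDerivAt_tsum_of_isPreconnected (F := ℝ) (y₀ := 0)
    (g := fun n s => a n * (n * s ^ (n - 1)))
    (g' := fun n s => a n * (n * ((n : ℝ) - 1) * s ^ (n - 2)))
    (summable_natCast_mul_sub_one_mul_pow hr0 hr1)
    (Metric.isOpen_ball (x := (0 : ℝ)) (ε := r)) (convex_ball (0 : ℝ) r).isPreconnected
    (fun n y _ => ?_) (fun n y hy => ?_) (Metric.mem_ball_self hpos) ?_ (by simpa using hr)
  · have := ((hasDerivAt_pow (n - 1) y).const_mul (n : ℝ)).const_mul (a n)
    refine this.congr_deriv ?_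
    rcases n with _ | n
    · simp
    · rw [Nat.add_sub_cancel, show n + 1 - 2 = n - 1 by omega]
      push_cast
      ring
  · rw [norm_mul, norm_mul, norm_pow, Real.norm_of_nonneg (natCast_mul_sub_one_nonneg n),
      Real.norm_eq_abs, Real.norm_eq_abs]
    have hy' : |y| < r := by simpa using hy
    have := natCast_mul_sub_one_nonneg n
    calc |a n| * (n * ((n : ℝ) - 1) * |y| ^ (n - 2)) ≤ 1 * (n * ((n : ℝ) - 1) * r ^ (n - 2)) := by
          gcongr
          exact ha n
      _ = _ := one_mul _
  · refine summable_of_ne_finset_zero (s := {1}) fun n hn => ?_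
    rcases n with _ | n
    · simp
    · have : n ≠ 0 := by simpa using hn
      simp [this]

/-- Power series with the same values on `(0, 1)` have the same coefficients. -/
theorem powerSeries_coeff_eq {a b : ℕ → ℝ} (ha : ∀ s ∈ Ioo (0 : ℝ) 1, Summable fun n => a n * s ^ n)
    (hb : ∀ s ∈ Ioo (0 : ℝ) 1, Summable fun n => b n * s ^ n)
    (h : ∀ s ∈ Ioo (0 : ℝ) 1, ∑' n, a n * s ^ n = ∑' n, b n * s ^ n) : a = b := by
  have key : ∀ c : ℕ → ℝ, (∀ s ∈ Ioo (0 : ℝ) 1, Summable fun n => c n * s ^ n) →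
      HasFPowerSeriesAt (fun s => ∑' n, c n * s ^ n) (FormalMultilinearSeries.ofScalars ℝ c) 0 := by
    intro c hc
    have hr : (1 / 2 : ℝ≥0∞) ≤ (FormalMultilinearSeries.ofScalars ℝ c).radius := by
      have hs := hc (1 / 2) (by norm_num)
      have := FormalMultilinearSeries.le_radius_of_summable_norm
        (p := FormalMultilinearSeries.ofScalars ℝ c) (r := 1 / 2) ?_
      · simpa using this
      · simpa [abs_mul, abs_pow] using hs.norm
    have := (FormalMultilinearSeries.ofScalars ℝ c).hasFPowerSeriesOnBall
      (lt_of_lt_of_le (by norm_num) hr)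
    refine (this.hasFPowerSeriesAt).congr ?_
    filter_upwards with s
    rw [FormalMultilinearSeries.sum]
    refine tsum_congr fun n => ?_
    simp [mul_comm]
  -- Equality on `(0, 1)` accumulates at `0` from the right, which is enough for the identity
  -- theorem for analytic functions.
  have hA := key a ha
  have hB := key b hb
  have hfreq : ∃ᶠ s in nhdsWithin (0 : ℝ) {0}ᶜ,
      (∑' n, a n * s ^ n) = ∑' n, b n * s ^ n := by
    have : ∃ᶠ s in nhdsWithin (0 : ℝ) (Ioi 0), (∑' n, a n * s ^ n) = ∑' n, b n * s ^ n := by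
      refine Filter.Eventually.frequently ?_
      filter_upwards [Ioo_mem_nhdsGT (zero_lt_one (α := ℝ))] with s hs
      exact h s hs
    exact this.filter_mono (nhdsWithin_mono _ fun s hs => (ne_of_gt hs : s ≠ 0))
  have hev := (AnalyticAt.frequently_eq_iff_eventually_eq hA.analyticAt hB.analyticAt).1 hfreq
  have heq := HasFPowerSeriesAt.eq_formalMultilinearSeries (hA.congr hev) hB
  exact FormalMultilinearSeries.ofScalars_series_injective ℝ ℝ heq

end PowerSeries

/-! ### The real generating function `ψ` and the logarithmic derivative of `ψ'`. -/

section Law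

open Filter Topology

variable (μ : Measure ℕ)

/-- The law of `Z_t` for the process started from one individual. -/
noncomputable def sizeProb (t : ℝ) (n : ℕ) : ℝ := (forestLaw μ 1).real {F | F.Z t = (n : ℕ∞)}

theorem ψ_eq (t : ℝ) : ψ μ t = fun s => ∑' n, sizeProb μ t n * s ^ n := rfl

theorem sizeProb_nonneg (t : ℝ) (n : ℕ) : 0 ≤ sizeProb μ t n := measureReal_nonneg

theorem ψ_nonneg (t : ℝ) {s : ℝ} (hs : 0 ≤ s) : 0 ≤ ψ μ t s :=
  tsum_nonneg fun n => mul_nonneg (sizeProb_nonneg μ t n) (by positivity)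

variable [IsFiniteMeasure μ] [NeZero μ]

theorem sizeProb_le_one (t : ℝ) (n : ℕ) : sizeProb μ t n ≤ 1 := measureReal_le_one

theorem abs_sizeProb_le_one (t : ℝ) (n : ℕ) : |sizeProb μ t n| ≤ 1 := by
  rw [abs_of_nonneg (sizeProb_nonneg μ t n)]
  exact sizeProb_le_one μ t n

theorem ofReal_sizeProb (t : ℝ) (n : ℕ) :
    ENNReal.ofReal (sizeProb μ t n) = forestLaw μ 1 {F | F.Z t = n} := ofReal_measureReal

theorem hasDerivAt_ψ (t : ℝ) {s : ℝ} (hs : |s| < 1) :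
    HasDerivAt (ψ μ t) (∑' n, sizeProb μ t n * (n * s ^ (n - 1))) s :=
  hasDerivAt_powerSeries (abs_sizeProb_le_one μ t) hs

theorem deriv_ψ (t : ℝ) {s : ℝ} (hs : |s| < 1) :
    deriv (ψ μ t) s = ∑' n, sizeProb μ t n * (n * s ^ (n - 1)) := (hasDerivAt_ψ μ t hs).deriv

theorem hasDerivAt_deriv_ψ (t : ℝ) {s : ℝ} (hs : |s| < 1) :
    HasDerivAt (deriv (ψ μ t)) (∑' n, sizeProb μ t n * (n * ((n : ℝ) - 1) * s ^ (n - 2))) s := by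
  refine (hasDerivAt_powerSeries_deriv (abs_sizeProb_le_one μ t) hs).congr_of_eventuallyEq ?_
  filter_upwards [(isOpen_Iio.preimage continuous_abs).mem_nhds hs] with u hu
  exact deriv_ψ μ t hu

theorem iteratedDeriv_ψ (t : ℝ) {s : ℝ} (hs : |s| < 1) :
    iteratedDeriv 2 (ψ μ t) s = ∑' n, sizeProb μ t n * (n * ((n : ℝ) - 1) * s ^ (n - 2)) := by
  rw [iteratedDeriv_succ, iteratedDeriv_one]
  exact (hasDerivAt_deriv_ψ μ t hs).deriv

theorem iteratedDeriv_ψ_nonneg (t : ℝ) {s : ℝ} (hs : s ∈ Ico (0 : ℝ) 1) :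
    0 ≤ iteratedDeriv 2 (ψ μ t) s := by
  rw [iteratedDeriv_ψ μ t (by rw [abs_of_nonneg hs.1]; exact hs.2)]
  exact tsum_nonneg fun n => mul_nonneg (sizeProb_nonneg μ t n)
    (mul_nonneg (natCast_mul_sub_one_nonneg n) (pow_nonneg hs.1 _))

theorem ofReal_ψ (t : ℝ) {s : ℝ} (hs : s ∈ Ico (0 : ℝ) 1) :
    ENNReal.ofReal (ψ μ t s) = gen μ t (ENNReal.ofReal s) := by
  rw [gen_eq_tsum, ψ_eq, ENNReal.ofReal_tsum_of_nonneg]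
  · refine tsum_congr fun n => ?_
    rw [ENNReal.ofReal_mul (sizeProb_nonneg μ t n), ofReal_sizeProb, ENNReal.ofReal_pow hs.1]
  · exact fun n => mul_nonneg (sizeProb_nonneg μ t n) (pow_nonneg hs.1 _)
  · exact summable_mul_of_abs_le_one (abs_sizeProb_le_one μ t) (fun n => pow_nonneg hs.1 _)
      (summable_geometric_of_lt_one hs.1 hs.2)

theorem ofReal_deriv_ψ (t : ℝ) {s : ℝ} (hs : s ∈ Ico (0 : ℝ) 1) :
    ENNReal.ofReal (deriv (ψ μ t) s) = gen' μ t (ENNReal.ofReal s) := by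
  rw [gen'_eq_tsum, deriv_ψ μ t (by rw [abs_of_nonneg hs.1]; exact hs.2),
    ENNReal.ofReal_tsum_of_nonneg]
  · refine tsum_congr fun n => ?_
    rw [ENNReal.ofReal_mul (sizeProb_nonneg μ t n), ofReal_sizeProb,
      ENNReal.ofReal_mul (Nat.cast_nonneg n), ENNReal.ofReal_pow hs.1, ENNReal.ofReal_natCast]
  · exact fun n => mul_nonneg (sizeProb_nonneg μ t n)
      (mul_nonneg (Nat.cast_nonneg n) (pow_nonneg hs.1 _))
  · exact summable_mul_of_abs_le_one (abs_sizeProb_le_one μ t)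
      (fun n => mul_nonneg (Nat.cast_nonneg n) (pow_nonneg hs.1 _))
      (summable_natCast_mul_pow hs.1 hs.2)

theorem ofReal_natCast_mul_sub_one (n : ℕ) :
    ENNReal.ofReal ((n : ℝ) * ((n : ℝ) - 1)) = (n : ℝ≥0∞) * ((n : ℝ≥0∞) - 1) := by
  rw [ENNReal.ofReal_mul (Nat.cast_nonneg n), ENNReal.ofReal_sub _ zero_le_one]
  simp

theorem ofReal_iteratedDeriv_ψ (t : ℝ) {s : ℝ} (hs : s ∈ Ico (0 : ℝ) 1) :
    ENNReal.ofReal (iteratedDeriv 2 (ψ μ t) s) = gen'' μ t (ENNReal.ofReal s) := by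
  rw [gen''_eq_tsum, iteratedDeriv_ψ μ t (by rw [abs_of_nonneg hs.1]; exact hs.2),
    ENNReal.ofReal_tsum_of_nonneg]
  · refine tsum_congr fun n => ?_
    rw [ENNReal.ofReal_mul (sizeProb_nonneg μ t n), ofReal_sizeProb,
      ENNReal.ofReal_mul (natCast_mul_sub_one_nonneg n), ENNReal.ofReal_pow hs.1,
      ofReal_natCast_mul_sub_one]
  · exact fun n => mul_nonneg (sizeProb_nonneg μ t n)
      (mul_nonneg (natCast_mul_sub_one_nonneg n) (pow_nonneg hs.1 _))
  · exact summable_mul_of_abs_le_one (abs_sizeProb_le_one μ t)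
      (fun n => mul_nonneg (natCast_mul_sub_one_nonneg n) (pow_nonneg hs.1 _))
      (summable_natCast_mul_sub_one_mul_pow hs.1 hs.2)

theorem exp_le_sizeProb_one {t : ℝ} (ht : 0 ≤ t) :
    Real.exp (-(μ.real univ * t)) ≤ sizeProb μ t 1 := by
  have := le_forestLaw_Z_eq μ ht 1
  rw [pow_one, ← ofReal_sizeProb] at this
  exact (ENNReal.ofReal_le_ofReal_iff (sizeProb_nonneg μ t 1)).1 this

theorem sizeProb_one_le_deriv_ψ (t : ℝ) {s : ℝ} (hs : s ∈ Ico (0 : ℝ) 1) :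
    sizeProb μ t 1 ≤ deriv (ψ μ t) s := by
  rw [deriv_ψ μ t (by rw [abs_of_nonneg hs.1]; exact hs.2)]
  have := (summable_mul_of_abs_le_one (abs_sizeProb_le_one μ t)
      (fun n => mul_nonneg (Nat.cast_nonneg n) (pow_nonneg hs.1 _))
      (summable_natCast_mul_pow hs.1 hs.2)).le_tsum 1 fun n _ => mul_nonneg (sizeProb_nonneg μ t n)
      (mul_nonneg (Nat.cast_nonneg n) (pow_nonneg hs.1 _))
  simpa using this

/-- The linear term of the series suffices: its coefficient is at least the probability that the
founder is still alive. -/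
theorem deriv_ψ_pos {t : ℝ} (ht : 0 ≤ t) {s : ℝ} (hs : s ∈ Ico (0 : ℝ) 1) :
    0 < deriv (ψ μ t) s :=
  (Real.exp_pos _).trans_le ((exp_le_sizeProb_one μ ht).trans (sizeProb_one_le_deriv_ψ μ t hs))

theorem ψ_le (t : ℝ) {s : ℝ} (hs : s ∈ Ico (0 : ℝ) 1) :
    ψ μ t s ≤ 1 - sizeProb μ t 1 * (1 - s) := by
  have h := gen_add_le μ (s := ENNReal.ofReal s) (ENNReal.ofReal_le_one.2 hs.2.le) t
  rw [← ofReal_ψ μ t hs, ← ofReal_sizeProb, ← ENNReal.ofReal_one, ← ENNReal.ofReal_sub _ hs.1,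
    ← ENNReal.ofReal_mul (sizeProb_nonneg μ t 1), ← ENNReal.ofReal_add (ψ_nonneg μ t hs.1)
    (mul_nonneg (sizeProb_nonneg μ t 1) (by linarith [hs.2])),
    ENNReal.ofReal_le_ofReal_iff zero_le_one] at h
  linarith

theorem ψ_le_exp {t : ℝ} (ht : 0 ≤ t) {s : ℝ} (hs : s ∈ Ico (0 : ℝ) 1) :
    ψ μ t s ≤ 1 - Real.exp (-(μ.real univ * t)) * (1 - s) := by
  have h1 := ψ_le μ t hs
  have h2 := mul_le_mul_of_nonneg_right (exp_le_sizeProb_one μ ht) (by linarith [hs.2] : 0 ≤ 1 - s)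
  linarith

theorem ψ_mem {t : ℝ} (ht : 0 ≤ t) {s : ℝ} (hs : s ∈ Ico (0 : ℝ) 1) :
    ψ μ t s ∈ Ico (0 : ℝ) 1 := by
  refine ⟨ψ_nonneg μ t hs.1, ?_⟩
  have := ψ_le_exp μ ht hs
  have h2 := mul_pos (Real.exp_pos (-(μ.real univ * t))) (by linarith [hs.2] : 0 < 1 - s)
  linarith

theorem deriv_ψ_add {r q : ℝ} (hr : 0 ≤ r) (hq : 0 ≤ q) {s : ℝ} (hs : s ∈ Ico (0 : ℝ) 1) :
    deriv (ψ μ (r + q)) s = deriv (ψ μ r) (ψ μ q s) * deriv (ψ μ q) s := by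
  have h1 := deriv_ψ_pos μ hr (ψ_mem μ hq hs)
  have h2 := deriv_ψ_pos μ hq hs
  rw [← ENNReal.ofReal_eq_ofReal_iff (deriv_ψ_pos μ (add_nonneg hr hq) hs).le (mul_pos h1 h2).le,
    ENNReal.ofReal_mul h1.le, ofReal_deriv_ψ μ _ hs, ofReal_deriv_ψ μ _ (ψ_mem μ hq hs),
    ofReal_deriv_ψ μ _ hs, ofReal_ψ μ _ hs, gen'_add μ hr hq]

/-- The derivative of the logarithm of the derivative of the generating function. -/
noncomputable def logDerivRatio (t s : ℝ) : ℝ := iteratedDeriv 2 (ψ μ t) s / deriv (ψ μ t) s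

theorem logDerivRatio_nonneg {t : ℝ} (ht : 0 ≤ t) {s : ℝ} (hs : s ∈ Ico (0 : ℝ) 1) :
    0 ≤ logDerivRatio μ t s :=
  div_nonneg (iteratedDeriv_ψ_nonneg μ t hs) (deriv_ψ_pos μ ht hs).le

/-- Logarithmic differentiation of the chain rule `deriv_ψ_add`. The point `s` is interior because
that rule must hold in a neighbourhood of `s`. -/
theorem logDerivRatio_add {r q : ℝ} (hr : 0 ≤ r) (hq : 0 ≤ q) {s : ℝ} (hs : s ∈ Ioo (0 : ℝ) 1) :
    logDerivRatio μ (r + q) s =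
      logDerivRatio μ r (ψ μ q s) * deriv (ψ μ q) s + logDerivRatio μ q s := by
  have habs : ∀ u ∈ Ico (0 : ℝ) 1, |u| < 1 := fun u hu => by rw [abs_of_nonneg hu.1]; exact hu.2
  have hs' := Ioo_subset_Ico_self hs
  have hψ := ψ_mem μ hq hs'
  have hd : ∀ t, ∀ u ∈ Ico (0 : ℝ) 1,
      HasDerivAt (deriv (ψ μ t)) (iteratedDeriv 2 (ψ μ t) u) u := by
    intro t u hu
    rw [iteratedDeriv_ψ μ t (habs u hu)]
    exact hasDerivAt_deriv_ψ μ t (habs u hu)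
  have h1 : HasDerivAt (ψ μ q) (deriv (ψ μ q) s) s := by
    rw [deriv_ψ μ q (habs s hs')]
    exact hasDerivAt_ψ μ q (habs s hs')
  have h2 := ((hd r _ hψ).comp s h1).mul (hd q s hs')
  have h3 : deriv (ψ μ (r + q)) =ᶠ[𝓝 s] (deriv (ψ μ r) ∘ ψ μ q) * deriv (ψ μ q) := by
    filter_upwards [Ioo_mem_nhds hs.1 hs.2] with u hu
    exact deriv_ψ_add μ hr hq (Ioo_subset_Ico_self hu)
  have h4 := (hd (r + q) s hs').unique (h2.congr_of_eventuallyEq h3)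
  have p1 := (deriv_ψ_pos μ hr hψ).ne'
  have p2 := (deriv_ψ_pos μ hq hs').ne'
  simp only [logDerivRatio]
  rw [h4, deriv_ψ_add μ hr hq hs']
  simp only [Function.comp_apply]
  field_simp

end Law

/-! ### Behaviour at small times -/

theorem Tree.Pos.alive_of_children {τ : Tree} (h : τ.Pos) {a : ℝ} (hl : (τ []).1 ≤ a)
    (hc : ∀ j < (τ []).2, a < (τ [j]).1) :
    τ.alive a = (Finset.range (τ []).2).image fun j => [j] := by
  ext v
  cases v with
  | nil => simp [Tree.nil_mem_alive, hl]
  | cons j v =>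
    rw [Tree.cons_mem_alive]
    by_cases hj : j < (τ []).2
    · have hch : a - (τ []).1 < (τ.child j []).1 := by
        have := hc j hj
        have h0 := h []
        simp only [Tree.child]
        linarith
      rw [(h.child j).alive_eq_singleton (by linarith) hch]
      simp [hj, eq_comm]
    · simp [hj]

theorem Forest.Pos.Z_of_children {F : Forest 1} (h : F.Pos) {a : ℝ} (hl : (F 0 []).1 ≤ a)
    (hc : ∀ j < (F 0 []).2, a < (F 0 [j]).1) : F.Z a = (F 0 []).2 := by
  have : F.alive a = (Finset.range (F 0 []).2).image fun j => ((0 : Fin 1), [j]) := by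
    ext ⟨i, v⟩
    obtain rfl := Subsingleton.elim 0 i
    rw [Forest.mem_alive, (h 0).alive_of_children hl hc]
    simp
  rw [Forest.Z, this, encard_coe_eq_coe_finsetCard, Finset.card_image_of_injective,
    Finset.card_range]
  intro i j hij
  simpa using hij

section Law

open Filter Topology

variable (μ : Measure ℕ)

/-- The probability of `k` children. -/
noncomputable def childProb (k : ℕ) : ℝ := μ.real {k} / μ.real univ

theorem childProb_nonneg (k : ℕ) : 0 ≤ childProb μ k :=
  div_nonneg measureReal_nonneg measureReal_nonneg

/-- The second derivative of the generating function of `μ`. -/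
noncomputable def rateGen'' (u : ℝ) : ℝ := ∑' n : ℕ, μ.real {n} * (n * ((n : ℝ) - 1) * u ^ (n - 2))

theorem rateGen''_nonneg {u : ℝ} (hu : 0 ≤ u) : 0 ≤ rateGen'' μ u :=
  tsum_nonneg fun n => mul_nonneg measureReal_nonneg
    (mul_nonneg (natCast_mul_sub_one_nonneg n) (pow_nonneg hu _))

theorem tendsto_exp_zero :
    Tendsto (fun a : ℝ => Real.exp (-(μ.real univ * a))) (𝓝[>] 0) (𝓝 1) := by
  have : Continuous fun a : ℝ => Real.exp (-(μ.real univ * a)) := by fun_prop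
  have := (this.tendsto 0).mono_left (nhdsWithin_le_nhds (s := Ioi 0))
  simpa using this

theorem tendsto_one_sub_exp_div :
    Tendsto (fun a : ℝ => (1 - Real.exp (-(μ.real univ * a))) / a) (𝓝[>] 0)
      (𝓝 (μ.real univ)) := by
  have h : HasDerivAt (fun a : ℝ => 1 - Real.exp (-(μ.real univ * a))) (μ.real univ) 0 := by
    have := ((((hasDerivAt_id (0 : ℝ)).const_mul (μ.real univ)).neg).exp).const_sub 1
    simpa using this
  have := h.hasDerivWithinAt (s := Ioi 0)
  rw [hasDerivWithinAt_iff_tendsto_slope' (by simp)] at this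
  refine this.congr fun a => ?_
  simp [slope_def_field]

variable [IsFiniteMeasure μ] [NeZero μ]

theorem ofReal_childProb (k : ℕ) : ENNReal.ofReal (childProb μ k) = (μ univ)⁻¹ * μ {k} := by
  rw [childProb, ENNReal.ofReal_div_of_pos (real_univ_pos μ), ofReal_measureReal,
    ofReal_measureReal, div_eq_mul_inv, mul_comm]

theorem hasSum_childProb : HasSum (childProb μ) 1 := by
  have h : ∑' k, ENNReal.ofReal (childProb μ k) = 1 := by
    simp_rw [ofReal_childProb]
    rw [ENNReal.tsum_mul_left]
    have : ∑' k, μ {k} = μ univ := by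
      simpa using (lintegral_countable' (μ := μ) (fun _ : ℕ => (1 : ℝ≥0∞))).symm
    rw [this, ENNReal.inv_mul_cancel (by simpa using NeZero.ne μ) (measure_ne_top μ _)]
  have hs : Summable (childProb μ) := by
    have := ENNReal.summable_toReal (f := fun k => ENNReal.ofReal (childProb μ k)) (by simp [h])
    simpa [ENNReal.toReal_ofReal (childProb_nonneg μ _)] using this
  have h2 := ENNReal.ofReal_tsum_of_nonneg (childProb_nonneg μ) hs
  rw [h] at h2
  have : ∑' k, childProb μ k = 1 := by
    rw [← ENNReal.toReal_ofReal (tsum_nonneg (childProb_nonneg μ)), h2, ENNReal.toReal_one]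
  rw [← this]
  exact hs.hasSum

theorem expMeasure_Iic {a : ℝ} (ha : 0 ≤ a) :
    expMeasure (μ.real univ) (Iic a) = ENNReal.ofReal (1 - Real.exp (-(μ.real univ * a))) := by
  rw [← compl_Ioi, prob_compl_eq_one_sub measurableSet_Ioi, expMeasure_Ioi (real_univ_pos μ) ha,
    ENNReal.ofReal_sub _ (Real.exp_pos _).le, ENNReal.ofReal_one]

/-- The founder dies before time `a`, its number of children lies in `K`, and all its children
live longer than `r`. -/
def earlySplit (a r : ℝ) (K : Set ℕ) : Set Tree :=
  {τ | (τ []).1 ≤ a ∧ (τ []).2 ∈ K ∧ ∀ j < (τ []).2, r < (τ [j]).1}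

theorem measurableSet_earlySplit (a r : ℝ) (K : Set ℕ) : MeasurableSet (earlySplit a r K) := by
  have h1 : Measurable fun τ : Tree => (τ []).1 := by fun_prop
  have h2 : Measurable fun τ : Tree => (τ []).2 := by fun_prop
  refine (measurableSet_le h1 measurable_const).inter
    ((h2 (MeasurableSet.of_discrete (s := K))).inter ?_)
  have : {τ : Tree | ∀ j < (τ []).2, r < (τ [j]).1} =
      ⋂ j, ({τ | j < (τ []).2}ᶜ ∪ {τ | r < (τ [j]).1}) := by
    ext τ
    simp only [mem_ofPred_eq, mem_iInter, mem_union, mem_compl_iff]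
    exact forall_congr' fun j => imp_iff_not_or
  change MeasurableSet {τ : Tree | ∀ j < (τ []).2, r < (τ [j]).1}
  rw [this]
  refine MeasurableSet.iInter fun j => ((measurableSet_lt measurable_const h2).compl).union ?_
  have h3 : Measurable fun τ : Tree => (τ [j]).1 := by fun_prop
  exact measurableSet_lt measurable_const h3

/-- The lifetime of the root, its number of children and the children's lifetimes are independent;
`k` children all outlive `r` with probability `exp(-μ(ℕ) r) ^ k`. -/
theorem treeLaw_earlySplit {a r : ℝ} (ha : 0 ≤ a) (hr : 0 ≤ r) (K : Set ℕ) :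
    treeLaw μ (earlySplit a r K) = ENNReal.ofReal (1 - Real.exp (-(μ.real univ * a))) *
      ∑' k, K.indicator (fun k => ENNReal.ofReal (childProb μ k) *
        ENNReal.ofReal (Real.exp (-(μ.real univ * r))) ^ k) k := by
  rw [← lintegral_indicator_one (measurableSet_earlySplit a r K),
    lintegral_treeLaw μ (measurable_one.indicator (measurableSet_earlySplit a r K))
    (fun k l => {F : Forest k | l ≤ a ∧ k ∈ K ∧ ∀ i, r < (F i []).1}.indicator 1)]
  · have hinner : ∀ p : ℝ × ℕ, ∫⁻ F, {F : Forest p.2 | p.1 ≤ a ∧ p.2 ∈ K ∧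
        ∀ i, r < (F i []).1}.indicator 1 F ∂forestLaw μ p.2 =
        (Iic a).indicator 1 p.1 * K.indicator (fun k =>
          ENNReal.ofReal (Real.exp (-(μ.real univ * r))) ^ k) p.2 := by
      intro p
      by_cases h1 : p.1 ≤ a
      · by_cases h2 : p.2 ∈ K
        · rw [indicator_of_mem (mem_Iic.2 h1), indicator_of_mem h2, ← forestLaw_lifetimes μ hr]
          simp only [h1, h2, true_and, Pi.one_apply, one_mul]
          refine lintegral_indicator_one ?_
          rw [ofPred_forall]
          exact MeasurableSet.iInter fun i => measurableSet_lifetime i r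
        · rw [indicator_of_notMem h2]
          simp [h2]
      · rw [indicator_of_notMem (fun h => h1 (mem_Iic.1 h))]
        simp [h1]
    rw [lintegral_congr hinner, lintegral_individualLaw, ← expMeasure_Iic μ ha,
      ← ENNReal.tsum_mul_left]
    · refine tsum_congr fun k => ?_
      change _ * ∫⁻ l, (Iic a).indicator 1 l * K.indicator (fun k =>
          ENNReal.ofReal (Real.exp (-(μ.real univ * r))) ^ k) k ∂_ = _
      rw [lintegral_mul_const _ (measurable_one.indicator measurableSet_Iic),
        lintegral_indicator_one measurableSet_Iic, ← ofReal_childProb]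
      by_cases h : k ∈ K
      · rw [indicator_of_mem h, indicator_of_mem h]
        ring
      · rw [indicator_of_notMem h, indicator_of_notMem h]
        simp
    · exact ((measurable_one.indicator measurableSet_Iic).comp measurable_fst).mul
        ((measurable_of_countable (K.indicator fun k =>
          ENNReal.ofReal (Real.exp (-(μ.real univ * r))) ^ k)).comp measurable_snd)
  · intro k l
    refine measurable_one.indicator
        ((MeasurableSet.const _).inter ((MeasurableSet.const _).inter ?_))
    change MeasurableSet {F : Forest k | ∀ i, r < (F i []).1}
    rw [ofPred_forall]
    exact MeasurableSet.iInter fun i => measurableSet_lifetime i r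
  · refine Eventually.of_forall fun τ => ?_
    have : τ ∈ earlySplit a r K ↔ (fun j : Fin (τ []).2 => τ.child j) ∈
        {F : Forest (τ []).2 | (τ []).1 ≤ a ∧ (τ []).2 ∈ K ∧ ∀ i, r < (F i []).1} := by
      simp [earlySplit, Tree.child, Fin.forall_iff]
    by_cases h : τ ∈ earlySplit a r K
    · rw [indicator_of_mem h, indicator_of_mem (this.1 h)]
      rfl
    · rw [indicator_of_notMem h, indicator_of_notMem (mt this.2 h)]

theorem summable_childProb_mul_pow {c : ℝ} (h0 : 0 ≤ c) (h1 : c ≤ 1) :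
    Summable fun k => childProb μ k * c ^ k :=
  (hasSum_childProb μ).summable.of_nonneg_of_le
    (fun k => mul_nonneg (childProb_nonneg μ k) (pow_nonneg h0 k))
    fun k => mul_le_of_le_one_right (childProb_nonneg μ k) (pow_le_one₀ h0 h1)

theorem exp_neg_le_one {a : ℝ} (ha : 0 ≤ a) : Real.exp (-(μ.real univ * a)) ≤ 1 :=
  Real.exp_le_one_iff.2 (by have := mul_nonneg (real_univ_pos μ).le ha; linarith)

theorem treeLaw_real_earlySplit_singleton {a r : ℝ} (ha : 0 ≤ a) (hr : 0 ≤ r) (n : ℕ) :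
    (treeLaw μ).real (earlySplit a r {n}) = (1 - Real.exp (-(μ.real univ * a))) *
      (childProb μ n * Real.exp (-(μ.real univ * r)) ^ n) := by
  have h1 := exp_neg_le_one μ ha
  rw [Measure.real, treeLaw_earlySplit μ ha hr, tsum_eq_single n]
  · rw [indicator_of_mem (mem_singleton n), ENNReal.toReal_mul, ENNReal.toReal_mul,
      ENNReal.toReal_pow, ENNReal.toReal_ofReal (by linarith),
      ENNReal.toReal_ofReal (childProb_nonneg μ n), ENNReal.toReal_ofReal (Real.exp_pos _).le]
  · intro k hk
    rw [indicator_of_notMem (by simpa using hk)]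

theorem treeLaw_real_earlySplit_univ {a r : ℝ} (ha : 0 ≤ a) (hr : 0 ≤ r) :
    (treeLaw μ).real (earlySplit a r univ) = (1 - Real.exp (-(μ.real univ * a))) *
      ∑' k, childProb μ k * Real.exp (-(μ.real univ * r)) ^ k := by
  have h1 := exp_neg_le_one μ ha
  have hnn : ∀ k, 0 ≤ childProb μ k * Real.exp (-(μ.real univ * r)) ^ k := fun k =>
    mul_nonneg (childProb_nonneg μ k) (pow_nonneg (Real.exp_pos _).le k)
  have : ∑' k, (univ : Set ℕ).indicator (fun k => ENNReal.ofReal (childProb μ k) *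
        ENNReal.ofReal (Real.exp (-(μ.real univ * r))) ^ k) k =
      ENNReal.ofReal (∑' k, childProb μ k * Real.exp (-(μ.real univ * r)) ^ k) := by
    rw [ENNReal.ofReal_tsum_of_nonneg hnn
      (summable_childProb_mul_pow μ (Real.exp_pos _).le (exp_neg_le_one μ hr))]
    refine tsum_congr fun k => ?_
    rw [indicator_univ, ENNReal.ofReal_mul (childProb_nonneg μ k),
      ENNReal.ofReal_pow (Real.exp_pos _).le]
  rw [Measure.real, treeLaw_earlySplit μ ha hr, this, ENNReal.toReal_mul,
    ENNReal.toReal_ofReal (by linarith), ENNReal.toReal_ofReal (tsum_nonneg hnn)]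

theorem forestLaw_one_preimage {A : Set Tree} (hA : MeasurableSet A) :
    (forestLaw μ 1).real {F | F 0 ∈ A} = (treeLaw μ).real A := by
  rw [Measure.real, Measure.real]
  exact congrArg _ ((measurePreserving_eval (fun _ : Fin 1 => treeLaw μ) 0).measure_preimage
    hA.nullMeasurableSet)

theorem measureReal_mono_ae {α : Type*} [MeasurableSpace α] {ν : Measure α} [IsFiniteMeasure ν]
    {A B : Set α} (h : ∀ᵐ a ∂ν, a ∈ A → a ∈ B) : ν.real A ≤ ν.real B :=
  ENNReal.toReal_mono (measure_ne_top ν B) (measure_mono_ae h)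

/-- It suffices that the founder splits into `n` by time `a` and that every child has a lifetime
exceeding `a`, which is more than survival up to time `a` requires. -/
theorem le_sizeProb {a : ℝ} (ha : 0 ≤ a) (n : ℕ) :
    (1 - Real.exp (-(μ.real univ * a))) * (childProb μ n * Real.exp (-(μ.real univ * a)) ^ n) ≤
      sizeProb μ a n := by
  rw [← treeLaw_real_earlySplit_singleton μ ha ha, ← forestLaw_one_preimage μ
    (measurableSet_earlySplit _ _ _)]
  refine measureReal_mono_ae ?_
  filter_upwards [ae_pos_forestLaw μ 1] with F hF hE
  have h2 : (F 0 []).2 = n := hE.2.1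
  have := hF.Z_of_children hE.1 hE.2.2
  rwa [h2] at this

/-- A size other than `1` forces the founder to have died by time `a`. Then either all children
outlive `a` and there are exactly `n` of them, or some child has a lifetime of at most `a`. The
latter has probability `o(a)`. -/
theorem sizeProb_le {a : ℝ} (ha : 0 ≤ a) {n : ℕ} (hn : n ≠ 1) :
    sizeProb μ a n ≤ (1 - Real.exp (-(μ.real univ * a))) *
      (childProb μ n + (1 - ∑' k, childProb μ k * Real.exp (-(μ.real univ * a)) ^ k)) := by
  have hA := treeLaw_real_earlySplit_singleton μ ha le_rfl n
  have hB := treeLaw_real_earlySplit_univ μ ha (le_refl 0)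
  have hC := treeLaw_real_earlySplit_univ μ ha ha
  simp only [mul_zero, neg_zero, Real.exp_zero, one_pow, mul_one, (hasSum_childProb μ).tsum_eq]
    at hA hB
  have hsub : sizeProb μ a n ≤ (treeLaw μ).real
      (earlySplit a 0 {n} ∪ (earlySplit a 0 univ \ earlySplit a a univ)) := by
    rw [← forestLaw_one_preimage μ ((measurableSet_earlySplit _ _ _).union
      ((measurableSet_earlySplit _ _ _).diff (measurableSet_earlySplit _ _ _)))]
    refine measureReal_mono_ae ?_
    filter_upwards [ae_pos_forestLaw μ 1] with F hF (hZ : F.Z a = n)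
    have hl : (F 0 []).1 ≤ a := by
      by_contra hl
      have h1 := hF.Z_of_lifetimes ha fun i => by
        rw [Subsingleton.elim i 0]; exact not_le.1 hl
      rw [hZ] at h1
      exact hn (by exact_mod_cast h1)
    have hpos : ∀ j < (F 0 []).2, 0 < (F 0 [j]).1 := fun j _ => hF 0 [j]
    by_cases hc : ∀ j < (F 0 []).2, a < (F 0 [j]).1
    · left
      have h1 := hF.Z_of_children hl hc
      rw [hZ] at h1
      exact ⟨hl, (by exact_mod_cast h1.symm : (F 0 []).2 = n), hpos⟩
    · exact Or.inr ⟨⟨hl, mem_univ _, hpos⟩, fun h => hc h.2.2⟩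
  have hincl : earlySplit a a univ ⊆ earlySplit a 0 univ := fun τ hτ =>
    ⟨hτ.1, hτ.2.1, fun j hj => ha.trans_lt (hτ.2.2 j hj)⟩
  have hdiff := measureReal_sdiff (μ := treeLaw μ) hincl (measurableSet_earlySplit a a univ)
  have hun := measureReal_union_le (μ := treeLaw μ) (earlySplit a 0 {n})
    (earlySplit a 0 univ \ earlySplit a a univ)
  rw [hdiff, hA, hB, hC] at hun
  linarith

theorem sizeProb_add_le {a : ℝ} {n : ℕ} (hn : n ≠ 1) : sizeProb μ a n + sizeProb μ a 1 ≤ 1 := by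
  rw [sizeProb, sizeProb, ← measureReal_union _ (Forest.measurableSet_Z_eq a _)]
  · exact measureReal_le_one
  · refine disjoint_left.2 fun F h1 h2 => hn ?_
    exact_mod_cast (show F.Z a = (n : ℕ∞) from h1).symm.trans h2

/-- A bound uniform in `n`: a size other than `1` has probability at most `1 - exp(-μ(ℕ) a)`. It
provides the domination in the termwise limits. -/
theorem sizeProb_le_mul {a : ℝ} (ha : 0 ≤ a) {n : ℕ} (hn : n ≠ 1) :
    sizeProb μ a n ≤ μ.real univ * a := by
  have h1 := sizeProb_add_le μ (a := a) hn
  have h2 := exp_le_sizeProb_one μ ha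
  have h3 := Real.add_one_le_exp (-(μ.real univ * a))
  linarith

theorem tendsto_childProb_sum :
    Tendsto (fun a : ℝ => ∑' k, childProb μ k * Real.exp (-(μ.real univ * a)) ^ k) (𝓝[>] 0)
      (𝓝 1) := by
  rw [← (hasSum_childProb μ).tsum_eq]
  refine tendsto_tsum_of_dominated_convergence (hasSum_childProb μ).summable (fun k => ?_) ?_
  · simpa using ((tendsto_exp_zero μ).pow k).const_mul (childProb μ k)
  · filter_upwards [self_mem_nhdsWithin] with a ha k
    have ha' : 0 ≤ a := (mem_Ioi.1 ha).le
    rw [Real.norm_of_nonneg (mul_nonneg (childProb_nonneg μ k) (pow_nonneg (Real.exp_pos _).le k))]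
    exact mul_le_of_le_one_right (childProb_nonneg μ k)
      (pow_le_one₀ (Real.exp_pos _).le (exp_neg_le_one μ ha'))

theorem mul_childProb (n : ℕ) : μ.real univ * childProb μ n = μ.real {n} := by
  rw [childProb, mul_div_cancel₀ _ (real_univ_pos μ).ne']

/-- The transition rate from `1` to `n ≠ 1` individuals is `μ n`. -/
theorem tendsto_sizeProb_div {n : ℕ} (hn : n ≠ 1) :
    Tendsto (fun a => sizeProb μ a n / a) (𝓝[>] 0) (𝓝 (μ.real {n})) := by
  have hlow : Tendsto (fun a : ℝ => (1 - Real.exp (-(μ.real univ * a))) / a *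
      (childProb μ n * Real.exp (-(μ.real univ * a)) ^ n)) (𝓝[>] 0) (𝓝 (μ.real {n})) := by
    have := (tendsto_one_sub_exp_div μ).mul (((tendsto_exp_zero μ).pow n).const_mul (childProb μ n))
    rwa [one_pow, mul_one, mul_childProb] at this
  have hup : Tendsto (fun a : ℝ => (1 - Real.exp (-(μ.real univ * a))) / a *
      (childProb μ n + (1 - ∑' k, childProb μ k * Real.exp (-(μ.real univ * a)) ^ k)))
      (𝓝[>] 0) (𝓝 (μ.real {n})) := by
    have := (tendsto_one_sub_exp_div μ).mul
      (((tendsto_childProb_sum μ).const_sub 1).const_add (childProb μ n))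
    rwa [sub_self, add_zero, mul_childProb] at this
  refine tendsto_of_tendsto_of_tendsto_of_le_of_le' hlow hup ?_ ?_
  · filter_upwards [self_mem_nhdsWithin] with a ha
    have ha' : 0 < a := ha
    rw [div_mul_eq_mul_div]
    exact div_le_div_of_nonneg_right (le_sizeProb μ ha'.le n) ha'.le
  · filter_upwards [self_mem_nhdsWithin] with a ha
    have ha' : 0 < a := ha
    rw [div_mul_eq_mul_div]
    exact div_le_div_of_nonneg_right (sizeProb_le μ ha'.le hn) ha'.le

theorem tendsto_sizeProb_one : Tendsto (fun a => sizeProb μ a 1) (𝓝[>] 0) (𝓝 1) := by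
  refine tendsto_of_tendsto_of_tendsto_of_le_of_le' (tendsto_exp_zero μ) tendsto_const_nhds ?_ ?_
  · filter_upwards [self_mem_nhdsWithin] with a ha
    exact exp_le_sizeProb_one μ (mem_Ioi.1 ha).le
  · exact Eventually.of_forall fun a => sizeProb_le_one μ a 1

theorem tendsto_deriv_ψ {u : ℝ} (hu : u ∈ Ico (0 : ℝ) 1) :
    Tendsto (fun a => deriv (ψ μ a) u) (𝓝[>] 0) (𝓝 1) := by
  have habs : |u| < 1 := by rw [abs_of_nonneg hu.1]; exact hu.2
  simp_rw [fun a => deriv_ψ μ a habs]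
  have h1 : (1 : ℝ) = ∑' n : ℕ, (if n = 1 then 1 else 0) * ((n : ℝ) * u ^ (n - 1)) := by
    rw [tsum_eq_single 1 fun n hn => by simp [hn]]
    simp
  rw [h1]
  refine tendsto_tsum_of_dominated_convergence (summable_natCast_mul_pow hu.1 hu.2) (fun n => ?_) ?_
  · refine Tendsto.mul_const _ ?_
    by_cases hn : n = 1
    · subst hn
      simpa using tendsto_sizeProb_one μ
    · simp only [hn, if_false]
      refine tendsto_of_tendsto_of_tendsto_of_le_of_le' tendsto_const_nhds
        (g := fun _ => 0) (h := fun a => 1 - sizeProb μ a 1) ?_ ?_ ?_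
      · simpa using (tendsto_sizeProb_one μ).const_sub 1
      · exact Eventually.of_forall fun a => sizeProb_nonneg μ a n
      · exact Eventually.of_forall fun a => by linarith [sizeProb_add_le μ (a := a) hn]
  · refine Eventually.of_forall fun a n => ?_
    have hnn : 0 ≤ (n : ℝ) * u ^ (n - 1) := mul_nonneg (Nat.cast_nonneg n) (pow_nonneg hu.1 _)
    rw [Real.norm_of_nonneg (mul_nonneg (sizeProb_nonneg μ a n) hnn)]
    exact mul_le_of_le_one_left hnn (sizeProb_le_one μ a n)

/-- The probability of size `1` is not of order `a`, but its term carries the factor `n (n - 1) =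
0`. -/
theorem iteratedDeriv_ψ_term_le {a u : ℝ} (ha : 0 ≤ a) (hu : 0 ≤ u) (n : ℕ) :
    sizeProb μ a n * (n * ((n : ℝ) - 1) * u ^ (n - 2)) ≤
      μ.real univ * a * (n * ((n : ℝ) - 1) * u ^ (n - 2)) := by
  rcases eq_or_ne n 1 with rfl | hn
  · simp
  · exact mul_le_mul_of_nonneg_right (sizeProb_le_mul μ ha hn)
      (mul_nonneg (natCast_mul_sub_one_nonneg n) (pow_nonneg hu _))

theorem tendsto_iteratedDeriv_ψ_div {u : ℝ} (hu : u ∈ Ico (0 : ℝ) 1) :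
    Tendsto (fun a => iteratedDeriv 2 (ψ μ a) u / a) (𝓝[>] 0) (𝓝 (rateGen'' μ u)) := by
  have habs : |u| < 1 := by rw [abs_of_nonneg hu.1]; exact hu.2
  have hnn : ∀ n : ℕ, 0 ≤ (n : ℝ) * ((n : ℝ) - 1) * u ^ (n - 2) := fun n =>
    mul_nonneg (natCast_mul_sub_one_nonneg n) (pow_nonneg hu.1 _)
  simp_rw [fun a => iteratedDeriv_ψ μ a habs, ← tsum_div_const]
  refine tendsto_tsum_of_dominated_convergence
    ((summable_natCast_mul_sub_one_mul_pow hu.1 hu.2).mul_left (μ.real univ)) (fun n => ?_) ?_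
  · rcases eq_or_ne n 1 with rfl | hn
    · simp
    · simp_rw [mul_div_right_comm]
      exact (tendsto_sizeProb_div μ hn).mul_const _
  · filter_upwards [self_mem_nhdsWithin] with a ha n
    have ha' : 0 < a := ha
    rw [Real.norm_of_nonneg (div_nonneg (mul_nonneg (sizeProb_nonneg μ a n) (hnn n)) ha'.le),
      div_le_iff₀ ha']
    refine (iteratedDeriv_ψ_term_le μ ha'.le hu.1 n).trans (le_of_eq (by ring))

theorem tendsto_logDerivRatio_div {u : ℝ} (hu : u ∈ Ico (0 : ℝ) 1) :
    Tendsto (fun a => logDerivRatio μ a u / a) (𝓝[>] 0) (𝓝 (rateGen'' μ u)) := by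
  have := (tendsto_iteratedDeriv_ψ_div μ hu).div (tendsto_deriv_ψ μ hu) one_ne_zero
  rw [div_one] at this
  refine this.congr fun a => ?_
  simp only [logDerivRatio, Pi.div_apply]
  rw [div_right_comm]

theorem iteratedDeriv_ψ_le {a u κ : ℝ} (ha : 0 ≤ a) (hu : 0 ≤ u) (huκ : u ≤ κ) (hκ : κ < 1) :
    iteratedDeriv 2 (ψ μ a) u ≤
      μ.real univ * a * ∑' n : ℕ, (n : ℝ) * ((n : ℝ) - 1) * κ ^ (n - 2) := by
  have hκ0 := hu.trans huκ
  rw [iteratedDeriv_ψ μ a (by rw [abs_of_nonneg hu]; exact huκ.trans_lt hκ), ← tsum_mul_left]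
  have hnn : ∀ n : ℕ, 0 ≤ (n : ℝ) * ((n : ℝ) - 1) * u ^ (n - 2) := fun n =>
    mul_nonneg (natCast_mul_sub_one_nonneg n) (pow_nonneg hu _)
  refine Summable.tsum_le_tsum (fun n => (iteratedDeriv_ψ_term_le μ ha hu n).trans ?_)
    (summable_mul_of_abs_le_one (abs_sizeProb_le_one μ a) hnn
      (summable_natCast_mul_sub_one_mul_pow hu (huκ.trans_lt hκ)))
    ((summable_natCast_mul_sub_one_mul_pow hκ0 hκ).mul_left _)
  have := natCast_mul_sub_one_nonneg n
  have := real_univ_pos μ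
  gcongr

theorem deriv_ψ_le (t : ℝ) {s : ℝ} (hs : s ∈ Ico (0 : ℝ) 1) :
    deriv (ψ μ t) s ≤ ∑' n : ℕ, (n : ℝ) * s ^ (n - 1) := by
  rw [deriv_ψ μ t (by rw [abs_of_nonneg hs.1]; exact hs.2)]
  have hnn : ∀ n : ℕ, 0 ≤ (n : ℝ) * s ^ (n - 1) := fun n =>
    mul_nonneg (Nat.cast_nonneg n) (pow_nonneg hs.1 _)
  exact Summable.tsum_le_tsum (fun n => mul_le_of_le_one_left (hnn n) (sizeProb_le_one μ t n))
    (summable_mul_of_abs_le_one (abs_sizeProb_le_one μ t) hnn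
      (summable_natCast_mul_pow hs.1 hs.2)) (summable_natCast_mul_pow hs.1 hs.2)

theorem logDerivRatio_zero {s : ℝ} (hs : s ∈ Ico (0 : ℝ) 1) : logDerivRatio μ 0 s = 0 := by
  have h := iteratedDeriv_ψ_le μ (a := 0) le_rfl hs.1 le_rfl hs.2
  rw [mul_zero, zero_mul] at h
  rw [logDerivRatio, le_antisymm h (iteratedDeriv_ψ_nonneg μ 0 hs), zero_div]

/-- By the cocycle identity an increment over a time step `r` is `L_r` at the point `ψ_q(s)`, times
`ψ_q'(s)`, which is at most a constant times `r`. The function is thus Lipschitz in time. -/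
theorem continuousOn_logDerivRatio (T : ℝ) {s : ℝ} (hs : s ∈ Ioo (0 : ℝ) 1) :
    ContinuousOn (fun r => logDerivRatio μ r s) (Icc 0 T) := by
  have hs' := Ioo_subset_Ico_self hs
  -- By `ψ_le_exp`, `κ` bounds `ψ_q(s)` away from `1` for all times `q` in `[0, T]`.
  set κ := 1 - Real.exp (-(μ.real univ * T)) * (1 - s) with hκ
  have hκ1 : κ < 1 := by
    have := mul_pos (Real.exp_pos (-(μ.real univ * T))) (by linarith [hs.2] : 0 < 1 - s)
    linarith
  -- An upper bound of `ψ_r''` on `[0, κ]` per unit of time, over a lower bound of `ψ_r'`, times an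
  -- upper bound of `ψ_q'(s)`.
  set C : ℝ := μ.real univ * (∑' n : ℕ, (n : ℝ) * ((n : ℝ) - 1) * κ ^ (n - 2)) /
    Real.exp (-(μ.real univ * T)) * ∑' n : ℕ, (n : ℝ) * s ^ (n - 1) with hC
  have hinc : ∀ r q, 0 ≤ r → 0 ≤ q → r + q ≤ T →
      |logDerivRatio μ (r + q) s - logDerivRatio μ q s| ≤ C * r := by
    intro r q hr hq hT
    have hψ := ψ_mem μ hq hs'
    have hexp : ∀ v ≤ T, Real.exp (-(μ.real univ * T)) ≤ Real.exp (-(μ.real univ * v)) := by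
      intro v hv
      exact Real.exp_le_exp.2 (neg_le_neg (mul_le_mul_of_nonneg_left hv (real_univ_pos μ).le))
    have hψκ : ψ μ q s ≤ κ := by
      refine (ψ_le_exp μ hq hs').trans ?_
      have := mul_le_mul_of_nonneg_right (hexp q (by linarith)) (by linarith [hs.2] : 0 ≤ 1 - s)
      linarith
    rw [logDerivRatio_add μ hr hq hs, add_sub_cancel_right, abs_of_nonneg
      (mul_nonneg (logDerivRatio_nonneg μ hr hψ) (deriv_ψ_pos μ hq hs').le)]
    have h1 := iteratedDeriv_ψ_le μ hr hψ.1 hψκ hκ1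
    have h2 := (hexp r (by linarith)).trans ((exp_le_sizeProb_one μ hr).trans
      (sizeProb_one_le_deriv_ψ μ r hψ))
    have h3 : logDerivRatio μ r (ψ μ q s) ≤
        μ.real univ * r * (∑' n : ℕ, (n : ℝ) * ((n : ℝ) - 1) * κ ^ (n - 2)) /
          Real.exp (-(μ.real univ * T)) :=
      div_le_div₀ ((iteratedDeriv_ψ_nonneg μ r hψ).trans h1) h1 (Real.exp_pos _) h2
    refine (mul_le_mul h3 (deriv_ψ_le μ q hs') (deriv_ψ_pos μ hq hs').le
      ((logDerivRatio_nonneg μ hr hψ).trans h3)).trans (le_of_eq ?_)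
    rw [hC]
    ring
  have hC0 : ∀ v ∈ Icc 0 T, 0 ≤ C * v := fun v hv => by
    simpa using (abs_nonneg _).trans (hinc v 0 hv.1 le_rfl (by linarith [hv.2]))
  have key : ∀ v ∈ Icc 0 T, ∀ w ∈ Icc 0 T, v ≤ w →
      |logDerivRatio μ w s - logDerivRatio μ v s| ≤ |C| * |w - v| := by
    intro v hv w hw hvw
    have := hinc (w - v) v (by linarith) hv.1 (by linarith [hw.2])
    rw [sub_add_cancel] at this
    rw [abs_of_nonneg (sub_nonneg.2 hvw)]
    exact this.trans (mul_le_mul_of_nonneg_right (le_abs_self C) (by linarith))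
  have hlip : LipschitzOnWith (Real.toNNReal |C|) (fun r => logDerivRatio μ r s) (Icc 0 T) := by
    refine LipschitzOnWith.of_dist_le_mul fun v hv w hw => ?_
    rw [Real.dist_eq, Real.dist_eq, Real.coe_toNNReal _ (abs_nonneg C)]
    rcases le_total v w with h | h
    · rw [abs_sub_comm, abs_sub_comm v w]
      exact key v hv w hw h
    · exact key w hw v hv h
  exact hlip.continuousOn

/-- The cocycle identity moves the difference quotient at time `q` to time `0` and to the point
`ψ_q(s)`. Only a right derivative comes out, and together with continuity it is enough for the
fundamental theorem of calculus. -/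
theorem hasDerivWithinAt_logDerivRatio {q : ℝ} (hq : 0 ≤ q) {s : ℝ} (hs : s ∈ Ioo (0 : ℝ) 1) :
    HasDerivWithinAt (fun r => logDerivRatio μ r s)
      (rateGen'' μ (ψ μ q s) * deriv (ψ μ q) s) (Ioi q) q := by
  have hs' := Ioo_subset_Ico_self hs
  rw [hasDerivWithinAt_iff_tendsto_slope' (by simp)]
  have h1 := (tendsto_logDerivRatio_div μ (ψ_mem μ hq hs')).mul_const (deriv (ψ μ q) s)
  have h2 : Tendsto (fun r => r - q) (𝓝[>] q) (𝓝[>] 0) := by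
    refine tendsto_nhdsWithin_iff.2 ⟨?_, ?_⟩
    · have : Tendsto (fun r : ℝ => r - q) (𝓝 q) (𝓝 (q - q)) := by
        exact (continuous_id.sub continuous_const).tendsto q
      rw [sub_self] at this
      exact this.mono_left nhdsWithin_le_nhds
    · filter_upwards [self_mem_nhdsWithin] with r hr
      exact sub_pos.2 (mem_Ioi.1 hr)
  refine (h1.comp h2).congr' ?_
  filter_upwards [self_mem_nhdsWithin] with r hr
  have hr' : 0 < r - q := sub_pos.2 (mem_Ioi.1 hr)
  have := logDerivRatio_add μ hr'.le hq hs
  rw [sub_add_cancel] at this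
  rw [slope_def_field, this]
  simp only [Function.comp_apply]
  field_simp
  ring

theorem lintegral_rateGen'' {T : ℝ} (hT : 0 ≤ T) {s : ℝ} (hs : s ∈ Ioo (0 : ℝ) 1) :
    ∫⁻ r in Ioc 0 T, ENNReal.ofReal (rateGen'' μ (ψ μ r s) * deriv (ψ μ r) s) =
      ENNReal.ofReal (logDerivRatio μ T s) := by
  have hs' := Ioo_subset_Ico_self hs
  have hcont := continuousOn_logDerivRatio μ T hs
  have hderiv : ∀ r ∈ Ioo 0 T, HasDerivWithinAt (fun r => logDerivRatio μ r s)
      (rateGen'' μ (ψ μ r s) * deriv (ψ μ r) s) (Ioi r) r := fun r hr =>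
    hasDerivWithinAt_logDerivRatio μ hr.1.le hs
  have hnn : ∀ r : ℝ, 0 ≤ r → 0 ≤ rateGen'' μ (ψ μ r s) * deriv (ψ μ r) s := fun r hr =>
    mul_nonneg (rateGen''_nonneg μ (ψ_nonneg μ r hs.1.le)) (deriv_ψ_pos μ hr hs').le
  have hint := intervalIntegral.integrableOn_deriv_right_of_nonneg hcont hderiv
    fun r hr => hnn r hr.1.le
  have hftc := intervalIntegral.integral_eq_sub_of_hasDeriv_right_of_le hT hcont hderiv
    ((intervalIntegrable_iff_integrableOn_Ioc_of_le hT).2 hint)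
  rw [logDerivRatio_zero μ hs', sub_zero, intervalIntegral.integral_of_le hT] at hftc
  rw [← hftc, ofReal_integral_eq_lintegral_ofReal hint]
  filter_upwards [ae_restrict_mem measurableSet_Ioc] with r hr
  exact hnn r hr.1.le

end Law

/-! ### The generating function of the density -/

/-- For sizes below `2` the truncated exponent would give weight `1`, so `Θ` must vanish there;
infinite sizes have weight `0`. -/
theorem lintegral_mul_shiftPow_two {α : Type*} [MeasurableSpace α] (ν : Measure α) {m : α → ℕ∞}
    (hm : Measurable m) {Θ : α → ℝ≥0∞} (hΘ : Measurable Θ) (h : ∀ a, m a < 2 → Θ a = 0)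
    (s : ℝ≥0∞) :
    ∫⁻ a, Θ a * shiftPow s 2 (m a) ∂ν =
      ∑' p : ℕ, (∫⁻ a in {a | m a = ((p + 2 : ℕ) : ℕ∞)}, Θ a ∂ν) * s ^ p := by
  have hmeas : ∀ p : ℕ, MeasurableSet {a | m a = ((p + 2 : ℕ) : ℕ∞)} := fun p =>
    hm (measurableSet_singleton _)
  have hpt : ∀ a, Θ a * shiftPow s 2 (m a) =
      ∑' p : ℕ, {a | m a = ((p + 2 : ℕ) : ℕ∞)}.indicator Θ a * s ^ p := by
    intro a
    by_cases htop : m a = ⊤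
    · rw [htop, shiftPow_top, mul_zero, eq_comm, ENNReal.tsum_eq_zero]
      intro p
      rw [indicator_of_notMem, zero_mul]
      intro hmem
      exact ENat.top_ne_natCast _ (htop.symm.trans hmem)
    by_cases h2 : m a < 2
    · simp [h a h2, indicator]
    obtain ⟨n, hn⟩ := ENat.ne_top_iff_exists.1 htop
    obtain ⟨k, rfl⟩ : ∃ k, n = k + 2 := by
      rw [← hn, not_lt] at h2
      exact ⟨n - 2, by have : 2 ≤ n := by exact_mod_cast h2
                       omega⟩
    rw [tsum_eq_single k, indicator_of_mem (show a ∈ {a | m a = ((k + 2 : ℕ) : ℕ∞)} from hn.symm),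
      ← hn, shiftPow_coe, Nat.add_sub_cancel]
    intro p hp
    rw [indicator_of_notMem, zero_mul]
    intro hmem
    have : m a = ((p + 2 : ℕ) : ℕ∞) := hmem
    rw [← hn, ENat.natCast_inj] at this
    omega
  rw [lintegral_congr hpt, lintegral_tsum fun p =>
      ((hΘ.indicator (hmeas p)).mul_const _).aemeasurable]
  exact tsum_congr fun p => by
    rw [lintegral_mul_const _ (hΘ.indicator (hmeas p)), lintegral_indicator (hmeas p)]

/-- Finiteness of the sum at one positive point makes all coefficients finite, after which the real
identity theorem applies. -/
theorem powerSeries_coeff_eq_ennreal {a b : ℕ → ℝ≥0∞}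
    (h : ∀ s ∈ Ioo (0 : ℝ) 1,
      ∑' n, a n * ENNReal.ofReal s ^ n = ∑' n, b n * ENNReal.ofReal s ^ n)
    (hb : ∀ s ∈ Ioo (0 : ℝ) 1, ∑' n, b n * ENNReal.ofReal s ^ n ≠ ⊤) : a = b := by
  have key : ∀ c : ℕ → ℝ≥0∞, (∀ s ∈ Ioo (0 : ℝ) 1, ∑' n, c n * ENNReal.ofReal s ^ n ≠ ⊤) →
      (∀ n, c n ≠ ⊤) ∧ ∀ s ∈ Ioo (0 : ℝ) 1, (Summable fun n => (c n).toReal * s ^ n) ∧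
        ∑' n, (c n).toReal * s ^ n = (∑' n, c n * ENNReal.ofReal s ^ n).toReal := by
    intro c hc
    refine ⟨fun n hn => ?_, fun s hs => ?_⟩
    · have h1 : (2⁻¹ : ℝ) ∈ Ioo (0 : ℝ) 1 := by constructor <;> norm_num
      refine ENNReal.ne_top_of_tsum_ne_top (hc _ h1) n ?_
      rw [hn, ENNReal.top_mul]
      exact pow_ne_zero _ (by simp)
    · have hreal : ∀ n, (c n * ENNReal.ofReal s ^ n).toReal = (c n).toReal * s ^ n := fun n => by
        rw [ENNReal.toReal_mul, ENNReal.toReal_pow, ENNReal.toReal_ofReal hs.1.le]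
      have := ENNReal.summable_toReal (hc s hs)
      simp_rw [hreal] at this
      refine ⟨this, ?_⟩
      rw [ENNReal.tsum_toReal_eq (ENNReal.ne_top_of_tsum_ne_top (hc s hs))]
      exact tsum_congr fun n => (hreal n).symm
  obtain ⟨ha1, ha2⟩ := key a fun s hs => by rw [h s hs]; exact hb s hs
  obtain ⟨hb1, hb2⟩ := key b hb
  have := powerSeries_coeff_eq (fun s hs => (ha2 s hs).1) (fun s hs => (hb2 s hs).1) fun s hs => by
    rw [(ha2 s hs).2, (hb2 s hs).2, h s hs]
  funext n
  exact (ENNReal.toReal_eq_toReal_iff' (ha1 n) (hb1 n)).1 (congrFun this n)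

theorem measurable_setLIntegral_eq {α β : Type*} [MeasurableSpace α] [MeasurableSpace β]
    (ν : Measure β) [SFinite ν] {m : α × β → ℕ∞} (hm : Measurable m) {f : α × β → ℝ≥0∞}
    (hf : Measurable f) (k : ℕ∞) :
    Measurable fun a => ∫⁻ b in {b | m (a, b) = k}, f (a, b) ∂ν := by
  have hset : MeasurableSet {q | m q = k} := hm (measurableSet_singleton k)
  have e : ∀ a, ∫⁻ b in {b | m (a, b) = k}, f (a, b) ∂ν =
      ∫⁻ b, {q | m q = k}.indicator f (a, b) ∂ν := by
    intro a
    have hset' : MeasurableSet {b | m (a, b) = k} := hset.preimage measurable_prodMk_left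
    rw [← lintegral_indicator hset']
    exact lintegral_congr fun b => by by_cases h : m (a, b) = k <;> simp [indicator, h]
  simp_rw [e]
  exact (hf.indicator hset).lintegral_prod_right'

theorem Forest.measurable_Z_joint {x : ℕ} : Measurable fun q : ℝ × Forest x => q.2.Z q.1 :=
  measurable_encard Forest.measurableSet_mem_alive

section Law

variable (μ : Measure ℕ)

theorem mul_splitMean (y n : ℕ) {p : ℕ} (hp : 2 ≤ p) (t₂ t₁ : ℝ) :
    (p : ℝ≥0∞) * ((p : ℝ≥0∞) - 1) * splitMean μ y p n t₂ t₁ =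
      ∫⁻ F in {F : Forest (y - 1) × Forest 1 × Forest (n - 1) |
        F.1.Z t₂ + F.2.1.Z t₂ + F.2.2.Z t₁ = (p : ℕ∞)},
      (F.2.1.Z t₂ : ℝ≥0∞) * (F.2.2.Z t₁ : ℝ≥0∞)
      ∂((forestLaw μ (y - 1)).prod ((forestLaw μ 1).prod (forestLaw μ (n - 1)))) := by
  have h0 : (p : ℝ≥0∞) * ((p : ℝ≥0∞) - 1) ≠ 0 := by
    refine mul_ne_zero (by simp; omega) (tsub_pos_of_lt ?_).ne'
    exact_mod_cast hp
  have h1 : (p : ℝ≥0∞) * ((p : ℝ≥0∞) - 1) ≠ ⊤ :=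
    ENNReal.mul_ne_top (ENNReal.natCast_ne_top p) (ENNReal.sub_ne_top (ENNReal.natCast_ne_top p))
  rw [splitMean, ← lintegral_const_mul' _ _ h1]
  exact lintegral_congr fun F => ENNReal.mul_div_cancel h0 h1

variable [IsFiniteMeasure μ]

theorem ofReal_rateGen'' {u : ℝ} (hu : u ∈ Ico (0 : ℝ) 1) :
    ENNReal.ofReal (rateGen'' μ u) = ∑' n : {n : ℕ // 2 ≤ n},
      ((n : ℕ) : ℝ≥0∞) * μ {(n : ℕ)} *
        (((n - 1 : ℕ) : ℝ≥0∞) * ENNReal.ofReal u ^ ((n : ℕ) - 1 - 1)) := by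
  have hnn : ∀ n : ℕ, 0 ≤ μ.real {n} * (n * ((n : ℝ) - 1) * u ^ (n - 2)) := fun n =>
    mul_nonneg measureReal_nonneg (mul_nonneg (natCast_mul_sub_one_nonneg n) (pow_nonneg hu.1 _))
  have hsum : Summable fun n : ℕ => μ.real {n} * (n * ((n : ℝ) - 1) * u ^ (n - 2)) := by
    refine Summable.of_nonneg_of_le hnn (fun n => ?_)
      ((summable_natCast_mul_sub_one_mul_pow hu.1 hu.2).mul_left (μ.real univ))
    exact mul_le_mul_of_nonneg_right (measureReal_mono (subset_univ _))
      (mul_nonneg (natCast_mul_sub_one_nonneg n) (pow_nonneg hu.1 _))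
  rw [rateGen'', ENNReal.ofReal_tsum_of_nonneg hnn hsum]
  rw [← tsum_subtype_eq_of_support_subset (s := {n : ℕ | 2 ≤ n})]
  · refine tsum_congr fun ⟨n, hn⟩ => ?_
    rw [ENNReal.ofReal_mul measureReal_nonneg, ofReal_measureReal,
      ENNReal.ofReal_mul (natCast_mul_sub_one_nonneg n), ofReal_natCast_mul_sub_one,
      ENNReal.ofReal_pow hu.1, ENNReal.natCast_sub, Nat.sub_sub]
    push_cast
    ring
  · intro n hn
    by_contra h
    have : n = 0 ∨ n = 1 := by simp only [mem_ofPred_eq] at h; omega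
    rcases this with rfl | rfl <;> simp at hn

variable [NeZero μ]

/-- At time `0` exactly the `x` founders are alive. Hence the branching identities at `r = 0`
describe the population started from `x` individuals. -/
theorem restrict_Z_zero (x : ℕ) :
    (forestLaw μ x).restrict {F | F.Z 0 = x} = forestLaw μ x := by
  refine Measure.restrict_eq_self_of_ae_mem ?_
  filter_upwards [ae_pos_forestLaw μ x] with F hF
  exact hF.Z_of_lifetimes le_rfl fun i => hF i []

theorem forestLaw_Z_zero (x : ℕ) : forestLaw μ x {F | F.Z 0 = x} = 1 := by
  rw [← Measure.restrict_apply_univ, restrict_Z_zero, measure_univ]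

theorem lintegral_shiftPow_Z {q : ℝ} (hq : 0 ≤ q) (x : ℕ) (s : ℝ≥0∞) :
    ∫⁻ F, shiftPow s 0 (F.Z q) ∂forestLaw μ x = gen μ q s ^ x := by
  have := setLIntegral_shiftPow μ (x := x) le_rfl hq x s
  rwa [restrict_Z_zero, forestLaw_Z_zero, one_mul, zero_add] at this

theorem lintegral_Z_mul_shiftPow {q : ℝ} (hq : 0 ≤ q) (x : ℕ) (s : ℝ≥0∞) :
    ∫⁻ F, (F.Z q : ℝ≥0∞) * shiftPow s 1 (F.Z q) ∂forestLaw μ x =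
      x * gen' μ q s * gen μ q s ^ (x - 1) := by
  have := setLIntegral_Z_mul_shiftPow μ (x := x) le_rfl hq x s
  rwa [restrict_Z_zero, forestLaw_Z_zero, one_mul, zero_add] at this

/-- Where `Z¹ Z² ≠ 0` both sizes are at least `1`, so the two powers removed from `s` can be taken
one from each. By independence the mean then factors into `ψ_{t₂}^(y-1)`, `ψ_{t₂}'` and the
derivative of `ψ_{t₁}^(n-1)`. -/
theorem tsum_mul_splitMean (y n : ℕ) {t₂ t₁ : ℝ} (ht₂ : 0 ≤ t₂) (ht₁ : 0 ≤ t₁) (s : ℝ≥0∞) :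
    ∑' p : ℕ, ((p + 2 : ℕ) : ℝ≥0∞) * (((p + 2 : ℕ) : ℝ≥0∞) - 1) *
        splitMean μ y (p + 2) n t₂ t₁ * s ^ p =
      gen μ t₂ s ^ (y - 1) * gen' μ t₂ s *
        (((n - 1 : ℕ) : ℝ≥0∞) * gen' μ t₁ s * gen μ t₁ s ^ (n - 1 - 1)) := by
  have hZ0 : Measurable fun F : Forest (y - 1) × Forest 1 × Forest (n - 1) => F.1.Z t₂ :=
    (Forest.measurable_Z t₂).comp measurable_fst
  have hZ1 : Measurable fun F : Forest (y - 1) × Forest 1 × Forest (n - 1) => F.2.1.Z t₂ :=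
    (Forest.measurable_Z t₂).comp (measurable_fst.comp measurable_snd)
  have hZ2 : Measurable fun F : Forest (y - 1) × Forest 1 × Forest (n - 1) => F.2.2.Z t₁ :=
    (Forest.measurable_Z t₁).comp (measurable_snd.comp measurable_snd)
  simp_rw [mul_splitMean μ y n (Nat.le_add_left 2 _)]
  refine (lintegral_mul_shiftPow_two _ ((hZ0.add hZ1).add hZ2)
    ((measurable_toENNReal.comp hZ1).mul (measurable_toENNReal.comp hZ2)) ?_ s).symm.trans ?_
  rotate_left
  · have hpt : ∀ F : Forest (y - 1) × Forest 1 × Forest (n - 1),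
        (F.2.1.Z t₂ : ℝ≥0∞) * (F.2.2.Z t₁ : ℝ≥0∞) *
          shiftPow s 2 (F.1.Z t₂ + F.2.1.Z t₂ + F.2.2.Z t₁) =
        shiftPow s 0 (F.1.Z t₂) * (((F.2.1.Z t₂ : ℝ≥0∞) * shiftPow s 1 (F.2.1.Z t₂)) *
          ((F.2.2.Z t₁ : ℝ≥0∞) * shiftPow s 1 (F.2.2.Z t₁))) := by
      intro F
      generalize F.1.Z t₂ = a
      generalize F.2.1.Z t₂ = b
      generalize F.2.2.Z t₁ = c
      by_cases hb : b = 0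
      · simp [hb]
      by_cases hc : c = 0
      · simp [hc]
      have hsum : shiftPow s 2 (a + b + c) = shiftPow s 0 a * shiftPow s 1 b * shiftPow s 1 c := by
        induction a using ENat.recTopCoe with
        | top => simp
        | coe a =>
        induction b using ENat.recTopCoe with
        | top => simp
        | coe b =>
        induction c using ENat.recTopCoe with
        | top => simp
        | coe c =>
        have hb' : b ≠ 0 := by exact_mod_cast hb
        have hc' : c ≠ 0 := by exact_mod_cast hc
        rw [← Nat.cast_add, ← Nat.cast_add, shiftPow_coe, shiftPow_coe, shiftPow_coe, shiftPow_coe,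
          ← pow_add, ← pow_add]
        congr 1
        omega
      rw [hsum]
      ring
    refine (lintegral_congr hpt).trans ?_
    have hm0 := (Forest.measurable_shiftPow_Z (x := y - 1) s 0 t₂)
    have hm1 := (Forest.measurable_Z_toENNReal t₂).mul
        (Forest.measurable_shiftPow_Z (x := 1) s 1 t₂)
    have hm2 := (Forest.measurable_Z_toENNReal t₁).mul
      (Forest.measurable_shiftPow_Z (x := n - 1) s 1 t₁)
    rw [lintegral_prod_mul (f := fun F : Forest (y - 1) => shiftPow s 0 (F.Z t₂))
        (g := fun F : Forest 1 × Forest (n - 1) => ((F.1.Z t₂ : ℝ≥0∞) * shiftPow s 1 (F.1.Z t₂)) *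
          ((F.2.Z t₁ : ℝ≥0∞) * shiftPow s 1 (F.2.Z t₁))) hm0.aemeasurable
        ((hm1.comp measurable_fst).mul (hm2.comp measurable_snd)).aemeasurable,
      lintegral_prod_mul (f := fun F : Forest 1 => (F.Z t₂ : ℝ≥0∞) * shiftPow s 1 (F.Z t₂))
        (g := fun F : Forest (n - 1) => (F.Z t₁ : ℝ≥0∞) * shiftPow s 1 (F.Z t₁))
        hm1.aemeasurable hm2.aemeasurable, lintegral_shiftPow_Z μ ht₂, lintegral_Z_mul_shiftPow μ
          ht₁]
    change gen μ t₂ s ^ (y - 1) * (gen' μ t₂ s * _) = _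
    ring
  · intro F hF
    by_cases hb : F.2.1.Z t₂ = 0
    · simp [hb]
    by_cases hc : F.2.2.Z t₁ = 0
    · simp [hc]
    exfalso
    refine absurd hF (not_lt.2 ?_)
    rw [← one_add_one_eq_two]
    exact add_le_add (le_add_left (Order.one_le_iff_ne_zero.2 hb)) (Order.one_le_iff_ne_zero.2 hc)

theorem measurable_splitMean (y p n : ℕ) (t₂ : ℝ) :
    Measurable fun t₁ => splitMean μ y p n t₂ t₁ := by
  have hZ0 : Measurable fun q : ℝ × (Forest (y - 1) × Forest 1 × Forest (n - 1)) => q.2.1.Z t₂ :=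
    (Forest.measurable_Z t₂).comp (measurable_fst.comp measurable_snd)
  have hZ1 : Measurable fun q : ℝ × (Forest (y - 1) × Forest 1 × Forest (n - 1)) => q.2.2.1.Z t₂ :=
    (Forest.measurable_Z t₂).comp (measurable_fst.comp (measurable_snd.comp measurable_snd))
  have hZ2 : Measurable fun q : ℝ × (Forest (y - 1) × Forest 1 × Forest (n - 1)) =>
      q.2.2.2.Z q.1 :=
    Forest.measurable_Z_joint.comp
      (measurable_fst.prodMk (measurable_snd.comp (measurable_snd.comp measurable_snd)))
  have hf : Measurable fun q : ℝ × (Forest (y - 1) × Forest 1 × Forest (n - 1)) =>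
      ((q.2.2.1.Z t₂ : ℝ≥0∞) * (q.2.2.2.Z q.1 : ℝ≥0∞)) / ((p : ℝ≥0∞) * ((p : ℝ≥0∞) - 1)) :=
    ((measurable_toENNReal.comp hZ1).mul (measurable_toENNReal.comp hZ2)).div_const _
  exact measurable_setLIntegral_eq (((forestLaw μ (y - 1)).prod
    ((forestLaw μ 1).prod (forestLaw μ (n - 1))))) ((hZ0.add hZ1).add hZ2) hf p

theorem measurable_density (y p : ℕ) (t₂ : ℝ) : Measurable fun t₁ => density μ y p t₂ t₁ := by
  unfold density
  exact (Measurable.tsum fun n : {n : ℕ // 2 ≤ n} =>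
    (measurable_splitMean μ y p n t₂).const_mul (((n : ℕ) : ℝ≥0∞) * μ {(n : ℕ)})).const_mul _

/-- Summation over `n` collects `∑ n (n - 1) μ(n) ψ_{t₁}^(n-2)`, the second derivative of the
generating function of `μ` at `ψ_{t₁}`. -/
theorem tsum_mul_density (y : ℕ) {t₂ t₁ : ℝ} (ht₂ : 0 ≤ t₂) (ht₁ : 0 ≤ t₁) {s : ℝ}
    (hs : s ∈ Ico (0 : ℝ) 1) :
    ∑' p : ℕ, ((p + 2 : ℕ) : ℝ≥0∞) * (((p + 2 : ℕ) : ℝ≥0∞) - 1) *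
        density μ y (p + 2) t₂ t₁ * ENNReal.ofReal s ^ p =
      y * gen' μ t₂ (ENNReal.ofReal s) * gen μ t₂ (ENNReal.ofReal s) ^ (y - 1) *
        ENNReal.ofReal (rateGen'' μ (ψ μ t₁ s) * deriv (ψ μ t₁) s) := by
  calc _ = ∑' p : ℕ, ∑' n : {n : ℕ // 2 ≤ n}, y * (((n : ℕ) : ℝ≥0∞) * μ {(n : ℕ)}) *
          (((p + 2 : ℕ) : ℝ≥0∞) * (((p + 2 : ℕ) : ℝ≥0∞) - 1) *
            splitMean μ y (p + 2) n t₂ t₁ * ENNReal.ofReal s ^ p) := by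
        refine tsum_congr fun p => ?_
        rw [density, ← ENNReal.tsum_mul_left, ← ENNReal.tsum_mul_left, ← ENNReal.tsum_mul_right]
        exact tsum_congr fun n => by ring
    _ = ∑' n : {n : ℕ // 2 ≤ n}, y * (((n : ℕ) : ℝ≥0∞) * μ {(n : ℕ)}) *
          (gen μ t₂ (ENNReal.ofReal s) ^ (y - 1) * gen' μ t₂ (ENNReal.ofReal s) *
        (((n - 1 : ℕ) : ℝ≥0∞) * gen' μ t₁ (ENNReal.ofReal s) *
          gen μ t₁ (ENNReal.ofReal s) ^ ((n : ℕ) - 1 - 1))) := by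
        rw [ENNReal.tsum_comm]
        refine tsum_congr fun n => ?_
        rw [ENNReal.tsum_mul_left, tsum_mul_splitMean μ y n ht₂ ht₁]
    _ = _ := by
        rw [ENNReal.ofReal_mul (rateGen''_nonneg μ (ψ_nonneg μ t₁ hs.1)),
          ofReal_rateGen'' μ (ψ_mem μ ht₁ hs), ofReal_deriv_ψ μ t₁ hs, ofReal_ψ μ t₁ hs,
          ← ENNReal.tsum_mul_right, ← ENNReal.tsum_mul_left]
        exact tsum_congr fun n => by ring

theorem tsum_mul_lintegral_density (y : ℕ) {t₂ t₁ : ℝ} (ht₂ : 0 ≤ t₂) (ht₁ : 0 ≤ t₁) {s : ℝ}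
    (hs : s ∈ Ioo (0 : ℝ) 1) :
    ∑' p : ℕ, ((p + 2 : ℕ) : ℝ≥0∞) * (((p + 2 : ℕ) : ℝ≥0∞) - 1) *
        (∫⁻ u in Ioc 0 t₁, density μ y (p + 2) t₂ u) * ENNReal.ofReal s ^ p =
      y * gen' μ t₂ (ENNReal.ofReal s) * gen μ t₂ (ENNReal.ofReal s) ^ (y - 1) *
        ENNReal.ofReal (logDerivRatio μ t₁ s) := by
  have hs' := Ioo_subset_Ico_self hs
  have hm := fun p => measurable_density μ y (p + 2) t₂
  have hfin : (y : ℝ≥0∞) * gen' μ t₂ (ENNReal.ofReal s) * gen μ t₂ (ENNReal.ofReal s) ^ (y - 1) ≠ ⊤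
      := by
    rw [← ofReal_deriv_ψ μ _ hs', ← ofReal_ψ μ _ hs']
    exact ENNReal.mul_ne_top (ENNReal.mul_ne_top (ENNReal.natCast_ne_top y) ENNReal.ofReal_ne_top)
      (ENNReal.pow_ne_top ENNReal.ofReal_ne_top)
  rw [← lintegral_rateGen'' μ ht₁ hs, ← lintegral_const_mul' _ _ hfin]
  rw [← setLIntegral_congr_fun measurableSet_Ioc fun u hu =>
    tsum_mul_density μ y ht₂ hu.1.le hs', lintegral_tsum fun p =>
      (((hm p).const_mul _).mul_const _).aemeasurable]
  exact tsum_congr fun p => by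
    rw [lintegral_mul_const _ ((hm p).const_mul _), lintegral_const_mul _ (hm p)]

/-- The chain rule divided by the positive number `ψ_t'(s)`: it trades the inner point `ψ_t(s)` for
the total time `q + t`. -/
theorem gen'_gen_mul_gen'' {q t : ℝ} (hq : 0 ≤ q) (ht : 0 ≤ t) {s : ℝ} (hs : s ∈ Ico (0 : ℝ) 1) :
    gen' μ q (gen μ t (ENNReal.ofReal s)) * gen'' μ t (ENNReal.ofReal s) =
      gen' μ (q + t) (ENNReal.ofReal s) * ENNReal.ofReal (logDerivRatio μ t s) := by
  have hpos := deriv_ψ_pos μ ht hs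
  rw [gen'_add μ hq ht, mul_assoc, ← ofReal_deriv_ψ μ t hs, ← ENNReal.ofReal_mul hpos.le,
    logDerivRatio, mul_div_cancel₀ _ hpos.ne', ofReal_iteratedDeriv_ψ μ t hs]

theorem tsum_setLIntegral_pairs {x : ℕ} {r q t : ℝ} (hr : 0 ≤ r) (hq : 0 ≤ q) (ht : 0 ≤ t) (y : ℕ)
    {s : ℝ} (hs : s ∈ Ico (0 : ℝ) 1) :
    ∑' p : ℕ, (∫⁻ F in {F | F.Z r = y ∧ F.Z (r + (q + t)) = ((p + 2 : ℕ) : ℕ∞)},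
        ((F.pairs (r + (q + t)) (r + q)).encard : ℝ≥0∞) ∂forestLaw μ x) * ENNReal.ofReal s ^ p =
      forestLaw μ x {F | F.Z r = y} * (y * gen' μ (q + t) (ENNReal.ofReal s) *
        gen μ (q + t) (ENNReal.ofReal s) ^ (y - 1) * ENNReal.ofReal (logDerivRatio μ t s)) := by
  have h := setLIntegral_pairs μ (x := x) hr hq ht y (ENNReal.ofReal s)
  rw [gen'_gen_mul_gen'' μ hq ht hs, lintegral_mul_shiftPow_two _ (Forest.measurable_Z _)
    (Forest.measurable_pairs_toENNReal _ _)] at h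
  · have e : ∀ p : ℕ, {F : Forest x | F.Z r = y ∧ F.Z (r + (q + t)) = ((p + 2 : ℕ) : ℕ∞)} =
        {F | F.Z (r + (q + t)) = ((p + 2 : ℕ) : ℕ∞)} ∩ {F | F.Z r = (y : ℕ∞)} := fun p => by
      ext F; exact and_comm
    simp_rw [e, ← Measure.restrict_restrict (Forest.measurableSet_Z_eq _ _)]
    rw [h]
    ring
  · intro F hF
    have : F.pairs (r + (q + t)) (r + q) = ∅ := by
      refine eq_empty_of_forall_notMem fun ⟨a, b⟩ ⟨h1, h2, h3, _⟩ => absurd hF (not_lt.2 ?_)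
      rw [← encard_pair h1]
      exact encard_le_encard (insert_subset h2 (singleton_subset_iff.2 h3))
    simp [this]

/-- Both sides have the same finite generating function in `p` on `(0, 1)`: the left by branching,
the right by integrating the derivative of `logDerivRatio`. -/
theorem setLIntegral_pairs_eq_density {x : ℕ} {r q t : ℝ} (hr : 0 ≤ r) (hq : 0 ≤ q) (ht : 0 ≤ t)
    (y p : ℕ) :
    ∫⁻ F in {F | F.Z r = y ∧ F.Z (r + (q + t)) = ((p + 2 : ℕ) : ℕ∞)},
        ((F.pairs (r + (q + t)) (r + q)).encard : ℝ≥0∞) ∂forestLaw μ x =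
      forestLaw μ x {F | F.Z r = y} * (((p + 2 : ℕ) : ℝ≥0∞) * (((p + 2 : ℕ) : ℝ≥0∞) - 1) *
        ∫⁻ u in Ioc 0 t, density μ y (p + 2) (q + t) u) := by
  refine congrFun (powerSeries_coeff_eq_ennreal (a := fun p : ℕ => ∫⁻ F in {F : Forest x |
      F.Z r = y ∧ F.Z (r + (q + t)) = ((p + 2 : ℕ) : ℕ∞)},
        ((F.pairs (r + (q + t)) (r + q)).encard : ℝ≥0∞) ∂forestLaw μ x)
    (b := fun p : ℕ => forestLaw μ x {F | F.Z r = y} * (((p + 2 : ℕ) : ℝ≥0∞) *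
      (((p + 2 : ℕ) : ℝ≥0∞) - 1) * ∫⁻ u in Ioc 0 t, density μ y (p + 2) (q + t) u)) ?_ ?_) p
  all_goals
    intro s hs
    have hs' := Ioo_subset_Ico_self hs
    have hb := tsum_mul_lintegral_density μ y (add_nonneg hq ht) ht hs
    simp_rw [mul_assoc (forestLaw μ x {F | F.Z r = y})]
    rw [ENNReal.tsum_mul_left, hb]
  · rw [tsum_setLIntegral_pairs μ hr hq ht y hs']
  · rw [← ofReal_deriv_ψ μ _ hs', ← ofReal_ψ μ _ hs']
    exact ENNReal.mul_ne_top (measure_ne_top _ _) (ENNReal.mul_ne_top (ENNReal.mul_ne_top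
      (ENNReal.mul_ne_top (ENNReal.natCast_ne_top y) ENNReal.ofReal_ne_top)
      (ENNReal.pow_ne_top ENNReal.ofReal_ne_top)) ENNReal.ofReal_ne_top)

end Law

/-! ### The sampled pair -/

/-- The ordered pairs of distinct individuals alive at time `t`. -/
def Forest.alivePairs {x : ℕ} (F : Forest x) (t : ℝ) : Set (Individual x × Individual x) :=
  {c | c.1 ≠ c.2 ∧ c.1 ∈ F.alive t ∧ c.2 ∈ F.alive t}

theorem Forest.measurableSet_mem_alivePairs {x : ℕ} (t : ℝ) (c : Individual x × Individual x) :
    MeasurableSet {F : Forest x | c ∈ F.alivePairs t} :=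
  .inter (.const _) (.inter (Forest.measurableSet_mem_alive_right t c.1)
    (Forest.measurableSet_mem_alive_right t c.2))

theorem Forest.two_le_Z {x : ℕ} {F : Forest x} {t : ℝ} {c : Individual x × Individual x}
    (hc : c ∈ F.alivePairs t) : 2 ≤ F.Z t := by
  rw [← encard_pair hc.1]
  exact encard_le_encard (insert_subset hc.2.1 (singleton_subset_iff.2 hc.2.2))

theorem Forest.pairs_subset_alivePairs {x : ℕ} (F : Forest x) (t q : ℝ) :
    F.pairs t q ⊆ F.alivePairs t := fun _ hc => ⟨hc.1, hc.2.1, hc.2.2.1⟩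

theorem Forest.Pos.T_eq {x : ℕ} {F : Forest x} (h : F.Pos) {t : ℝ}
    {c : Individual x × Individual x} (hc : c ∈ F.alivePairs t) (htop : F.Z t ≠ ⊤) :
    F.T t c = if c.1.1 = c.2.1 then ENNReal.ofReal (t - F.splitTime c.1 c.2) else ⊤ := by
  rw [Forest.T, if_pos ⟨Forest.two_le_Z hc, htop⟩, h.coalescenceTime_eq hc.1 hc.2.1 hc.2.2]

theorem tsum_measure_mem_pairs {x : ℕ} (ν : Measure (Forest x)) (D : Set (Forest x))
    (t q : ℝ) :
    ∑' c, ν {F | F ∈ D ∧ c ∈ F.pairs t q} = ∫⁻ F in D, ((F.pairs t q).encard : ℝ≥0∞) ∂ν := by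
  have hm := fun c => Forest.measurableSet_mem_pairs (x := x) t q c
  have hpt : ∀ F : Forest x, ((F.pairs t q).encard : ℝ≥0∞) =
      ∑' c, {F : Forest x | c ∈ F.pairs t q}.indicator 1 F := fun F => by
    rw [← ENNReal.tsum_set_one, tsum_subtype (F.pairs t q) fun _ => (1 : ℝ≥0∞)]
    rfl
  rw [lintegral_congr hpt, lintegral_tsum fun c => (measurable_one.indicator (hm c)).aemeasurable]
  refine tsum_congr fun c => ?_
  rw [lintegral_indicator_one (hm c), Measure.restrict_apply (hm c), inter_comm]
  rfl

theorem ae_splitTime_ne (μ : Measure ℕ) [IsFiniteMeasure μ] [NeZero μ] (x : ℕ) (q : ℝ) :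
    ∀ᵐ F ∂forestLaw μ x, ∀ c : Individual x × Individual x, F.splitTime c.1 c.2 ≠ q := by
  refine ae_all_iff.2 fun c => ?_
  exact (Measure.quasiMeasurePreserving_eval (fun _ : Fin x => treeLaw μ) c.1.1).ae
    (ae_death_ne μ _ q)

theorem natCast_mul_sub_one_ne_zero {p : ℕ} (hp : 2 ≤ p) :
    (p : ℝ≥0∞) * ((p : ℝ≥0∞) - 1) ≠ 0 := by
  refine mul_ne_zero (by simp; omega) (tsub_pos_of_lt ?_).ne'
  exact_mod_cast hp

theorem natCast_mul_sub_one_ne_top (p : ℕ) : (p : ℝ≥0∞) * ((p : ℝ≥0∞) - 1) ≠ ⊤ :=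
  ENNReal.mul_ne_top (ENNReal.natCast_ne_top p) (ENNReal.sub_ne_top (ENNReal.natCast_ne_top p))

/-! ### Uniform sampling given the genealogy. -/

section Sampling

variable {Ω : Type*} [MeasurableSpace Ω] {P : Measure Ω} {x : ℕ} {X : Ω → Forest x} {t : ℝ}
  {σ : Ω → Individual x × Individual x}

theorem IsUniformPair.measurableSet_mem (hσ : IsUniformPair P X t σ) (hX : Measurable X)
    {A : Individual x × Individual x → Set (Forest x)} (hA : ∀ c, MeasurableSet (A c)) :
    MeasurableSet {ω | X ω ∈ A (σ ω)} := by
  have : {ω | X ω ∈ A (σ ω)} = ⋃ c, ({ω | σ ω = c} ∩ X ⁻¹' A c) := by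
    ext ω
    simp
  rw [this]
  exact .iUnion fun c => (hσ.measurable c.1 c.2).inter (hX (hA c))

/-- The event splits over the countably many values of `σ`; on `Z_t = p` each pair has the constant
conditional weight `1 / (p (p - 1))`. -/
theorem IsUniformPair.measure_mem (hσ : IsUniformPair P X t σ) (hX : Measurable X)
    {A : Individual x × Individual x → Set (Forest x)} (hA : ∀ c, MeasurableSet (A c)) {p : ℕ}
    (hp : 2 ≤ p) :
    P {ω | X ω ∈ A (σ ω) ∧ (X ω).Z t = p} = ((p : ℝ≥0∞) * ((p : ℝ≥0∞) - 1))⁻¹ *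
      ∑' c, P.map X {F | F ∈ A c ∧ F.Z t = p ∧ c ∈ F.alivePairs t} := by
  have hZp := Forest.measurableSet_Z_eq (x := x) t p
  have hB : ∀ c, MeasurableSet (A c ∩ {F | F.Z t = p}) := fun c => (hA c).inter hZp
  have h2 : (2 : ℕ∞) ≤ p := by exact_mod_cast hp
  have hpt : (p : ℕ∞) ≠ ⊤ := ENat.natCast_ne_top p
  have e : {ω | X ω ∈ A (σ ω) ∧ (X ω).Z t = p} =
      ⋃ c : Individual x × Individual x, {ω | X ω ∈ A c ∩ {F | F.Z t = p} ∧ 2 ≤ (X ω).Z t ∧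
        (X ω).Z t ≠ ⊤ ∧ σ ω = (c.1, c.2)} := by
    ext ω
    simp only [mem_ofPred_eq, mem_iUnion]
    constructor
    · rintro ⟨h, hZ⟩
      exact ⟨σ ω, ⟨h, hZ⟩, hZ ▸ h2, hZ ▸ hpt, rfl⟩
    · rintro ⟨c, ⟨h, hZ⟩, -, -, hc⟩
      have hc' : c = σ ω := hc.symm
      subst hc'
      exact ⟨h, hZ⟩
  have hZ : Measurable fun ω => (X ω).Z t := (Forest.measurable_Z t).comp hX
  rw [e, measure_iUnion, ← ENNReal.tsum_mul_left]
  · refine tsum_congr fun c => ?_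
    have hm : MeasurableSet {F : Forest x | F ∈ A c ∧ F.Z t = p ∧ c ∈ F.alivePairs t} :=
      (hA c).inter (hZp.inter (Forest.measurableSet_mem_alivePairs t c))
    have e' : {ω | X ω ∈ A c ∩ {F | F.Z t = p} ∧ 2 ≤ (X ω).Z t ∧ (X ω).Z t ≠ ⊤ ∧
        c.1 ≠ c.2 ∧ c.1 ∈ (X ω).alive t ∧ c.2 ∈ (X ω).alive t} =
        X ⁻¹' {F | F ∈ A c ∧ F.Z t = p ∧ c ∈ F.alivePairs t} := by
      ext ω
      constructor
      · rintro ⟨⟨h, hZ⟩, -, -, h3⟩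
        exact ⟨h, hZ, h3⟩
      · rintro ⟨h, hZ, h3⟩
        exact ⟨⟨h, hZ⟩, hZ ▸ h2, hZ ▸ hpt, h3⟩
    rw [hσ.law _ (hB c) c.1 c.2, e', Measure.map_apply hX hm,
      setLIntegral_congr_fun (g := fun _ => ((p : ℝ≥0∞) * ((p : ℝ≥0∞) - 1))⁻¹) (hX hm)
        fun ω hω => ?_, setLIntegral_const]
    have : (X ω).Z t = p := hω.2.1
    simp [this]
  · intro c d hcd
    refine disjoint_left.2 ?_
    rintro ω ⟨-, -, -, h⟩ ⟨-, -, -, h'⟩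
    exact hcd (h.symm.trans h')
  · intro c
    exact (hX (hB c)).inter ((hZ (to_countable {n : ℕ∞ | 2 ≤ n}).measurableSet).inter
      ((hZ (to_countable {n : ℕ∞ | n ≠ ⊤}).measurableSet).inter (hσ.measurable c.1 c.2)))

/-- The sampled individuals are alive and distinct. -/
theorem IsUniformPair.ae_mem_alivePairs (hσ : IsUniformPair P X t σ) (hX : Measurable X) :
    ∀ᵐ ω ∂P, 2 ≤ (X ω).Z t → (X ω).Z t ≠ ⊤ → σ ω ∈ (X ω).alivePairs t := by
  have h : ∀ᵐ ω ∂P, ∀ p : ℕ, 2 ≤ p → (X ω).Z t = p → σ ω ∈ (X ω).alivePairs t := by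
    refine ae_all_iff.2 fun p => ?_
    by_cases hp : 2 ≤ p
    · have := hσ.measure_mem hX (A := fun c => {F | c ∈ F.alivePairs t}ᶜ)
        (fun c => (Forest.measurableSet_mem_alivePairs t c).compl) hp
      have e : ∀ c : Individual x × Individual x,
          {F | F ∈ {F : Forest x | c ∈ F.alivePairs t}ᶜ ∧ F.Z t = p ∧ c ∈ F.alivePairs t} = ∅ :=
        fun c => eq_empty_of_forall_notMem fun F hF => hF.1 hF.2.2
      simp only [e, measure_empty, tsum_zero, mul_zero] at this
      filter_upwards [measure_eq_zero_iff_ae_notMem.1 this] with ω hω _ hZ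
      by_contra hc
      exact hω ⟨hc, hZ⟩
    · exact .of_forall fun ω h => absurd h hp
  filter_upwards [h] with ω hω h2 htop
  obtain ⟨p, hp⟩ := ENat.ne_top_iff_exists.1 htop
  rw [← hp] at h2
  exact hω p (by exact_mod_cast h2) hp.symm

theorem IsUniformPair.measure_pairs (hσ : IsUniformPair P X t σ) (hX : Measurable X) (r q : ℝ)
    (y : ℕ) {p : ℕ} (hp : 2 ≤ p) :
    (p : ℝ≥0∞) * ((p : ℝ≥0∞) - 1) *
        P {ω | ((X ω).Z r = y ∧ σ ω ∈ (X ω).pairs t q) ∧ (X ω).Z t = p} =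
      ∫⁻ F in {F | F.Z r = y ∧ F.Z t = p}, ((F.pairs t q).encard : ℝ≥0∞) ∂P.map X := by
  have h := hσ.measure_mem hX (A := fun c => {F | F.Z r = y ∧ c ∈ F.pairs t q})
    (fun c => (Forest.measurableSet_Z_eq r y).inter (Forest.measurableSet_mem_pairs t q c)) hp
  have e : ∀ c : Individual x × Individual x,
      {F | F ∈ {F : Forest x | F.Z r = y ∧ c ∈ F.pairs t q} ∧
      F.Z t = p ∧ c ∈ F.alivePairs t} =
      {F | F ∈ {F : Forest x | F.Z r = y ∧ F.Z t = p} ∧ c ∈ F.pairs t q} := by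
    intro c
    ext F
    constructor
    · rintro ⟨⟨h1, h2⟩, h3, -⟩
      exact ⟨⟨h1, h3⟩, h2⟩
    · rintro ⟨⟨h1, h3⟩, h2⟩
      exact ⟨⟨h1, h2⟩, h3, F.pairs_subset_alivePairs t q h2⟩
  simp_rw [e] at h
  rw [tsum_measure_mem_pairs] at h
  rw [← ENNReal.mul_inv_cancel_left (a := (p : ℝ≥0∞) * ((p : ℝ≥0∞) - 1))
    (natCast_mul_sub_one_ne_zero hp) (natCast_mul_sub_one_ne_top p)
    (b := ∫⁻ F in {F | F.Z r = y ∧ F.Z t = p}, ((F.pairs t q).encard : ℝ≥0∞) ∂P.map X)]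
  exact congrArg _ h

theorem IsUniformPair.measurable_splitTime (hσ : IsUniformPair P X t σ) (hX : Measurable X) :
    Measurable fun ω => (X ω).splitTime (σ ω).1 (σ ω).2 := fun _ hB =>
  hσ.measurableSet_mem hX (A := fun c => {F | F.splitTime c.1 c.2 ∈ _}) fun c =>
    Forest.measurable_splitTime c.1 c.2 hB

theorem IsUniformPair.measurableSet_pairs (hσ : IsUniformPair P X t σ) (hX : Measurable X)
    (q : ℝ) : MeasurableSet {ω | σ ω ∈ (X ω).pairs t q} :=
  hσ.measurableSet_mem hX (A := fun c => {F | c ∈ F.pairs t q}) fun c =>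
    Forest.measurableSet_mem_pairs t q c

theorem ae_forest (hX : Measurable X) {ν : Measure (Forest x)} (hXlaw : P.map X = ν)
    {Q : Forest x → Prop}
    (h : ∀ᵐ F ∂ν, Q F) : ∀ᵐ ω ∂P, Q (X ω) :=
  ae_of_ae_map hX.aemeasurable (hXlaw ▸ h)

variable (μ : Measure ℕ) [IsFiniteMeasure μ] [NeZero μ]

/-- Membership in `pairs` asks for `splitTime > t - u`, whereas `T ≤ u` only gives `≥`; the
difference is null by `ae_splitTime_ne`. -/
theorem IsUniformPair.ae_T_le_iff (hσ : IsUniformPair P X t σ) (hX : Measurable X)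
    (hXlaw : P.map X = forestLaw μ x) {u : ℝ} (hu : 0 ≤ u) (hut : u ≤ t) :
    ∀ᵐ ω ∂P, (X ω).T t (σ ω) ≤ ENNReal.ofReal u ↔
      (X ω).Z t ≠ ⊤ ∧ σ ω ∈ (X ω).pairs t (t - u) := by
  filter_upwards [hσ.ae_mem_alivePairs hX, ae_forest hX hXlaw (ae_pos_forestLaw μ x),
    ae_forest hX hXlaw (ae_splitTime_ne μ x (t - u))] with ω h1 h2 h3
  have h3' := h3 (σ ω)
  have key := h2.mem_pairs_iff (a := (σ ω).1) (b := (σ ω).2) (t := t) (sub_nonneg.2 hut)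
  constructor
  · intro hT
    have hZ : 2 ≤ (X ω).Z t ∧ (X ω).Z t ≠ ⊤ := by
      by_contra hZ
      rw [Forest.T, if_neg hZ] at hT
      exact ENNReal.ofReal_ne_top (top_le_iff.1 hT)
    have hal := h1 hZ.1 hZ.2
    rw [h2.T_eq hal hZ.2] at hT
    split_ifs at hT with hf
    · rw [ENNReal.ofReal_le_ofReal_iff hu] at hT
      exact ⟨hZ.2, key.2 ⟨hal.1, hal.2.1, hal.2.2, hf, lt_of_le_of_ne (by linarith) h3'.symm⟩⟩
    · exact absurd (top_le_iff.1 hT) ENNReal.ofReal_ne_top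
  · rintro ⟨htop, hp⟩
    obtain ⟨-, -, -, hf, hs⟩ := key.1 hp
    rw [h2.T_eq ((X ω).pairs_subset_alivePairs t _ hp) htop, if_pos hf]
    exact ENNReal.ofReal_le_ofReal (by linarith)

/-- Positivity of the elements of `B` matters because `ENNReal.ofReal` sends all nonpositive numbers
to `0`. -/
theorem IsUniformPair.ae_T_eq_iff (hσ : IsUniformPair P X t σ) (hX : Measurable X)
    (hXlaw : P.map X = forestLaw μ x) {B : Set ℝ} (hB : B ⊆ Ioi 0) :
    ∀ᵐ ω ∂P, 2 ≤ (X ω).Z t → (X ω).Z t ≠ ⊤ →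
      ((∃ u ∈ B, (X ω).T t (σ ω) = ENNReal.ofReal u) ↔
        (σ ω).1.1 = (σ ω).2.1 ∧ t - (X ω).splitTime (σ ω).1 (σ ω).2 ∈ B) := by
  filter_upwards [hσ.ae_mem_alivePairs hX, ae_forest hX hXlaw (ae_pos_forestLaw μ x)]
    with ω h1 h2 hZ htop
  rw [h2.T_eq (h1 hZ htop) htop]
  constructor
  · rintro ⟨u, hu, hT⟩
    split_ifs at hT with hf
    · refine ⟨hf, ?_⟩
      have hpos : 0 < t - (X ω).splitTime (σ ω).1 (σ ω).2 := by
        rw [← ENNReal.ofReal_pos, hT]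
        exact ENNReal.ofReal_pos.2 (hB hu)
      rwa [(ENNReal.ofReal_eq_ofReal_iff hpos.le (mem_Ioi.1 (hB hu)).le).1 hT]
    · exact absurd hT.symm ENNReal.ofReal_ne_top
  · rintro ⟨hf, h⟩
    exact ⟨_, h, if_pos hf⟩

theorem IsUniformPair.ae_splitTime_iff (hσ : IsUniformPair P X t σ) (hX : Measurable X)
    (hXlaw : P.map X = forestLaw μ x) {u : ℝ} (hut : u ≤ t) :
    ∀ᵐ ω ∂P, 2 ≤ (X ω).Z t → (X ω).Z t ≠ ⊤ →
      ((σ ω).1.1 = (σ ω).2.1 ∧ t - (X ω).splitTime (σ ω).1 (σ ω).2 ∈ Ioc 0 u ↔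
        σ ω ∈ (X ω).pairs t (t - u)) := by
  filter_upwards [hσ.ae_mem_alivePairs hX, ae_forest hX hXlaw (ae_pos_forestLaw μ x),
    ae_forest hX hXlaw (ae_splitTime_ne μ x (t - u)), ae_forest hX hXlaw (ae_splitTime_ne μ x t)]
    with ω h1 h2 h3 h4 hZ htop
  have hal := h1 hZ htop
  have key := h2.mem_pairs_iff (a := (σ ω).1) (b := (σ ω).2) (t := t) (sub_nonneg.2 hut)
  constructor
  · rintro ⟨hf, hs⟩
    exact key.2 ⟨hal.1, hal.2.1, hal.2.2, hf,
      lt_of_le_of_ne (by linarith [hs.2]) (h3 (σ ω)).symm⟩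
  · intro h
    obtain ⟨-, -, -, hf, hs⟩ := key.1 h
    have hlt := lt_of_le_of_ne (h2.splitTime_le hal.1 hf hal.2.1 hal.2.2) (h4 (σ ω))
    exact ⟨hf, by linarith, by linarith⟩

/-- The law of the coalescence time of the sampled pair. -/
theorem IsUniformPair.measure_pairs_eq_density (hσ : IsUniformPair P X t σ) (hX : Measurable X)
    (hXlaw : P.map X = forestLaw μ x) {t₂ u : ℝ} (hu : 0 ≤ u) (hut : u ≤ t₂) (ht : t₂ ≤ t)
    (y : ℕ) {p : ℕ} (hp : 2 ≤ p) :
    P {ω | ((X ω).Z (t - t₂) = y ∧ σ ω ∈ (X ω).pairs t (t - u)) ∧ (X ω).Z t = p} =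
      forestLaw μ x {F | F.Z (t - t₂) = y} * ∫⁻ v in Ioc 0 u, density μ y p t₂ v := by
  have h := hσ.measure_pairs hX (t - t₂) (t - u) y hp
  have h' := setLIntegral_pairs_eq_density μ (x := x) (sub_nonneg.2 ht) (sub_nonneg.2 hut) hu y
      (p - 2)
  rw [show t - t₂ + (t₂ - u + u) = t by ring, show t - t₂ + (t₂ - u) = t - u by ring,
    show t₂ - u + u = t₂ by ring, Nat.sub_add_cancel hp, ← hXlaw, ← h, hXlaw, mul_left_comm] at h'
  exact (ENNReal.mul_right_inj (natCast_mul_sub_one_ne_zero hp) (natCast_mul_sub_one_ne_top p)).1 h'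

theorem IsUniformPair.measure_splitTime [IsFiniteMeasure P] (hσ : IsUniformPair P X t σ)
    (hX : Measurable X)
    (hXlaw : P.map X = forestLaw μ x) {t₂ : ℝ} (ht : t₂ ≤ t)
    (y : ℕ) {p : ℕ} (hp : 2 ≤ p) {B : Set ℝ} (hB : MeasurableSet B) (hBt : B ⊆ Ioc 0 t₂) :
    P {ω | ((X ω).Z (t - t₂) = y ∧ (X ω).Z t = p ∧ (σ ω).1.1 = (σ ω).2.1) ∧
        t - (X ω).splitTime (σ ω).1 (σ ω).2 ∈ B} =
      forestLaw μ x {F | F.Z (t - t₂) = y} * ∫⁻ v in B, density μ y p t₂ v := by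
  have hm : Measurable fun ω => t - (X ω).splitTime (σ ω).1 (σ ω).2 :=
    (hσ.measurable_splitTime hX).const_sub t
  set D := {ω | (X ω).Z (t - t₂) = y ∧ (X ω).Z t = p ∧ (σ ω).1.1 = (σ ω).2.1} with hDdef
  set κ : Measure ℝ := ((P.restrict D).map fun ω => t - (X ω).splitTime (σ ω).1 (σ ω).2) with hκ
  have hκB : ∀ C, MeasurableSet C →
      κ C = P {ω | ω ∈ D ∧ t - (X ω).splitTime (σ ω).1 (σ ω).2 ∈ C} := by
    intro C hC
    rw [hκ, Measure.map_apply hm hC, Measure.restrict_apply (hm hC), inter_comm]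
    rfl
  have hIoc : ∀ u, 0 ≤ u → u ≤ t₂ → κ (Ioc 0 u) =
      forestLaw μ x {F | F.Z (t - t₂) = y} * ∫⁻ v in Ioc 0 u, density μ y p t₂ v := by
    intro u hu hut
    rw [hκB _ measurableSet_Ioc, ← hσ.measure_pairs_eq_density μ hX hXlaw hu hut ht y hp]
    refine measure_congr ?_
    filter_upwards [hσ.ae_splitTime_iff μ hX hXlaw (hut.trans ht)] with ω hω
    refine propext ?_
    constructor
    · rintro ⟨⟨h1, h2, h3⟩, h4⟩
      refine ⟨⟨h1, (hω ?_ ?_).1 ⟨h3, h4⟩⟩, h2⟩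
      · rw [h2]; exact_mod_cast hp
      · rw [h2]; exact ENat.natCast_ne_top p
    · rintro ⟨⟨h1, h4⟩, h2⟩
      have := (hω ?_ ?_).2 h4
      · exact ⟨⟨h1, h2, this.1⟩, this.2⟩
      · rw [h2]; exact_mod_cast hp
      · rw [h2]; exact ENat.natCast_ne_top p
  set ν : Measure ℝ := forestLaw μ x {F | F.Z (t - t₂) = y} •
    (volume.restrict (Ioc 0 t₂)).withDensity (density μ y p t₂) with hν
  have hνB : ∀ C, MeasurableSet C → C ⊆ Ioc 0 t₂ →
      ν C = forestLaw μ x {F | F.Z (t - t₂) = y} * ∫⁻ v in C, density μ y p t₂ v := by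
    intro C hC hCt
    rw [hν, Measure.smul_apply, smul_eq_mul, withDensity_apply _ hC,
      Measure.restrict_restrict hC, inter_eq_left.2 hCt]
  -- On `(0, t₂]` the half-lines `Iic a` cut out the intervals `(0, min t₂ a]`, where the law is
  -- known; they determine a finite measure.
  have key : κ.restrict (Ioc 0 t₂) = ν.restrict (Ioc 0 t₂) := by
    refine Measure.ext_of_Iic _ _ fun a => ?_
    rw [Measure.restrict_apply measurableSet_Iic, Measure.restrict_apply measurableSet_Iic,
      inter_comm, Ioc_inter_Iic]
    rcases le_total 0 (min t₂ a) with h | h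
    · rw [hIoc _ h (min_le_left _ _), hνB _ measurableSet_Ioc
        (Ioc_subset_Ioc_right (min_le_left _ _))]
    · simp [Ioc_eq_empty (not_lt.2 h)]
  have := congrArg (fun m => m B) key
  simp only [Measure.restrict_apply hB, inter_eq_left.2 hBt] at this
  rw [hνB B hB hBt, hκB B hB] at this
  exact this

theorem IsUniformPair.setLIntegral_T_le (hσ : IsUniformPair P X t σ) (hX : Measurable X)
    (hXlaw : P.map X = forestLaw μ x) {t₂ u : ℝ} (hu : 0 ≤ u) (hut : u ≤ t₂) (ht : t₂ ≤ t)
    (y : ℕ) {s : ℝ} (hs : s ∈ Ico (0 : ℝ) 1) :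
    ∫⁻ ω in {ω | (X ω).T t (σ ω) ≤ ENNReal.ofReal u} ∩ {ω | (X ω).Z (t - t₂) = y},
        (((X ω).Z t : ℝ≥0∞) * (((X ω).Z t : ℝ≥0∞) - 1)) *
          shiftPow (ENNReal.ofReal s) 2 ((X ω).Z t) ∂P =
      forestLaw μ x {F | F.Z (t - t₂) = y} * (y * gen' μ t₂ (ENNReal.ofReal s) *
        gen μ t₂ (ENNReal.ofReal s) ^ (y - 1) * ENNReal.ofReal (logDerivRatio μ u s)) := by
  have hZ := fun r : ℝ => (Forest.measurable_Z r).comp hX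
  have hG : MeasurableSet {ω | (X ω).Z (t - t₂) = y ∧ (X ω).Z t ≠ ⊤ ∧
      σ ω ∈ (X ω).pairs t (t - u)} :=
    (hZ _ (measurableSet_singleton _)).inter ((hZ _ (measurableSet_singleton ⊤).compl).inter
      (hσ.measurableSet_pairs hX _))
  have hae : ({ω | (X ω).T t (σ ω) ≤ ENNReal.ofReal u} ∩ {ω | (X ω).Z (t - t₂) = y} : Set Ω) =ᵐ[P]
      {ω | (X ω).Z (t - t₂) = y ∧ (X ω).Z t ≠ ⊤ ∧ σ ω ∈ (X ω).pairs t (t - u)} := by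
    filter_upwards [hσ.ae_T_le_iff μ hX hXlaw hu (hut.trans ht)] with ω hω
    exact propext ⟨fun h => ⟨h.2, hω.1 h.1⟩, fun h => ⟨hω.2 h.2, h.1⟩⟩
  have h := tsum_setLIntegral_pairs μ (x := x) (sub_nonneg.2 ht) (sub_nonneg.2 hut) hu y hs
  rw [show t₂ - u + u = t₂ by ring, show t - t₂ + (t₂ - u) = t - u by ring,
    show t - t₂ + t₂ = t by ring] at h
  have hf : Measurable fun m : ℕ∞ => (m : ℝ≥0∞) * ((m : ℝ≥0∞) - 1) := measurable_of_countable _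
  rw [setLIntegral_congr hae, ← h]
  refine (lintegral_mul_shiftPow_two _ (hZ t) (hf.comp (hZ t)) (fun ω hω => ?_) _).trans ?_
  · have : (X ω).Z t ≤ 1 := ENat.lt_add_one_iff (by simp) |>.1
        (by rw [one_add_one_eq_two]; exact hω)
    have h1 : ((X ω).Z t : ℝ≥0∞) ≤ 1 := by exact_mod_cast ENat.toENNReal_mono this
    simp [tsub_eq_zero_of_le h1]
  · refine tsum_congr fun p => ?_
    have hmp : MeasurableSet {ω | (X ω).Z t = ((p + 2 : ℕ) : ℕ∞)} := hZ t
        (measurableSet_singleton _)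
    congr 1
    rw [← hXlaw, ← hσ.measure_pairs hX (t - t₂) (t - u) y (Nat.le_add_left 2 p)]
    refine (setLIntegral_congr_fun (g := fun _ => ((p + 2 : ℕ) : ℝ≥0∞) *
      (((p + 2 : ℕ) : ℝ≥0∞) - 1)) hmp fun ω hω => ?_).trans ?_
    · have : (X ω).Z t = ((p + 2 : ℕ) : ℕ∞) := hω
      simp only [Function.comp_apply, this, ENat.toENNReal_coe]
    · rw [setLIntegral_const]
      congr 1
      rw [Measure.restrict_apply hmp]
      congr 1
      ext ω
      constructor
      · rintro ⟨h1, h2, h3, h4⟩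
        exact ⟨⟨h2, h4⟩, h1⟩
      · rintro ⟨⟨h2, h4⟩, h1⟩
        refine ⟨h1, h2, ?_, h4⟩
        rw [show (X ω).Z t = ((p + 2 : ℕ) : ℕ∞) from h1]
        exact ENat.natCast_ne_top _

end Sampling

/-- For `m = ⊤` both conventions agree: `toNat` is `0`, which kills the left side, and `shiftPow` is
`0` on the right. -/
theorem ofReal_mul_pow_toNat {s : ℝ} (hs : 0 ≤ s) (m : ℕ∞) :
    ENNReal.ofReal ((m.toNat : ℝ) * ((m.toNat : ℝ) - 1) * s ^ (m.toNat - 2)) =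
      (m : ℝ≥0∞) * ((m : ℝ≥0∞) - 1) * shiftPow (ENNReal.ofReal s) 2 m := by
  induction m using ENat.recTopCoe with
  | top => simp
  | coe n =>
    rw [shiftPow_coe, ENat.toNat_natCast, ENNReal.ofReal_mul (natCast_mul_sub_one_nonneg n),
      ofReal_natCast_mul_sub_one, ENNReal.ofReal_pow hs, ENat.toENNReal_coe]

end BGW
-- The theorem.
theorem theorem1
    (μ : Measure ℕ) [IsFiniteMeasure μ] (hμ0 : 0 < μ {0}) (hμ1 : μ {1} = 0)
    {Ω : Type*} [MeasurableSpace Ω] (P : Measure Ω) [IsProbabilityMeasure P]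
    (x : ℕ) (X : Ω → BGW.Forest x) (hX : Measurable X) (hXlaw : P.map X = BGW.forestLaw μ x)
    (t t₂ : ℝ) (ht₂ : 0 < t₂) (ht : t₂ ≤ t)
    (σ : Ω → BGW.Individual x × BGW.Individual x) (hσ : BGW.IsUniformPair P X t σ)
    (y : ℕ) (hy : 1 ≤ y) (hPy : P {ω | (X ω).Z (t - t₂) = (y : ℕ∞)} ≠ 0) :
    (∀ t₁ : ℝ, 0 < t₁ → t₁ ≤ t₂ → ∀ s ∈ Ico (0 : ℝ) 1,
      0 < deriv (BGW.ψ μ t₁) s ∧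
      IntegrableOn
        (fun ω => (((X ω).Z t).toNat : ℝ) * ((((X ω).Z t).toNat : ℝ) - 1)
          * s ^ (((X ω).Z t).toNat - 2))
        {ω | (X ω).T t (σ ω) ≤ ENNReal.ofReal t₁}
        (P[|{ω | (X ω).Z (t - t₂) = (y : ℕ∞)}]) ∧
      ∫ ω in {ω | (X ω).T t (σ ω) ≤ ENNReal.ofReal t₁},
          (((X ω).Z t).toNat : ℝ) * ((((X ω).Z t).toNat : ℝ) - 1)
            * s ^ (((X ω).Z t).toNat - 2)
          ∂(P[|{ω | (X ω).Z (t - t₂) = (y : ℕ∞)}]) =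
        (y : ℝ) * deriv (BGW.ψ μ t₂) s * BGW.ψ μ t₂ s ^ (y - 1)
          * (iteratedDeriv 2 (BGW.ψ μ t₁) s / deriv (BGW.ψ μ t₁) s)) ∧
    (∀ p : ℕ, 2 ≤ p → ∀ B : Set ℝ, MeasurableSet B → B ⊆ Ioc 0 t₂ →
      (P[|{ω | (X ω).Z (t - t₂) = (y : ℕ∞)}])
          {ω | (X ω).Z t = (p : ℕ∞) ∧ ∃ u ∈ B, (X ω).T t (σ ω) = ENNReal.ofReal u} =
        ∫⁻ t₁ in B, BGW.density μ y p t₂ t₁) := by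
  have : NeZero μ := ⟨fun h => by simp [h] at hμ0⟩
  have hZ := fun r : ℝ => (BGW.Forest.measurable_Z r).comp hX
  have hE : MeasurableSet {ω | (X ω).Z (t - t₂) = (y : ℕ∞)} := hZ _ (measurableSet_singleton _)
  have hPE : P {ω | (X ω).Z (t - t₂) = (y : ℕ∞)} =
      BGW.forestLaw μ x {F | F.Z (t - t₂) = (y : ℕ∞)} := by
    rw [← hXlaw, Measure.map_apply hX (BGW.Forest.measurableSet_Z_eq _ _)]
    rfl
  refine ⟨fun t₁ ht₁ ht₁₂ s hs => ?_, fun p hp B hB hBt => ?_⟩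
  · have hpos := BGW.deriv_ψ_pos μ ht₁.le hs
    have hval : 0 ≤ (y : ℝ) * deriv (BGW.ψ μ t₂) s * BGW.ψ μ t₂ s ^ (y - 1)
          * (iteratedDeriv 2 (BGW.ψ μ t₁) s / deriv (BGW.ψ μ t₁) s) :=
      mul_nonneg (mul_nonneg (mul_nonneg (Nat.cast_nonneg y) (BGW.deriv_ψ_pos μ ht₂.le hs).le)
        (pow_nonneg (BGW.ψ_nonneg μ t₂ hs.1) _)) (BGW.logDerivRatio_nonneg μ ht₁.le hs)
    have hlint : ∫⁻ ω in {ω | (X ω).T t (σ ω) ≤ ENNReal.ofReal t₁},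
        ENNReal.ofReal ((((X ω).Z t).toNat : ℝ) * ((((X ω).Z t).toNat : ℝ) - 1)
          * s ^ (((X ω).Z t).toNat - 2)) ∂(P[|{ω | (X ω).Z (t - t₂) = (y : ℕ∞)}]) =
        ENNReal.ofReal ((y : ℝ) * deriv (BGW.ψ μ t₂) s * BGW.ψ μ t₂ s ^ (y - 1)
          * (iteratedDeriv 2 (BGW.ψ μ t₁) s / deriv (BGW.ψ μ t₁) s)) := by
      simp_rw [BGW.ofReal_mul_pow_toNat hs.1]
      rw [ProbabilityTheory.cond, Measure.restrict_smul, lintegral_smul_measure,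
        Measure.restrict_restrict' hE, hσ.setLIntegral_T_le μ hX hXlaw ht₁.le ht₁₂ ht y hs, hPE,
        smul_eq_mul, ENNReal.inv_mul_cancel_left (hPE ▸ hPy) (measure_ne_top _ _),
        ← BGW.ofReal_deriv_ψ μ _ hs, ← BGW.ofReal_ψ μ _ hs, BGW.logDerivRatio,
        ENNReal.ofReal_mul (mul_nonneg (mul_nonneg (Nat.cast_nonneg y)
          (BGW.deriv_ψ_pos μ ht₂.le hs).le) (pow_nonneg (BGW.ψ_nonneg μ t₂ hs.1) _)),
        ENNReal.ofReal_mul (mul_nonneg (Nat.cast_nonneg y) (BGW.deriv_ψ_pos μ ht₂.le hs).le),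
        ENNReal.ofReal_mul (Nat.cast_nonneg y), ENNReal.ofReal_pow (BGW.ψ_nonneg μ t₂ hs.1),
        ENNReal.ofReal_natCast]
    have hnn : ∀ ω, 0 ≤ (((X ω).Z t).toNat : ℝ) * ((((X ω).Z t).toNat : ℝ) - 1)
        * s ^ (((X ω).Z t).toNat - 2) := fun ω =>
      mul_nonneg (BGW.natCast_mul_sub_one_nonneg _) (pow_nonneg hs.1 _)
    have hg : Measurable fun m : ℕ∞ => (m.toNat : ℝ) * ((m.toNat : ℝ) - 1) * s ^ (m.toNat - 2) :=
      measurable_of_countable _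
    have hmeas : Measurable fun ω => (((X ω).Z t).toNat : ℝ) * ((((X ω).Z t).toNat : ℝ) - 1)
        * s ^ (((X ω).Z t).toNat - 2) := hg.comp (hZ t)
    refine ⟨hpos, ⟨hmeas.aestronglyMeasurable, ?_⟩, ?_⟩
    · rw [hasFiniteIntegral_iff_ofReal (.of_forall hnn), hlint]
      exact ENNReal.ofReal_lt_top
    · rw [integral_eq_lintegral_of_nonneg_ae (.of_forall hnn) hmeas.aestronglyMeasurable, hlint,
        ENNReal.toReal_ofReal hval]
  · rw [cond_apply hE, hPE]
    have hae : P ({ω | (X ω).Z (t - t₂) = (y : ℕ∞)} ∩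
        {ω | (X ω).Z t = (p : ℕ∞) ∧ ∃ u ∈ B, (X ω).T t (σ ω) = ENNReal.ofReal u}) =
        P {ω | ((X ω).Z (t - t₂) = y ∧ (X ω).Z t = p ∧ (σ ω).1.1 = (σ ω).2.1) ∧
          t - (X ω).splitTime (σ ω).1 (σ ω).2 ∈ B} := by
      refine measure_congr ?_
      filter_upwards [hσ.ae_T_eq_iff μ hX hXlaw (hBt.trans Ioc_subset_Ioi_self)] with ω hω
      have hω' : (X ω).Z t = (p : ℕ∞) → _ := fun h =>
        hω (by rw [h]; exact_mod_cast hp) (by rw [h]; exact ENat.natCast_ne_top p)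
      refine propext ?_
      constructor
      · rintro ⟨h1, h2, h3⟩
        have := (hω' h2).1 h3
        exact ⟨⟨h1, h2, this.1⟩, this.2⟩
      · rintro ⟨⟨h1, h2, h3⟩, h4⟩
        exact ⟨h1, h2, (hω' h2).2 ⟨h3, h4⟩⟩
    rw [hae, hσ.measure_splitTime μ hX hXlaw ht y hp hB hBt,
      ENNReal.inv_mul_cancel_left (hPE ▸ hPy) (measure_ne_top _ _)]
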